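/- **Setting.** $G_a$ denotes a gamma$(a,1)$ variable ($G_0=0$), $\beta_{a,b}$ a beta$(a,b)$ variable with the convention $\beta_{1,0}=1$, $F_U$ the uniform law on $[0,1]$, and $F_W$ the law of $W=G_1/G_1'$, the ratio of two independent standard exponential variables. For $0<\sigma\le 1$ and $X$ with law $F_X$, $F_{XY_\sigma}$ is the law of $XY_\sigma$, where $Y_\sigma$ is an independent Bernoulli variable with success probability $\sigma$. A Dirichlet process $P_\theta$ with parameters $(\theta,F)$ is a random probability measure such that, for every finite measurable partition $(B_1,\dots,B_m)$, $(P_\theta(B_1),\dots,P_\theta(B_m))$ has the Dirichlet distribution with parameters $(\theta F(B_1),\dots,\theta F(B_m))$; its mean is $M_\theta(F)=\int x\,P_\theta(dx)$. A GGC$(\theta,F)$ subordinator $\zeta$ is a nondecreasing right-continuous process with $\zeta(0)=0$, independent and stationary increments and $\mathbb E[e^{-\lambda\zeta(t)}]=e^{-t\theta\psi_F(\lambda)}$ for $\lambda\ge 0$, where $\psi_F(\lambda)=\int\log(1+\lambda x)\,F(dx)$; for a Borel set $C$ of times, $\zeta(C)=\int \mathbf 1(s\in C)\,\zeta(ds)$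 (Lebesgue–Stieltjes integral). All products of random variables below are of independent factors. **Proposition 4.2.** Let $(C_1,\dots,C_k)$ be a partition of $(0,1)$ into Borel sets with Lebesgue measures $\sigma_i=|C_i|>0$. (i) If $(\tilde\zeta_1(t))_{0\le t\le 1}$ is a GGC$(1,F_U)$ subordinator, then $(\tilde\zeta_1(C_1),\dots,\tilde\zeta_1(C_k))$ has joint density $\prod_{i=1}^k g_{\sigma_i,F_U}(x_i)$ on $(0,\infty)^k$, where, for $x>0$, the following integral converges absolutely: $$g_{\sigma,F_U}(x)=\int_0^1 e^{-x/y}\,\frac{e^{\sigma}}{\pi}\sin(\pi\sigma(1-y))\,y^{\sigma(1-y)-2}(1-y)^{-\sigma(1-y)}\,dy.$$ (ii) That is, the $\tilde\zeta_1(C_i)$ are independent, and $\tilde\zeta_1(C_i)\stackrel{d}{=}G_1M_1(F_{UY_{\sigma_i}})$. Furthermore, for every $0<\sigma\le1$ the means $M_1(F_{UY_\sigma})$ and $M_\sigma(F_U)$ are almost surely finite, and $M_1(F_{UY_\sigma})\stackrel{d}{=}\beta_{\sigma,1-\sigma}M_\sigma(F_U)$ has density $$\frac{e^{\sigma}}{\pi}\sin(\pi\sigma(1-y))\,y^{\sigma(1-y)-1}(1-y)^{-\sigma(1-y)},\qquad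 0<y<1.$$ (iii) If $(\zeta_1(t))_{0\le t\le 1}$ is a GGC$(1,F_W)$ subordinator, then $(\zeta_1(C_1),\dots,\zeta_1(C_k))$ has joint density $\prod_{i=1}^k g_{\sigma_i,F_W}(x_i)$ on $(0,\infty)^k$, where, for $x>0$, the following integral converges absolutely: $$g_{\sigma,F_W}(x)=\int_0^\infty e^{-x/w}\,\frac1\pi\sin\Bigl(\frac{\pi\sigma}{1+w}\Bigr)\,w^{\frac{\sigma}{1+w}-2}\,dw.$$ (iv) That is, the $\zeta_1(C_i)$ are independent, and $\zeta_1(C_i)\stackrel{d}{=}G_1M_1(F_{WY_{\sigma_i}})$. Furthermore, for every $0<\sigma\le1$ the means $M_1(F_{WY_\sigma})$ and $M_\sigma(F_W)$ are almost surely finite, and $M_1(F_{WY_\sigma})\stackrel{d}{=}\beta_{\sigma,1-\sigma}M_\sigma(F_W)$ has density $$\frac1\pi\sin\Bigl(\frac{\pi\sigma}{1+x}\Bigr)\,x^{\frac{\sigma}{1+x}-1},\qquad x>0.$$ -/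

import Mathlib

open MeasureTheory ProbabilityTheory Set Filter Topology

noncomputable section

namespace DirichletMeans

/-- `C 0, …, C (k-1)` is a partition of `S` into pairwise disjoint measurable sets
(empty pieces are allowed). -/
structure IsMeasurablePartition {E : Type*} [MeasurableSpace E] {k : ℕ}
    (C : Fin k → Set E) (S : Set E) : Prop where
  measurableSet : ∀ i, MeasurableSet (C i)
  disjoint : ∀ i j, i ≠ j → Disjoint (C i) (C j)
  iUnion_eq : ⋃ i, C i = S

/-! ### Dirichlet processes and their means -/

/-- The gamma law with shape `a` and rate `1`; for `a = 0` it is the point mass at `0`. -/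
def gammaLaw (a : ℝ) : Measure ℝ :=
  if 0 < a then gammaMeasure a 1 else Measure.dirac 0

/-- The Dirichlet distribution with parameters `a 0, …, a (k-1)` (nonnegative, not all zero):
the law of `(G 0 / G, …, G (k-1) / G)`, where the `G i` are independent gamma variables with
shapes `a i` and `G` is their sum. -/
def dirichletLaw {k : ℕ} (a : Fin k → ℝ) : Measure (Fin k → ℝ) :=
  (Measure.pi fun i => gammaLaw (a i)).map fun g i => g i / ∑ j, g j

/-- `P` is a Dirichlet process with total mass `θ` and prior probability measure `F`: a random
probability measure whose values on the pieces of any finite measurable partition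
`C` have the Dirichlet distribution with parameters `θ F(C i)`. -/
structure IsDirichletProcess {Ω E : Type*} [MeasurableSpace Ω] [MeasurableSpace E]
    (P : Ω → Measure E) (θ : ℝ) (F : Measure E) (μ : Measure Ω) : Prop where
  measurable : Measurable P
  isProbabilityMeasure : ∀ ω, IsProbabilityMeasure (P ω)
  fidi : ∀ (k : ℕ) (C : Fin k → Set E), IsMeasurablePartition C univ →
    μ.map (fun ω i => (P ω).real (C i)) = dirichletLaw fun i => θ * F.real (C i)

/-- The mean functional `∫ x P(dx)` of a random measure on the line. -/
def meanFunctional {Ω : Type*} (P : Ω → Measure ℝ) (ω : Ω) : ℝ := ∫ x, x ∂(P ω)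

/-! ### Subordinators of generalized gamma convolution type -/

/-- The Lévy exponent `ψ_F(l) = ∫ log (1 + l x) F(dx)` (for probability measures `F` on `[0, ∞)`
for which this is finite). -/
def levyExponent (F : Measure ℝ) (l : ℝ) : ℝ := ∫ x, Real.log (1 + l * x) ∂F

/-- `ζ` is a GGC`(θ, F)` subordinator on the time interval `[0, 1]`: it starts at `0`, has
independent and stationary increments, its paths are almost surely nondecreasing and
right-continuous, and `ζ t` has Laplace transform `l ↦ exp (-t θ ψ_F(l))`. -/
structure IsGGCSubordinator {Ω : Type*} [MeasurableSpace Ω] (ζ : unitInterval → Ω → ℝ)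
    (θ : ℝ) (F : Measure ℝ) (μ : Measure Ω) : Prop where
  measurable : ∀ t, Measurable (ζ t)
  zero : ∀ᵐ ω ∂μ, ζ 0 ω = 0
  monotone : ∀ᵐ ω ∂μ, Monotone fun t => ζ t ω
  rightContinuous : ∀ᵐ ω ∂μ, ∀ t, ContinuousWithinAt (fun s => ζ s ω) (Ioi t) t
  indepIncrements : HasIndepIncrements ζ μ
  stationary : ∀ r s t : unitInterval, (s : ℝ) + r = t →
    IdentDistrib (fun ω => ζ t ω - ζ s ω) (ζ r) μ μ
  laplace : ∀ (t : unitInterval) (l : ℝ), 0 ≤ l →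
    ∫ ω, Real.exp (-(l * ζ t ω)) ∂μ = Real.exp (-(t * θ * levyExponent F l))

/-- The path `t ↦ ζ t ω` extended to the real line by its values at the endpoints. -/
def extendedPath {Ω : Type*} (ζ : unitInterval → Ω → ℝ) (ω : Ω) (t : ℝ) : ℝ :=
  ζ (projIcc 0 1 zero_le_one t) ω

open Classical in
/-- The Lebesgue–Stieltjes measure `ζ(ds)` of the path `t ↦ ζ t ω` (zero on the exceptional
event that this path is not nondecreasing). -/
def pathMeasure {Ω : Type*} (ζ : unitInterval → Ω → ℝ) (ω : Ω) : Measure ℝ :=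
  if h : Monotone (extendedPath ζ ω) then h.stieltjesFunction.measure else 0

/-- The increment `ζ(C) = ∫ 1(s ∈ C) ζ(ds)` of the process over a set `C` of times. -/
def increment {Ω : Type*} (ζ : unitInterval → Ω → ℝ) (C : Set ℝ) (ω : Ω) : ℝ :=
  (pathMeasure ζ ω).real C

/-! ### The laws -/

/-- The law `F_U` of a uniform variable on `[0, 1]`. -/
def lawU : Measure ℝ := volume.restrict (Icc 0 1)

/-- The law `F_W` of the ratio of two independent standard exponential variables. -/
def lawW : Measure ℝ := ((expMeasure 1).prod (expMeasure 1)).map fun p => p.1 / p.2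

/-- The law of a Bernoulli variable `Y_σ` with success probability `σ`. -/
def bernoulliLaw (σ : ℝ) : Measure ℝ :=
  ENNReal.ofReal σ • Measure.dirac 1 + ENNReal.ofReal (1 - σ) • Measure.dirac 0

/-- The law `F_{XY_σ}` of `X Y_σ`, where `X` has law `F` and `Y_σ` is an independent
Bernoulli variable with success probability `σ`. -/
def thinnedLaw (F : Measure ℝ) (σ : ℝ) : Measure ℝ := F.mconv (bernoulliLaw σ)

/-- The law of `β_{σ,1-σ}` for `0 < σ ≤ 1`, with the convention `β_{1,0} = 1`. -/
def symmetricBetaLaw (σ : ℝ) : Measure ℝ :=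
  if σ < 1 then betaMeasure σ (1 - σ) else Measure.dirac 1

/-! ### The densities -/

/-- The density of `M_1(F_{UY_σ})`. -/
def meanDensityU (σ y : ℝ) : ℝ :=
  if 0 < y ∧ y < 1 then
    Real.exp σ / Real.pi * Real.sin (Real.pi * σ * (1 - y)) *
      y ^ (σ * (1 - y) - 1) * (1 - y) ^ (-(σ * (1 - y)))
  else 0

/-- The density of `M_1(F_{WY_σ})`. -/
def meanDensityW (σ x : ℝ) : ℝ :=
  if 0 < x then
    1 / Real.pi * Real.sin (Real.pi * σ / (1 + x)) * x ^ (σ / (1 + x) - 1)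
  else 0

/-- The integrand in the gamma mixture `g_{σ,F_U}(x)`. -/
def mixtureIntegrandU (σ x y : ℝ) : ℝ :=
  Real.exp (-(x / y)) * (Real.exp σ / Real.pi) * Real.sin (Real.pi * σ * (1 - y)) *
    y ^ (σ * (1 - y) - 2) * (1 - y) ^ (-(σ * (1 - y)))

/-- The integrand in the gamma mixture `g_{σ,F_W}(x)`. -/
def mixtureIntegrandW (σ x w : ℝ) : ℝ :=
  Real.exp (-(x / w)) * (1 / Real.pi) * Real.sin (Real.pi * σ / (1 + w)) *
    w ^ (σ / (1 + w) - 2)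

/-- The density `g_{σ,F_U}`, carried by `(0, ∞)`. -/
def mixtureDensityU (σ x : ℝ) : ℝ :=
  if 0 < x then ∫ y in Ioo (0 : ℝ) 1, mixtureIntegrandU σ x y else 0

/-- The density `g_{σ,F_W}`, carried by `(0, ∞)`. -/
def mixtureDensityW (σ x : ℝ) : ℝ :=
  if 0 < x then ∫ w in Ioi (0 : ℝ), mixtureIntegrandW σ x w else 0

end DirichletMeans

end

/-! Everything is read off one function. Let ψ be the Lévy exponent of the prior F. Then exp(-σψ(l))
appears as a transform in several ways. (a) It is the Laplace transform of the increment over a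
Borel set of measure σ, and over disjoint sets these transforms multiply
(`IsGGCSubordinator.laplace_increment`). Independent stationary increments give the Laplace
functional on grids, Riemann–Stieltjes sums extend it to continuous functions, and an L¹
approximation extends it to bounded measurable ones. Since F may have infinite mean, the
approximation uses an intensity weighted by an exponential of the total mass. (b) A Dirichlet mean
satisfies E(1 + l M_θ)^(-θ) = exp(-θψ(l)) (`IsDirichletProcess.lintegral_meanFunctional`), because
Dirichlet proportions times an independent gamma total are independent gamma variables. Thinning the
prior multiplies ψ by σ, and averaging 1/(1 + l β m) over β with law beta(σ, 1-σ) gives (1 + l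
m)^(-σ). Hence M_1 of the thinned prior and β M_σ(F) both have Stieltjes transform exp(-σψ(l)). (c)
Multiplying by an independent standard exponential variable turns a Stieltjes transform into a
Laplace transform. This identifies the increment with G_1 M_1 and, together with uniqueness of
Laplace transforms, shows that a law on [0, ∞) is determined by its Stieltjes transform
(`ext_of_stieltjes`). It remains to see that the explicit densities have this Stieltjes transform.
For W, ψ(l) = l log l / (l - 1), so with l = e^(-a) the target is f(a) for f(w) = exp(-σ w / (e^w -
1)), analytic in |Im w| < 2π. Cauchy's theorem for (f(w) - f(a)) / (e^w - e^a) on the rectangles |Re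
w| ≤ R, |Im w| ≤ π does the rest: the two horizontal sides combine to the density in the variable x
= e^u, the left side tends to a multiple of f(a), and the right side vanishes
(`lintegral_lineIntegrand`). The uniform case follows by x = y / (1 - y), since ψ_U(l) = ψ_W(1 + l)
- 1. -/

open scoped NNReal ENNReal

namespace DirichletMeans

/-! ### Uniqueness of Laplace transforms -/

/-- The function `x ↦ exp (-⟨l, x⟩)` on the nonnegative orthant. -/
noncomputable def expNegInner {ι : Type*} [Fintype ι] (l : ι → ℝ≥0) :
    BoundedContinuousFunction (ι → ℝ≥0) ℝ :=
  BoundedContinuousFunction.ofNormedAddCommGroup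
    (fun x => Real.exp (-∑ i, (l i : ℝ) * x i)) (by fun_prop) 1 (by
      intro x
      rw [Real.norm_eq_abs, abs_of_pos (Real.exp_pos _)]
      exact Real.exp_le_one_iff.2 (neg_nonpos.2 (by positivity)))

/-- The unital algebra generated by the functions `x ↦ exp (-⟨l, x⟩)`. -/
noncomputable def expNegInnerAlgebra (ι : Type*) [Fintype ι] :
    StarSubalgebra ℝ (BoundedContinuousFunction (ι → ℝ≥0) ℝ) where
  toSubalgebra := Algebra.adjoin ℝ (range expNegInner)
  star_mem' := by
    intro a ha
    have : star a = a := by ext; simp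
    rwa [this]

/-- An algebra of bounded continuous functions that separates points determines a finite measure on
a Polish space. Working over `ℝ≥0` is what makes the exponentials bounded. -/
theorem ext_of_laplace_nnreal {ι : Type*} [Fintype ι] {μ ν : Measure (ι → ℝ≥0)}
    [IsFiniteMeasure μ] [IsFiniteMeasure ν]
    (h : ∀ l : ι → ℝ≥0, ∫ x, Real.exp (-∑ i, (l i : ℝ) * x i) ∂μ =
      ∫ x, Real.exp (-∑ i, (l i : ℝ) * x i) ∂ν) : μ = ν := by
  classical
  refine ext_of_forall_mem_subalgebra_integral_eq_of_polish (𝕜 := ℝ)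
    (A := expNegInnerAlgebra ι) ?_ ?_
  · intro x y hxy
    obtain ⟨i, hi⟩ := Function.ne_iff.1 hxy
    refine ⟨expNegInner (Pi.single i 1), ⟨_, ⟨expNegInner (Pi.single i 1),
      Algebra.subset_adjoin ⟨_, rfl⟩, rfl⟩, rfl⟩, ?_⟩
    simp only [expNegInner, BoundedContinuousFunction.coe_ofNormedAddCommGroup]
    rw [Ne, Real.exp_eq_exp, neg_inj]
    rw [Finset.sum_eq_single i, Finset.sum_eq_single i] <;> simp_all
  · intro g hg
    have hg' : g ∈ Submodule.span ℝ (range (expNegInner (ι := ι))) := by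
      -- The exponentials are already closed under products, since exponents add. The algebra they
      -- generate is therefore their linear span, and the hypothesis extends by linearity.
      have h1 : ((Submonoid.closure (range (expNegInner (ι := ι))) :
          Submonoid (BoundedContinuousFunction (ι → ℝ≥0) ℝ)) :
          Set (BoundedContinuousFunction (ι → ℝ≥0) ℝ)) ⊆ range expNegInner := by
        intro f hf
        induction hf using Submonoid.closure_induction with
        | mem f hf => exact hf
        | one => exact ⟨0, by ext; simp [expNegInner]⟩
        | mul f g _ _ hf hg =>
          obtain ⟨a, rfl⟩ := hf
          obtain ⟨b, rfl⟩ := hg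
          refine ⟨a + b, ?_⟩
          ext x
          simp only [expNegInner, BoundedContinuousFunction.coe_ofNormedAddCommGroup,
            BoundedContinuousFunction.coe_mul, Pi.mul_apply, Pi.add_apply]
          rw [← Real.exp_add, ← neg_add, ← Finset.sum_add_distrib]
          simp [add_mul]
      have h2 : g ∈ Subalgebra.toSubmodule (Algebra.adjoin ℝ (range (expNegInner (ι := ι)))) := hg
      rw [Algebra.adjoin_eq_span] at h2
      exact Submodule.span_mono h1 h2
    clear hg
    induction hg' using Submodule.span_induction with
    | mem f hf => obtain ⟨l, rfl⟩ := hf; exact h l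
    | zero => simp
    | add f g _ _ hf hg =>
      simp only [BoundedContinuousFunction.coe_add, Pi.add_apply]
      rw [integral_add (f.integrable μ) (g.integrable μ),
        integral_add (f.integrable ν) (g.integrable ν), hf, hg]
    | smul c f _ hf =>
      simp only [BoundedContinuousFunction.coe_smul, smul_eq_mul]
      rw [integral_const_mul, integral_const_mul, hf]

theorem ext_of_laplace_pi {ι : Type*} [Fintype ι] {μ ν : Measure (ι → ℝ)}
    [IsFiniteMeasure μ] [IsFiniteMeasure ν]
    (hμ : ∀ᵐ x ∂μ, ∀ i, 0 ≤ x i) (hν : ∀ᵐ x ∂ν, ∀ i, 0 ≤ x i)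
    (h : ∀ l : ι → ℝ, (∀ i, 0 ≤ l i) → ∫ x, Real.exp (-∑ i, l i * x i) ∂μ =
      ∫ x, Real.exp (-∑ i, l i * x i) ∂ν) : μ = ν := by
  have hm : Measurable fun (x : ι → ℝ) i => (x i).toNNReal := by fun_prop
  have hc : Measurable fun (x : ι → ℝ≥0) i => (x i : ℝ) := by fun_prop
  have key : ∀ ρ : Measure (ι → ℝ), (∀ᵐ x ∂ρ, ∀ i, 0 ≤ x i) →
      (ρ.map fun x i => (x i).toNNReal).map (fun x i => (x i : ℝ)) = ρ := by
    intro ρ hρ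
    rw [Measure.map_map hc hm]
    conv_rhs => rw [← Measure.map_id (μ := ρ)]
    refine Measure.map_congr ?_
    filter_upwards [hρ] with x hx
    ext i
    simp [hx i]
  rw [← key μ hμ, ← key ν hν]
  congr 1
  refine ext_of_laplace_nnreal fun l => ?_
  have hF : ∀ ρ : Measure (ι → ℝ), (∀ᵐ x ∂ρ, ∀ i, 0 ≤ x i) →
      ∫ x, Real.exp (-∑ i, (l i : ℝ) * x i) ∂(ρ.map fun x i => (x i).toNNReal) =
      ∫ x, Real.exp (-∑ i, (l i : ℝ) * x i) ∂ρ := by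
    intro ρ hρ
    rw [integral_map hm.aemeasurable (Continuous.aestronglyMeasurable (by fun_prop))]
    refine integral_congr_ae ?_
    filter_upwards [hρ] with x hx
    simp [hx]
  rw [hF μ hμ, hF ν hν]
  exact h (fun i => (l i : ℝ)) fun i => (l i).2

theorem ext_of_laplace {μ ν : Measure ℝ} [IsFiniteMeasure μ] [IsFiniteMeasure ν]
    (hμ : ∀ᵐ x ∂μ, 0 ≤ x) (hν : ∀ᵐ x ∂ν, 0 ≤ x)
    (h : ∀ l : ℝ, 0 ≤ l → ∫⁻ x, ENNReal.ofReal (Real.exp (-(l * x))) ∂μ =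
      ∫⁻ x, ENNReal.ofReal (Real.exp (-(l * x))) ∂ν) : μ = ν := by
  let e := MeasurableEquiv.funUnique Unit ℝ
  refine e.symm.measurableEmbedding.map_injective ?_
  have hes : ∀ x i, e.symm x i = x := fun x i => rfl
  refine ext_of_laplace_pi ?_ ?_ fun l hl => ?_
  · rw [e.symm.measurableEmbedding.ae_map_iff]; simpa [hes] using hμ
  · rw [e.symm.measurableEmbedding.ae_map_iff]; simpa [hes] using hν
  · rw [e.symm.measurableEmbedding.integral_map, e.symm.measurableEmbedding.integral_map]
    simp only [hes, Finset.univ_unique, Finset.sum_singleton]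
    rw [integral_eq_lintegral_of_nonneg_ae (ae_of_all _ fun _ => (Real.exp_pos _).le)
      (Continuous.aestronglyMeasurable (by fun_prop)),
      integral_eq_lintegral_of_nonneg_ae (ae_of_all _ fun _ => (Real.exp_pos _).le)
      (Continuous.aestronglyMeasurable (by fun_prop)), h _ (hl _)]

/-! ### Exponential mixtures and Stieltjes transforms -/

theorem lintegral_Ioi_comp_mul {y : ℝ} (hy : 0 < y) (F : ℝ → ℝ≥0∞) :
    ∫⁻ x in Ioi 0, F x = ∫⁻ x in Ioi 0, ENNReal.ofReal y * F (x * y) := by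
  have h := lintegral_image_eq_lintegral_abs_deriv_mul (s := Ioi (0 : ℝ)) (f := fun x => x * y)
    (f' := fun _ => y) measurableSet_Ioi
    (fun x _ => by simpa using ((hasDerivAt_id x).mul_const y).hasDerivWithinAt)
    (fun a _ b _ hab => mul_right_cancel₀ hy.ne' hab) F
  have him : (fun x => x * y) '' Ioi (0 : ℝ) = Ioi 0 := by
    ext z
    constructor
    · rintro ⟨x, hx, rfl⟩
      exact mul_pos hx hy
    · intro hz
      exact ⟨z / y, div_pos hz hy, div_mul_cancel₀ _ hy.ne'⟩
  rw [him] at h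
  rw [h, abs_of_pos hy]

theorem gammaMeasure_eq_withDensity_Ioi (a r : ℝ) :
    gammaMeasure a r = (volume.restrict (Ioi 0)).withDensity
      fun x => ENNReal.ofReal (r ^ a / Real.Gamma a * x ^ (a - 1) * Real.exp (-(r * x))) := by
  rw [gammaMeasure, ← withDensity_indicator measurableSet_Ioi]
  refine withDensity_congr_ae ?_
  -- The two densities can differ only at the null point 0.
  filter_upwards [Measure.ae_ne volume (0 : ℝ)] with x hx
  rcases lt_or_gt_of_ne hx with h | h
  · rw [gammaPDF_of_neg h, indicator_of_notMem (notMem_Ioi.2 h.le)]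
  · rw [gammaPDF_of_nonneg h.le, indicator_of_mem (mem_Ioi.2 h)]

instance isProbabilityMeasure_expMeasure_one : IsProbabilityMeasure (expMeasure 1) :=
  isProbabilityMeasure_expMeasure one_pos

theorem gammaMeasure_ae_pos (a r : ℝ) : ∀ᵐ x ∂gammaMeasure a r, 0 < x := by
  rw [gammaMeasure_eq_withDensity_Ioi]
  exact (withDensity_absolutelyContinuous _ _).ae_le (ae_restrict_mem measurableSet_Ioi)

theorem lintegral_expMeasure {f : ℝ → ℝ≥0∞} (hf : Measurable f) :
    ∫⁻ x, f x ∂expMeasure 1 = ∫⁻ x in Ioi 0, ENNReal.ofReal (Real.exp (-x)) * f x := by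
  rw [expMeasure, gammaMeasure_eq_withDensity_Ioi, lintegral_withDensity_eq_lintegral_mul _
    (by fun_prop) hf]
  simp

/-- Exponential tilting raises the rate from r to r + l. The constant left over is the Laplace
transform, because the tilted density integrates to 1. -/
theorem gammaPDF_mul_exp {a r l : ℝ} (ha : 0 < a) (hr : 0 < r) (hl : 0 ≤ l) (x : ℝ) :
    gammaPDF a r x * ENNReal.ofReal (Real.exp (-(l * x))) =
      ENNReal.ofReal ((1 + l / r) ^ (-a)) * gammaPDF a (r + l) x := by
  rcases lt_or_ge x 0 with hx | hx
  · simp [gammaPDF_of_neg hx]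
  · rw [gammaPDF_of_nonneg hx, gammaPDF_of_nonneg hx,
      ← ENNReal.ofReal_mul' (Real.exp_pos _).le, ← ENNReal.ofReal_mul (by positivity)]
    congr 1
    have h1 : 1 + l / r = (r + l) / r := by field_simp
    rw [h1, Real.div_rpow (by positivity) hr.le, Real.rpow_neg (by positivity),
      Real.rpow_neg hr.le, add_mul, neg_add, Real.exp_add]
    have := (Real.rpow_pos_of_pos (by positivity : 0 < r + l) a).ne'
    have := (Real.rpow_pos_of_pos hr a).ne'
    field_simp

theorem lintegral_exp_gammaMeasure {a l : ℝ} (ha : 0 < a) (hl : 0 ≤ l) :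
    ∫⁻ x, ENNReal.ofReal (Real.exp (-(l * x))) ∂gammaMeasure a 1 =
      ENNReal.ofReal ((1 + l) ^ (-a)) := by
  have hm : Measurable (gammaPDF a 1) := (measurable_gammaPDFReal a 1).ennreal_ofReal
  rw [gammaMeasure, lintegral_withDensity_eq_lintegral_mul _ hm (by fun_prop)]
  simp only [Pi.mul_apply]
  simp_rw [gammaPDF_mul_exp ha one_pos hl]
  rw [lintegral_const_mul' _ _ ENNReal.ofReal_ne_top,
    lintegral_gammaPDF_eq_one ha (by positivity)]
  simp

theorem ae_nonneg_mconv {μ ν : Measure ℝ} [SFinite μ] [SFinite ν] (hμ : ∀ᵐ x ∂μ, 0 ≤ x)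
    (hν : ∀ᵐ x ∂ν, 0 ≤ x) : ∀ᵐ x ∂(μ.mconv ν), 0 ≤ x := by
  rw [Measure.mconv, ae_map_iff (by fun_prop) measurableSet_Ici]
  filter_upwards [Measure.quasiMeasurePreserving_fst.ae hμ,
    Measure.quasiMeasurePreserving_snd.ae hν] with p h1 h2
  exact mul_nonneg h1 h2

theorem lintegral_mconv_symm {μ ν : Measure ℝ} [SFinite μ] [SFinite ν] {f : ℝ → ℝ≥0∞}
    (hf : Measurable f) : ∫⁻ z, f z ∂(μ.mconv ν) = ∫⁻ y, ∫⁻ x, f (x * y) ∂μ ∂ν := by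
  rw [Measure.lintegral_mconv_eq_lintegral_prod hf, lintegral_prod_symm _ (by fun_prop)]

theorem lintegral_exp_gamma_mconv {a : ℝ} (ha : 0 < a) {ν : Measure ℝ} [SFinite ν]
    (hν : ∀ᵐ x ∂ν, 0 ≤ x) {l : ℝ} (hl : 0 ≤ l) :
    ∫⁻ z, ENNReal.ofReal (Real.exp (-(l * z))) ∂((gammaMeasure a 1).mconv ν) =
      ∫⁻ x, ENNReal.ofReal ((1 + l * x) ^ (-a)) ∂ν := by
  have := isProbabilityMeasure_gammaMeasure ha one_pos
  rw [lintegral_mconv_symm (by fun_prop)]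
  refine lintegral_congr_ae ?_
  filter_upwards [hν] with y hy
  rw [← lintegral_exp_gammaMeasure ha (by positivity)]
  refine lintegral_congr fun x => ?_
  congr 3
  ring

/-- The bridge between the two transforms: conditionally on the second factor x, the exponential
variable contributes 1 / (1 + l x). -/
theorem lintegral_exp_expMeasure_mconv {ν : Measure ℝ} [SFinite ν]
    (hν : ∀ᵐ x ∂ν, 0 ≤ x) {l : ℝ} (hl : 0 ≤ l) :
    ∫⁻ z, ENNReal.ofReal (Real.exp (-(l * z))) ∂((expMeasure 1).mconv ν) =
      ∫⁻ x, ENNReal.ofReal ((1 + l * x)⁻¹) ∂ν := by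
  rw [expMeasure, lintegral_exp_gamma_mconv one_pos hν hl]
  simp [Real.rpow_neg_one]

theorem expMeasure_Ioi {s : ℝ} (hs : 0 ≤ s) :
    expMeasure 1 (Ioi s) = ENNReal.ofReal (Real.exp (-s)) := by
  rw [← compl_Iic, prob_compl_eq_one_sub measurableSet_Iic, ← ofReal_cdf,
    cdf_expMeasure_eq one_pos, if_pos hs, ← ENNReal.ofReal_one,
    ← ENNReal.ofReal_sub _ (by simp [hs])]
  simp

/-- P(G X > t) = E[exp(-t / X); X > 0], so the tail of the mixture is itself a Laplace transform in
t, namely that of 1 / X away from the atom of X at 0. -/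
theorem expMeasure_mconv_Ioi {ν : Measure ℝ} [SFinite ν]
    (hν : ∀ᵐ x ∂ν, 0 ≤ x) {t : ℝ} (ht : 0 ≤ t) :
    (expMeasure 1).mconv ν (Ioi t) =
      ∫⁻ y in Ioi 0, ENNReal.ofReal (Real.exp (-(t * y⁻¹))) ∂ν := by
  rw [← lintegral_indicator_one measurableSet_Ioi,
    lintegral_mconv_symm (measurable_one.indicator measurableSet_Ioi),
    ← lintegral_indicator measurableSet_Ioi]
  refine lintegral_congr_ae ?_
  filter_upwards [hν] with y hy
  rcases hy.eq_or_lt with rfl | hy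
  · simp [ht.not_gt]
  · rw [indicator_of_mem (mem_Ioi.2 hy), ← expMeasure_Ioi (by positivity),
      ← lintegral_indicator_one measurableSet_Ioi]
    refine lintegral_congr fun x => ?_
    simp [indicator_apply, ← div_eq_mul_inv, div_lt_iff₀ hy]

/-- A finite measure on `[0, ∞)` is determined by its Stieltjes transform. -/
theorem ext_of_stieltjes {ν₁ ν₂ : Measure ℝ} [IsFiniteMeasure ν₁] [IsFiniteMeasure ν₂]
    (h₁ : ∀ᵐ x ∂ν₁, 0 ≤ x) (h₂ : ∀ᵐ x ∂ν₂, 0 ≤ x)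
    (h : ∀ l : ℝ, 0 ≤ l → ∫⁻ x, ENNReal.ofReal ((1 + l * x)⁻¹) ∂ν₁ =
      ∫⁻ x, ENNReal.ofReal ((1 + l * x)⁻¹) ∂ν₂) : ν₁ = ν₂ := by
  have hexp : ∀ᵐ x ∂expMeasure 1, (0 : ℝ) ≤ x :=
    (gammaMeasure_ae_pos 1 1).mono fun _ hx => hx.le
  have hconv : (expMeasure 1).mconv ν₁ = (expMeasure 1).mconv ν₂ :=
    ext_of_laplace (ae_nonneg_mconv hexp h₁) (ae_nonneg_mconv hexp h₂) fun l hl => by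
      rw [lintegral_exp_expMeasure_mconv h₁ hl, lintegral_exp_expMeasure_mconv h₂ hl, h l hl]
  have hinv : ∀ ν : Measure ℝ, ∀ᵐ x ∂(ν.restrict (Ioi 0)).map (·⁻¹), (0 : ℝ) ≤ x := by
    intro ν
    rw [ae_map_iff measurable_inv.aemeasurable measurableSet_Ici]
    filter_upwards [ae_restrict_mem measurableSet_Ioi] with x hx
    exact inv_nonneg.2 (le_of_lt hx)
  -- The mixtures agree, hence so do their tails, which are the Laplace transforms of the images of
  -- the two measures under inversion.
  have hrestr : ν₁.restrict (Ioi 0) = ν₂.restrict (Ioi 0) := by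
    have : (ν₁.restrict (Ioi 0)).map (·⁻¹) = (ν₂.restrict (Ioi 0)).map (·⁻¹) := by
      refine ext_of_laplace (hinv _) (hinv _) fun l hl => ?_
      rw [lintegral_map (by fun_prop) measurable_inv, lintegral_map (by fun_prop) measurable_inv,
        ← expMeasure_mconv_Ioi h₁ hl, ← expMeasure_mconv_Ioi h₂ hl, hconv]
    have h3 := congrArg (Measure.map (·⁻¹)) this
    have hid : (fun x : ℝ => x⁻¹) ∘ (fun x : ℝ => x⁻¹) = id := by ext; simp
    rwa [Measure.map_map measurable_inv measurable_inv,
      Measure.map_map measurable_inv measurable_inv, hid, Measure.map_id, Measure.map_id] at h3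
  have hzero : ∀ ν : Measure ℝ, (∀ᵐ x ∂ν, 0 ≤ x) → ν.restrict (Iic 0) = ν {0} • Measure.dirac 0 := by
    intro ν hν
    rw [← Measure.restrict_singleton]
    refine Measure.restrict_congr_set ?_
    filter_upwards [hν] with x hx
    exact propext ⟨fun h => le_antisymm h hx, fun h => le_of_eq h⟩
  have hmass : ∀ ν : Measure ℝ, (∀ᵐ x ∂ν, 0 ≤ x) → ν univ = ν {0} + ν.restrict (Ioi 0) univ := by
    intro ν hν
    rw [Measure.restrict_apply_univ, ← measure_add_measure_compl (measurableSet_Iic (a := (0 : ℝ))),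
      compl_Iic, ← Measure.restrict_apply_univ (Iic 0), hzero ν hν]
    simp
  -- Inversion does not see the atom at 0. It is recovered from the total mass, which is the
  -- transform at l = 0.
  have h0 : ν₁ {0} = ν₂ {0} := by
    have hu : ν₁ univ = ν₂ univ := by simpa using h 0 le_rfl
    rw [hmass _ h₁, hmass _ h₂, hrestr] at hu
    exact (ENNReal.add_left_inj (measure_ne_top _ _)).1 hu
  rw [← Measure.restrict_add_restrict_compl (μ := ν₁) (measurableSet_Iic (a := (0 : ℝ))),
    ← Measure.restrict_add_restrict_compl (μ := ν₂) (measurableSet_Iic (a := (0 : ℝ))),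
    compl_Iic, hrestr, hzero _ h₁, hzero _ h₂, h0]

/-- The law of an exponential mixture with mixing density `f` on `(0, ∞)`. -/
theorem expMeasure_mconv_withDensity {f : ℝ → ℝ≥0∞} (hf : Measurable f)
    (hf0 : ∀ x ≤ 0, f x = 0) [SFinite (volume.withDensity f)] :
    (expMeasure 1).mconv (volume.withDensity f) = volume.withDensity fun x =>
      (Ioi 0).indicator (fun x =>
        ∫⁻ y in Ioi 0, ENNReal.ofReal (Real.exp (-(x / y)) * y⁻¹) * f y) x := by
  have hf' : volume.withDensity f = (volume.restrict (Ioi 0)).withDensity f := by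
    rw [← withDensity_indicator measurableSet_Ioi]
    congr 1
    ext x
    by_cases hx : 0 < x
    · simp [hx]
    · simp [hx, hf0 x (not_lt.1 hx)]
  ext s hs
  have hind : Measurable (s.indicator (1 : ℝ → ℝ≥0∞)) := measurable_one.indicator hs
  rw [← lintegral_indicator_one hs, lintegral_mconv_symm hind,
    withDensity_apply _ hs, ← lintegral_indicator hs, hf',
    lintegral_withDensity_eq_lintegral_mul _ hf (by fun_prop)]
  simp only [Pi.mul_apply]
  -- For fixed y, rescaling by y turns the standard exponential law into the one with mean y, whose
  -- density is exp(-x / y) / y. Tonelli then exchanges x and y.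
  have hinner : ∀ y ∈ Ioi (0 : ℝ), f y * ∫⁻ x, s.indicator 1 (x * y) ∂expMeasure 1 =
      ∫⁻ x in Ioi 0, s.indicator 1 x * (ENNReal.ofReal (Real.exp (-(x / y)) * y⁻¹) * f y) := by
    intro y hy
    have hy' : (0 : ℝ) < y := hy
    rw [lintegral_expMeasure (by fun_prop), lintegral_Ioi_comp_mul hy' (fun x =>
      s.indicator 1 x * (ENNReal.ofReal (Real.exp (-(x / y)) * y⁻¹) * f y)),
      ← lintegral_const_mul _ (by fun_prop)]
    refine lintegral_congr fun x => ?_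
    rw [mul_div_cancel_right₀ _ hy'.ne', ENNReal.ofReal_mul (Real.exp_pos _).le]
    have h1 : ENNReal.ofReal y * ENNReal.ofReal y⁻¹ = 1 := by
      rw [← ENNReal.ofReal_mul hy'.le, mul_inv_cancel₀ hy'.ne', ENNReal.ofReal_one]
    calc _ = f y * (ENNReal.ofReal (Real.exp (-x)) * s.indicator 1 (x * y)) * 1 := by ring
      _ = _ := by rw [← h1]; ring
  rw [setLIntegral_congr_fun measurableSet_Ioi hinner,
    lintegral_lintegral_swap (by fun_prop), ← lintegral_indicator measurableSet_Ioi]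
  refine lintegral_congr fun x => ?_
  by_cases hx : x ∈ s <;> by_cases hx0 : 0 < x <;> simp [hx, hx0]

/-! ### A contour integral -/

/-- `exp (-σ w / (exp w - 1))`, extended analytically to `w = 0`. -/
noncomputable def stripFun (σ : ℝ) (w : ℂ) : ℂ :=
  Complex.exp (-(σ / dslope Complex.exp 0 w))

/-- The difference quotient of `stripFun σ` with respect to `exp` at `a`. -/
noncomputable def stripQuotient (σ a : ℝ) (w : ℂ) : ℂ :=
  dslope (stripFun σ) a w / dslope Complex.exp a w

/-- The open strip of height `4π` about the real axis. -/
def openStrip : Set ℂ := {w | |w.im| < 2 * Real.pi}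

theorem isOpen_openStrip : IsOpen openStrip :=
  isOpen_lt (by fun_prop) continuous_const

theorem ofReal_mem_openStrip (a : ℝ) : (a : ℂ) ∈ openStrip := by
  simp [openStrip, Real.pi_pos]

/-- Equal exponentials differ by a multiple of 2πi, and the strip leaves only the multiple 0 because
a is real. So all denominators below vanish only at removable points, while the strip still contains
the closed rectangles |Im w| ≤ π. -/
theorem exp_ne_exp_of_mem_openStrip {w : ℂ} (hw : w ∈ openStrip) {a : ℝ} (h : w ≠ a) :
    Complex.exp w ≠ Complex.exp a := by
  intro he
  obtain ⟨n, hn⟩ := Complex.exp_eq_exp_iff_exists_int.1 he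
  have him : w.im = n * (2 * Real.pi) := by rw [hn]; simp
  have hlt : |w.im| < 2 * Real.pi := hw
  rw [him, abs_mul, abs_of_pos Real.two_pi_pos] at hlt
  have h1 : |(n : ℝ)| < 1 := by nlinarith [Real.two_pi_pos]
  have h2 : n = 0 := by
    have : |n| < 1 := by exact_mod_cast h1
    exact Int.abs_lt_one_iff.1 this
  exact h (by rw [hn, h2]; simp)

theorem dslope_exp_ne_zero {w : ℂ} (hw : w ∈ openStrip) (a : ℝ) :
    dslope Complex.exp a w ≠ 0 := by
  rcases eq_or_ne w a with rfl | h
  · simp [dslope_same]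
  · rw [dslope_of_ne _ h, slope_def_field]
    exact div_ne_zero (sub_ne_zero.2 (exp_ne_exp_of_mem_openStrip hw h)) (sub_ne_zero.2 h)

theorem differentiableOn_dslope_exp (a : ℝ) :
    DifferentiableOn ℂ (dslope Complex.exp a) openStrip :=
  (Complex.differentiableOn_dslope (isOpen_openStrip.mem_nhds (ofReal_mem_openStrip a))).2
    Complex.differentiable_exp.differentiableOn

theorem differentiableOn_stripFun (σ : ℝ) : DifferentiableOn ℂ (stripFun σ) openStrip := by
  refine DifferentiableOn.cexp (DifferentiableOn.neg ?_)
  refine DifferentiableOn.div (differentiableOn_const _) ?_ fun w hw => ?_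
  · simpa using differentiableOn_dslope_exp 0
  · simpa using dslope_exp_ne_zero hw 0

theorem differentiableOn_stripQuotient (σ a : ℝ) :
    DifferentiableOn ℂ (stripQuotient σ a) openStrip :=
  ((Complex.differentiableOn_dslope (isOpen_openStrip.mem_nhds (ofReal_mem_openStrip a))).2
    (differentiableOn_stripFun σ)).div (differentiableOn_dslope_exp a)
    fun _ hw => dslope_exp_ne_zero hw a

theorem stripFun_of_ne {σ : ℝ} {w : ℂ} (h : w ≠ 0) :
    stripFun σ w = Complex.exp (-(σ * w / (Complex.exp w - 1))) := by
  rw [stripFun, dslope_of_ne _ h, slope_def_field]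
  simp [div_div_eq_mul_div]

theorem stripQuotient_of_ne {σ a : ℝ} {w : ℂ} (h : w ≠ a) :
    stripQuotient σ a w =
      (stripFun σ w - stripFun σ a) / (Complex.exp w - Complex.exp a) := by
  rw [stripQuotient, dslope_of_ne _ h, dslope_of_ne _ h, slope_def_field, slope_def_field,
    div_div_div_cancel_right₀ (sub_ne_zero.2 h)]

theorem norm_exp_add_mul_I (x y : ℝ) : ‖Complex.exp (x + y * Complex.I)‖ = Real.exp x := by
  simp [Complex.norm_exp]

theorem norm_add_mul_I_le {x y : ℝ} (hy : |y| ≤ Real.pi) :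
    ‖(x + y * Complex.I : ℂ)‖ ≤ |x| + Real.pi := by
  refine (norm_add_le _ _).trans ?_
  simpa using hy

/-- Far to the right the exponent tends to 0, so the function stays bounded; the decay of the
quotient will come from its denominator. -/
theorem norm_stripFun_right_le {σ R y : ℝ} (hσ : 0 < σ) (hR : 0 < R) (hy : |y| ≤ Real.pi) :
    ‖stripFun σ (R + y * Complex.I)‖ ≤ Real.exp (σ * ((R + Real.pi) / (Real.exp R - 1))) := by
  have hne : (R + y * Complex.I : ℂ) ≠ 0 := by
    intro h
    have := congrArg Complex.re h
    simp at this
    exact hR.ne' this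
  have hR1 : 0 < Real.exp R - 1 := by simpa using hR
  rw [stripFun_of_ne hne, Complex.norm_exp, Real.exp_le_exp]
  refine (Complex.re_le_norm _).trans ?_
  rw [norm_neg, norm_div, norm_mul, Complex.norm_real, Real.norm_of_nonneg hσ.le, mul_div_assoc]
  refine mul_le_mul_of_nonneg_left ?_ hσ.le
  refine div_le_div₀ (by positivity) ?_ hR1 ?_
  · simpa [abs_of_pos hR] using norm_add_mul_I_le (x := R) hy
  · have := norm_sub_norm_le (Complex.exp (R + y * Complex.I)) 1
    rwa [norm_exp_add_mul_I, norm_one] at this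

theorem norm_stripFun_left_le {σ R y : ℝ} (hσ : 0 < σ) (hR : 0 < R) (hy : |y| ≤ Real.pi) :
    ‖stripFun σ (-R + y * Complex.I)‖ ≤
      Real.exp (σ * (-R + (R + Real.pi) / (Real.exp R - 1))) := by
  set w : ℂ := -R + y * Complex.I with hw
  have hne : w ≠ 0 := by
    intro h
    have := congrArg Complex.re h
    simp [hw] at this
    exact hR.ne' this
  have hR1 : 0 < Real.exp R - 1 := by simpa using hR
  have hnw : ‖Complex.exp w‖ = Real.exp (-R) := by
    have := norm_exp_add_mul_I (-R) y
    simpa [hw] using this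
  have hlow : 1 - Real.exp (-R) ≤ ‖Complex.exp w - 1‖ := by
    have := norm_sub_norm_le 1 (Complex.exp w)
    rwa [hnw, norm_one, norm_sub_rev] at this
  have hpos : 0 < 1 - Real.exp (-R) := by simpa using hR
  have hne1 : Complex.exp w - 1 ≠ 0 := norm_pos_iff.1 (hpos.trans_le hlow)
  -- Far to the left e^w is small, so -w / (e^w - 1) is w up to a vanishing error. The real part of
  -- w gives decay of order e^(-σR).
  have hdec : -(σ * w / (Complex.exp w - 1)) =
      σ * (w - w * (Complex.exp w / (Complex.exp w - 1))) := by
    field_simp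
    ring
  rw [stripFun_of_ne hne, Complex.norm_exp, Real.exp_le_exp, hdec, Complex.re_ofReal_mul]
  refine mul_le_mul_of_nonneg_left ?_ hσ.le
  rw [sub_eq_add_neg, Complex.add_re]
  refine add_le_add (by simp [hw]) ((Complex.re_le_norm _).trans ?_)
  rw [norm_neg, norm_mul, norm_div, hnw, mul_div_assoc', div_le_div_iff₀ (hpos.trans_le hlow) hR1]
  have h1 : ‖w‖ ≤ R + Real.pi := by
    simpa [abs_of_pos hR, hw] using norm_add_mul_I_le (x := -R) hy
  have h2 : Real.exp (-R) * (Real.exp R - 1) = 1 - Real.exp (-R) := by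
    rw [mul_sub, ← Real.exp_add]; simp
  rw [mul_assoc, h2]
  exact mul_le_mul h1 hlow hpos.le (by positivity)

theorem tendsto_add_pi_div_exp_sub_one :
    Tendsto (fun R : ℝ => (R + Real.pi) / (Real.exp R - 1)) atTop (𝓝 0) := by
  have h1 : Tendsto (fun R : ℝ => (R * Real.exp (-R) + Real.pi * Real.exp (-R)) /
      (1 - Real.exp (-R))) atTop (𝓝 ((0 + Real.pi * 0) / (1 - 0))) := by
    have he : Tendsto (fun R : ℝ => Real.exp (-R)) atTop (𝓝 0) :=
      Real.tendsto_exp_neg_atTop_nhds_zero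
    have hx : Tendsto (fun R : ℝ => R * Real.exp (-R)) atTop (𝓝 0) := by
      simpa using Real.tendsto_pow_mul_exp_neg_atTop_nhds_zero 1
    exact (hx.add (he.const_mul _)).div (tendsto_const_nhds.sub he) (by norm_num)
  simp only [mul_zero, add_zero, sub_zero, zero_div] at h1
  refine h1.congr fun R => ?_
  rw [← add_mul, Real.exp_neg]
  have h2 : 1 - (Real.exp R)⁻¹ = (Real.exp R - 1) * (Real.exp R)⁻¹ := by
    rw [sub_mul, mul_inv_cancel₀ (Real.exp_pos R).ne', one_mul]
  rw [h2, mul_div_mul_right _ _ (inv_ne_zero (Real.exp_pos R).ne')]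

/-- The boundary values of the contour integral. -/
noncomputable def lineIntegrand (σ a u : ℝ) : ℝ :=
  Real.exp (σ * u / (1 + Real.exp u)) * Real.sin (Real.pi * σ / (1 + Real.exp u)) /
    (Real.exp u + Real.exp a)

theorem exp_add_pi_mul_I (u : ℝ) : Complex.exp (u + Real.pi * Complex.I) = -(Real.exp u : ℂ) := by
  rw [Complex.exp_add, Complex.exp_pi_mul_I]; simp

theorem exp_sub_pi_mul_I (u : ℝ) :
    Complex.exp (u + (-Real.pi : ℝ) * Complex.I) = -(Real.exp u : ℂ) := by
  have : Complex.exp (((-Real.pi : ℝ) : ℂ) * Complex.I) = -1 := by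
    rw [Complex.ofReal_neg, neg_mul, Complex.exp_neg, Complex.exp_pi_mul_I]; norm_num
  rw [Complex.exp_add, this]; simp

/-- On Im w = ±π the denominator e^w - 1 is the real number -(1 + e^u), so modulus and phase
separate. The hypothesis on `exp` treats both lines at once. -/
theorem stripFun_boundary (σ u v : ℝ) (hv : v ≠ 0)
    (he : Complex.exp (u + v * Complex.I) = -(Real.exp u : ℂ)) :
    stripFun σ (u + v * Complex.I) =
      Real.exp (σ * u / (1 + Real.exp u)) *
        Complex.exp ((σ * v / (1 + Real.exp u) : ℝ) * Complex.I) := by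
  have hne : (u + v * Complex.I : ℂ) ≠ 0 := by
    intro h
    have := congrArg Complex.im h
    simp at this
    exact hv this
  have hpos : (1 + Real.exp u : ℂ) ≠ 0 := by
    exact_mod_cast (by positivity : (1 + Real.exp u : ℝ) ≠ 0)
  have h2 : (-(Real.exp u : ℂ) - 1) ≠ 0 := by
    rw [show (-(Real.exp u : ℂ) - 1) = -(1 + Real.exp u) by ring]
    exact neg_ne_zero.2 hpos
  rw [stripFun_of_ne hne, he, Complex.ofReal_exp (σ * u / _), ← Complex.exp_add]
  congr 1
  push_cast at h2 hpos ⊢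
  field_simp
  ring

/-- Both sides share the denominator -(e^u + e^a), so the constant `stripFun σ a` cancels, and the
two conjugate phases leave a sine. -/
theorem stripQuotient_boundary (σ a u : ℝ) :
    stripQuotient σ a (u + (-Real.pi : ℝ) * Complex.I) -
      stripQuotient σ a (u + Real.pi * Complex.I) = 2 * Complex.I * lineIntegrand σ a u := by
  have hne : ∀ v : ℝ, v ≠ 0 → (u + v * Complex.I : ℂ) ≠ a := by
    intro v hv h
    have := congrArg Complex.im h
    simp at this
    exact hv this
  have hpi := Real.pi_ne_zero
  have hpos : (Real.exp u + Real.exp a : ℂ) ≠ 0 := by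
    exact_mod_cast (by positivity : (Real.exp u + Real.exp a : ℝ) ≠ 0)
  rw [stripQuotient_of_ne (hne _ (neg_ne_zero.2 hpi)), stripQuotient_of_ne (hne _ hpi),
    exp_add_pi_mul_I, exp_sub_pi_mul_I, stripFun_boundary σ u _ hpi (exp_add_pi_mul_I u),
    stripFun_boundary σ u _ (neg_ne_zero.2 hpi) (exp_sub_pi_mul_I u), lineIntegrand,
    Complex.exp_mul_I, Complex.exp_mul_I, ← Complex.ofReal_exp a]
  have h2 : (-(Real.exp u : ℂ) - Real.exp a) = -(Real.exp u + Real.exp a) := by ring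
  rw [h2, show σ * -Real.pi / (1 + Real.exp u) = -(Real.pi * σ / (1 + Real.exp u)) by ring,
    show σ * Real.pi / (1 + Real.exp u) = (Real.pi * σ / (1 + Real.exp u)) by ring]
  rw [Complex.ofReal_neg, Complex.cos_neg, Complex.sin_neg]
  rw [div_sub_div_same]
  simp only [Complex.ofReal_div, Complex.ofReal_mul, Complex.ofReal_add, Complex.ofReal_sin]
  field_simp
  ring

/-- Cauchy's theorem on the rectangle with corners ±R ± πi; the singularity at a is removable, so
there is no residue term. -/
theorem stripQuotient_contour (σ a R : ℝ) :
    2 * Complex.I * ((∫ u in (-R)..R, lineIntegrand σ a u : ℝ) : ℂ) =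
      Complex.I * (∫ y in (-Real.pi)..Real.pi, stripQuotient σ a (-R + y * Complex.I)) -
      Complex.I * (∫ y in (-Real.pi)..Real.pi, stripQuotient σ a (R + y * Complex.I)) := by
  have hpi := Real.pi_pos
  have hsub : (uIcc (-R) R ×ℂ uIcc (-Real.pi) Real.pi) ⊆ openStrip := by
    intro w hw
    have h : w.im ∈ uIcc (-Real.pi) Real.pi := hw.2
    rw [uIcc_of_le (by linarith)] at h
    have : |w.im| ≤ Real.pi := abs_le.2 h
    show |w.im| < 2 * Real.pi
    linarith
  have key := Complex.integral_boundary_rect_eq_zero_of_differentiableOn (stripQuotient σ a)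
    ⟨-R, -Real.pi⟩ ⟨R, Real.pi⟩ ((differentiableOn_stripQuotient σ a).mono hsub)
  simp only [smul_eq_mul] at key
  have hcont : ∀ v : ℝ, |v| ≤ Real.pi →
      Continuous fun u : ℝ => stripQuotient σ a (u + v * Complex.I) := by
    intro v hv
    refine (differentiableOn_stripQuotient σ a).continuousOn.comp_continuous (by fun_prop) ?_
    intro u
    show |(u + v * Complex.I : ℂ).im| < 2 * Real.pi
    simp
    linarith
  rw [← intervalIntegral.integral_sub ((hcont _ (by simp [abs_of_pos hpi])).intervalIntegrable _ _)
    ((hcont _ (by simp [abs_of_pos hpi])).intervalIntegrable _ _)] at key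
  simp_rw [stripQuotient_boundary] at key
  rw [intervalIntegral.integral_const_mul, intervalIntegral.integral_ofReal] at key
  rw [← sub_eq_zero, ← key]
  push_cast
  ring

theorem stripFun_ofReal (σ a : ℝ) : (stripFun σ a).im = 0 := by
  rcases eq_or_ne a 0 with rfl | h
  · simp [stripFun, Complex.exp_im]
  · rw [stripFun_of_ne (by exact_mod_cast h)]
    rw [show -(σ * a / (Complex.exp a - 1)) = ((-(σ * a / (Real.exp a - 1)) : ℝ) : ℂ) by
      push_cast; rfl]
    exact Complex.exp_ofReal_im _

/-- The numerator is bounded and the denominator is at least e^R - e^a, on a side of fixed length.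
-/
theorem tendsto_integral_stripQuotient_right {σ : ℝ} (hσ : 0 < σ) (a : ℝ) :
    Tendsto (fun R : ℝ => ∫ y in (-Real.pi)..Real.pi, stripQuotient σ a (R + y * Complex.I))
      atTop (𝓝 0) := by
  have hpi := Real.pi_pos
  have hlim : Tendsto (fun R : ℝ => (Real.exp (σ * ((R + Real.pi) / (Real.exp R - 1))) +
      ‖stripFun σ a‖) / (Real.exp R - Real.exp a) * |Real.pi - -Real.pi|) atTop (𝓝 0) := by
    have h1 : Tendsto (fun R : ℝ => (Real.exp (σ * ((R + Real.pi) / (Real.exp R - 1))) +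
      ‖stripFun σ a‖)) atTop (𝓝 (Real.exp (σ * 0) + ‖stripFun σ a‖)) :=
      ((tendsto_add_pi_div_exp_sub_one.const_mul σ).rexp).add_const _
    have h2 : Tendsto (fun R : ℝ => Real.exp R - Real.exp a) atTop atTop :=
      tendsto_atTop_add_const_right _ _ Real.tendsto_exp_atTop
    simpa using (h1.div_atTop h2).mul_const |Real.pi - -Real.pi|
  refine squeeze_zero_norm' ?_ hlim
  filter_upwards [eventually_gt_atTop 0, eventually_gt_atTop a] with R hR hRa
  refine intervalIntegral.norm_integral_le_of_norm_le_const fun y hy => ?_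
  rw [uIoc_of_le (by linarith)] at hy
  have hy' : |y| ≤ Real.pi := abs_le.2 ⟨hy.1.le, hy.2⟩
  have hne : (R + y * Complex.I : ℂ) ≠ a := by
    intro h
    have := congrArg Complex.re h
    simp at this
    exact hRa.ne' this
  rw [stripQuotient_of_ne hne, norm_div]
  refine div_le_div₀ (by positivity) ((norm_sub_le _ _).trans ?_)
    (sub_pos.2 (Real.exp_lt_exp.2 hRa)) ?_
  · gcongr
    exact norm_stripFun_right_le hσ hR hy'
  · have := norm_sub_norm_le (Complex.exp (R + y * Complex.I)) (Complex.exp a)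
    rwa [norm_exp_add_mul_I, Complex.norm_exp_ofReal] at this

/-- On this side both `stripFun σ w` and e^w tend to 0, so the quotient tends uniformly to `stripFun
σ a` / e^a; the side has length 2π. -/
theorem tendsto_integral_stripQuotient_left {σ : ℝ} (hσ : 0 < σ) (a : ℝ) :
    Tendsto (fun R : ℝ => ∫ y in (-Real.pi)..Real.pi, stripQuotient σ a (-R + y * Complex.I))
      atTop (𝓝 (2 * Real.pi * (stripFun σ a / Complex.exp a))) := by
  have hpi := Real.pi_pos
  set c := stripFun σ a with hc
  have hB : Tendsto (fun R : ℝ => Real.exp (σ * (-R + (R + Real.pi) / (Real.exp R - 1))))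
      atTop (𝓝 0) := by
    refine Real.tendsto_exp_atBot.comp (Tendsto.const_mul_atBot hσ ?_)
    exact tendsto_neg_atTop_atBot.atBot_add tendsto_add_pi_div_exp_sub_one
  have he : Tendsto (fun R : ℝ => Real.exp (-R)) atTop (𝓝 0) :=
    Real.tendsto_exp_neg_atTop_nhds_zero
  have hlim : Tendsto (fun R : ℝ =>
      (Real.exp (σ * (-R + (R + Real.pi) / (Real.exp R - 1))) * Real.exp a +
        ‖c‖ * Real.exp (-R)) / ((Real.exp a - Real.exp (-R)) * Real.exp a) *
        |Real.pi - -Real.pi|) atTop (𝓝 0) := by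
    have := (((hB.mul_const (Real.exp a)).add (he.const_mul ‖c‖)).div
      ((tendsto_const_nhds (x := Real.exp a)).sub he |>.mul_const (Real.exp a))
      (by simp)).mul_const |Real.pi - -Real.pi|
    simpa using this
  rw [tendsto_iff_norm_sub_tendsto_zero]
  refine squeeze_zero' (Eventually.of_forall fun _ => norm_nonneg _) ?_ hlim
  filter_upwards [eventually_gt_atTop 0, eventually_gt_atTop (-a)] with R hR hRa
  have hcst : 2 * Real.pi * (c / Complex.exp a) =
      ∫ _y in (-Real.pi)..Real.pi, c / Complex.exp a := by
    rw [intervalIntegral.integral_const, Complex.real_smul]; push_cast; ring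
  have hint : IntervalIntegrable (fun y : ℝ => stripQuotient σ a (-R + y * Complex.I)) volume
      (-Real.pi) Real.pi := by
    refine ContinuousOn.intervalIntegrable ?_
    refine (differentiableOn_stripQuotient σ a).continuousOn.comp (by fun_prop) ?_
    intro y hy
    rw [uIcc_of_le (by linarith)] at hy
    have hy' : |y| ≤ Real.pi := abs_le.2 hy
    show |(-R + y * Complex.I : ℂ).im| < 2 * Real.pi
    simp
    linarith
  rw [hcst, ← intervalIntegral.integral_sub hint (by simp)]
  refine intervalIntegral.norm_integral_le_of_norm_le_const fun y hy => ?_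
  rw [uIoc_of_le (by linarith)] at hy
  have hy' : |y| ≤ Real.pi := abs_le.2 ⟨hy.1.le, hy.2⟩
  have hne : (-R + y * Complex.I : ℂ) ≠ a := by
    intro h
    have := congrArg Complex.re h
    simp at this
    linarith
  have hnw : ‖Complex.exp (-R + y * Complex.I)‖ = Real.exp (-R) := by
    have := norm_exp_add_mul_I (-R) y
    simpa using this
  have hlow : Real.exp a - Real.exp (-R) ≤ ‖Complex.exp (-R + y * Complex.I) - Complex.exp a‖ := by
    have := norm_sub_norm_le (Complex.exp a) (Complex.exp (-R + y * Complex.I))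
    rwa [hnw, Complex.norm_exp_ofReal, norm_sub_rev] at this
  have hpos : 0 < Real.exp a - Real.exp (-R) := sub_pos.2 (Real.exp_lt_exp.2 (by linarith))
  have hne2 : Complex.exp (-R + y * Complex.I) - Complex.exp a ≠ 0 :=
    norm_pos_iff.1 (hpos.trans_le hlow)
  -- Over the common denominator the two terms not containing a small factor cancel.
  have hid : (stripFun σ (-R + y * Complex.I) - c) /
      (Complex.exp (-R + y * Complex.I) - Complex.exp a) - c / Complex.exp a =
      (stripFun σ (-R + y * Complex.I) * Complex.exp a - c * Complex.exp (-R + y * Complex.I)) /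
      ((Complex.exp (-R + y * Complex.I) - Complex.exp a) * Complex.exp a) := by
    have := Complex.exp_ne_zero a
    field_simp
    ring
  rw [stripQuotient_of_ne hne, ← hc, hid, norm_div, norm_mul (_ - _), Complex.norm_exp_ofReal]
  refine div_le_div₀ (by positivity) ((norm_sub_le _ _).trans ?_) (by positivity) (by gcongr)
  rw [norm_mul, norm_mul, hnw, Complex.norm_exp_ofReal]
  gcongr
  exact norm_stripFun_left_le hσ hR hy'

theorem tendsto_integral_lineIntegrand {σ : ℝ} (hσ : 0 < σ) (a : ℝ) :
    Tendsto (fun R : ℝ => ∫ u in (-R)..R, lineIntegrand σ a u) atTop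
      (𝓝 (Real.pi * ((stripFun σ a).re / Real.exp a))) := by
  have h := ((tendsto_integral_stripQuotient_left hσ a).const_mul Complex.I).sub
    ((tendsto_integral_stripQuotient_right hσ a).const_mul Complex.I)
  have h2 := h.congr' (f₂ := fun R : ℝ => 2 * Complex.I *
    ((∫ u in (-R)..R, lineIntegrand σ a u : ℝ) : ℂ)) (by
      refine Eventually.of_forall fun R => ?_
      exact (stripQuotient_contour σ a R).symm)
  -- The contour identity is purely imaginary, since `stripFun σ a` is real; half of its imaginary
  -- part is the real limit sought.
  have h3 := (Complex.continuous_im.tendsto _).comp h2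
  have h4 := h3.mul_const (1 / 2)
  have hre : (stripFun σ a : ℂ) = ((stripFun σ a).re : ℂ) := by
    apply Complex.ext <;> simp [stripFun_ofReal]
  rw [hre] at h4
  have hval : (Complex.I * (2 * Real.pi * (((stripFun σ a).re : ℂ) / Complex.exp a)) -
      Complex.I * 0).im * (1 / 2) = Real.pi * ((stripFun σ a).re / Real.exp a) := by
    rw [show Complex.I * (2 * Real.pi * (((stripFun σ a).re : ℂ) / Complex.exp a)) -
      Complex.I * 0 = ((2 * (Real.pi * ((stripFun σ a).re / Real.exp a)) : ℝ) : ℂ) * Complex.I by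
        push_cast; ring]
    rw [Complex.im_ofReal_mul, Complex.I_im]
    ring
  rw [hval] at h4
  refine h4.congr fun R => ?_
  simp only [Function.comp_apply]
  rw [mul_assoc, mul_comm Complex.I, ← mul_assoc, show (2 : ℂ) = ((2 : ℝ) : ℂ) by norm_num,
    ← Complex.ofReal_mul, Complex.im_ofReal_mul, Complex.I_im]
  ring

theorem lineIntegrand_nonneg {σ : ℝ} (hσ : 0 < σ) (hσ1 : σ ≤ 1) (a u : ℝ) :
    0 ≤ lineIntegrand σ a u := by
  have he := Real.exp_pos u
  refine div_nonneg (mul_nonneg (Real.exp_pos _).le (Real.sin_nonneg_of_nonneg_of_le_pi ?_ ?_))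
    (by positivity)
  · have := Real.pi_pos
    positivity
  · rw [div_le_iff₀ (by positivity)]
    have := Real.pi_pos
    nlinarith

/-- For σ ≤ 1 the argument of the sine lies in [0, π], so the integrand is nonnegative and
convergence of the symmetric integrals already gives integrability. -/
theorem lintegral_lineIntegrand {σ : ℝ} (hσ : 0 < σ) (hσ1 : σ ≤ 1) (a : ℝ) :
    ∫⁻ u, ENNReal.ofReal (lineIntegrand σ a u) =
      ENNReal.ofReal (Real.pi * ((stripFun σ a).re / Real.exp a)) := by
  have hcont : Continuous (lineIntegrand σ a) := by
    unfold lineIntegrand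
    refine Continuous.div (Continuous.mul ?_ ?_) (by fun_prop) fun u => by positivity
    · exact Real.continuous_exp.comp (Continuous.div (by fun_prop) (by fun_prop)
        fun u => by positivity)
    · exact Real.continuous_sin.comp (Continuous.div (by fun_prop) (by fun_prop)
        fun u => by positivity)
  have hlim := tendsto_integral_lineIntegrand hσ a
  have hint : Integrable (lineIntegrand σ a) := by
    refine integrable_of_intervalIntegral_norm_tendsto
      (Real.pi * ((stripFun σ a).re / Real.exp a)) (a := fun R : ℝ => -R) (b := fun R : ℝ => R)
      (l := atTop) (fun R => ?_)
      tendsto_neg_atTop_atBot tendsto_id ?_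
    · exact hcont.integrableOn_Ioc
    · simpa only [Real.norm_of_nonneg (lineIntegrand_nonneg hσ hσ1 a _)] using hlim
  rw [← ofReal_integral_eq_lintegral_ofReal hint (ae_of_all _ (lineIntegrand_nonneg hσ hσ1 a))]
  congr 1
  exact tendsto_nhds_unique (intervalIntegral_tendsto_integral hint tendsto_neg_atTop_atBot
    tendsto_id) hlim

/-! ### Stieltjes transforms of the densities -/

/-- The closed form of the Lévy exponent of `lawW`. -/
noncomputable def exponentW (l : ℝ) : ℝ := if l = 1 then 1 else l * Real.log l / (l - 1)

/-- The point a = -log l is where the contour formula produces the wanted Stieltjes transform at l.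
-/
theorem stripFun_neg_log (σ : ℝ) {l : ℝ} (hl : 0 < l) :
    (stripFun σ ((-Real.log l : ℝ) : ℂ)).re = Real.exp (-(σ * exponentW l)) := by
  rcases eq_or_ne l 1 with rfl | h
  · simp [stripFun, exponentW, Complex.exp_re]
  · have hlog : -Real.log l ≠ 0 := neg_ne_zero.2 (Real.log_ne_zero_of_pos_of_ne_one hl h)
    have h1 : l - 1 ≠ 0 := sub_ne_zero.2 h
    have h2 : l⁻¹ - 1 ≠ 0 := by
      intro h3
      have : l⁻¹ = 1 := by linarith
      exact h (inv_eq_one.1 this)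
    rw [stripFun_of_ne (by exact_mod_cast hlog), ← Complex.ofReal_exp, Real.exp_neg,
      Real.exp_log hl]
    rw [show -(σ * ((-Real.log l : ℝ) : ℂ) / (((l⁻¹ : ℝ) : ℂ) - 1)) =
      ((-(σ * (-Real.log l) / (l⁻¹ - 1)) : ℝ) : ℂ) by push_cast; ring, Complex.exp_ofReal_re,
      exponentW, if_neg h]
    congr 1
    have h4 : l⁻¹ - 1 = -(l - 1) / l := by field_simp; ring
    rw [h4]
    field_simp

theorem lintegral_Ioi_comp_exp (F : ℝ → ℝ≥0∞) :
    ∫⁻ x in Ioi 0, F x = ∫⁻ u, ENNReal.ofReal (Real.exp u) * F (Real.exp u) := by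
  have h := lintegral_image_eq_lintegral_abs_deriv_mul (s := univ) (f := Real.exp)
    (f' := Real.exp) MeasurableSet.univ (fun x _ => (Real.hasDerivAt_exp x).hasDerivWithinAt)
    Real.exp_injective.injOn F
  rw [image_univ, Real.range_exp, setLIntegral_univ] at h
  rw [h]
  simp

/-- This substitution serves twice: to pass from the W density to the U density, and to compute the
beta transform. -/
theorem lintegral_Ioi_comp_div_one_sub (F : ℝ → ℝ≥0∞) :
    ∫⁻ x in Ioi 0, F x = ∫⁻ y in Ioo 0 1, ENNReal.ofReal (((1 - y) ^ 2)⁻¹) * F (y / (1 - y)) := by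
  have hd : ∀ y ∈ Ioo (0 : ℝ) 1, HasDerivWithinAt (fun y => y / (1 - y)) (((1 - y) ^ 2)⁻¹)
      (Ioo 0 1) y := by
    intro y hy
    have hne : 1 - y ≠ 0 := by linarith [hy.2]
    have := ((hasDerivAt_id y).div ((hasDerivAt_const y 1).sub (hasDerivAt_id y)) hne)
    refine (this.congr_deriv ?_).hasDerivWithinAt
    simp
  have hinj : InjOn (fun y : ℝ => y / (1 - y)) (Ioo 0 1) := by
    intro a ha b hb hab
    have ha' : 1 - a ≠ 0 := by linarith [ha.2]
    have hb' : 1 - b ≠ 0 := by linarith [hb.2]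
    simp only at hab
    rw [div_eq_div_iff ha' hb'] at hab
    linarith
  have h := lintegral_image_eq_lintegral_abs_deriv_mul measurableSet_Ioo hd hinj F
  have him : (fun y : ℝ => y / (1 - y)) '' Ioo 0 1 = Ioi 0 := by
    ext x
    constructor
    · rintro ⟨y, hy, rfl⟩
      exact div_pos hy.1 (by linarith [hy.2])
    · intro hx
      have hx' : (0 : ℝ) < x := hx
      refine ⟨x / (1 + x), ⟨by positivity, (div_lt_one (by positivity)).2 (by linarith)⟩, ?_⟩
      have : 1 - x / (1 + x) = 1 / (1 + x) := by field_simp; ring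
      simp only [this]
      field_simp
  rw [him] at h
  rw [h]
  refine setLIntegral_congr_fun measurableSet_Ioo fun y _ => ?_
  simp only [abs_of_nonneg (inv_nonneg.2 (sq_nonneg (1 - y)))]

theorem meanDensityW_of_notMem (σ : ℝ) {x : ℝ} (hx : x ∉ Ioi 0) : meanDensityW σ x = 0 :=
  if_neg hx

theorem meanDensityU_of_notMem (σ : ℝ) {x : ℝ} (hx : x ∉ Ioo 0 1) : meanDensityU σ x = 0 :=
  if_neg hx

theorem betaPDF_of_notMem (a b : ℝ) {x : ℝ} (hx : x ∉ Ioo 0 1) : betaPDF a b x = 0 := by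
  rw [betaPDF_eq, if_neg (show ¬(0 < x ∧ x < 1) from hx), ENNReal.ofReal_zero]

theorem meanDensityW_nonneg {σ : ℝ} (hσ : 0 < σ) (hσ1 : σ ≤ 1) (x : ℝ) :
    0 ≤ meanDensityW σ x := by
  unfold meanDensityW
  split_ifs with hx
  · have hpi := Real.pi_pos
    refine mul_nonneg (mul_nonneg (by positivity)
      (Real.sin_nonneg_of_nonneg_of_le_pi (by positivity) ?_)) (by positivity)
    rw [div_le_iff₀ (by positivity)]
    nlinarith
  · exact le_rfl

theorem meanDensityU_nonneg {σ : ℝ} (hσ : 0 < σ) (hσ1 : σ ≤ 1) (x : ℝ) :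
    0 ≤ meanDensityU σ x := by
  unfold meanDensityU
  split_ifs with hx
  · have hpi := Real.pi_pos
    have h1 : 0 < 1 - x := by linarith [hx.2]
    have hx0 := hx.1
    have hs : 0 ≤ Real.sin (Real.pi * σ * (1 - x)) := by
      refine Real.sin_nonneg_of_nonneg_of_le_pi (by positivity) ?_
      have : σ * (1 - x) ≤ 1 := by nlinarith
      nlinarith
    positivity
  · exact le_rfl

theorem measurable_meanDensityW (σ : ℝ) : Measurable (meanDensityW σ) := by
  unfold meanDensityW
  exact Measurable.ite measurableSet_Ioi (by fun_prop) measurable_const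

theorem measurable_meanDensityU (σ : ℝ) : Measurable (meanDensityU σ) := by
  unfold meanDensityU
  exact Measurable.ite measurableSet_Ioo (by fun_prop) measurable_const

theorem lintegral_eq_setLIntegral {f : ℝ → ℝ≥0∞} {s : Set ℝ} (hs : MeasurableSet s)
    (hf : ∀ x ∉ s, f x = 0) : ∫⁻ x, f x = ∫⁻ x in s, f x := by
  rw [← lintegral_indicator hs]
  refine lintegral_congr fun x => ?_
  by_cases hx : x ∈ s
  · simp [hx]
  · simp [hx, hf x hx]

/-- With x = e^u and l = e^(-a) one has 1 + l x = l (e^u + e^a), so the integral is that of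
`lineIntegrand` up to the factor 1 / (π l). -/
theorem lintegral_meanDensityW_mul {σ : ℝ} (hσ : 0 < σ) (hσ1 : σ ≤ 1) {l : ℝ} (hl : 0 < l) :
    ∫⁻ x, ENNReal.ofReal (meanDensityW σ x * (1 + l * x)⁻¹) =
      ENNReal.ofReal (Real.exp (-(σ * exponentW l))) := by
  rw [lintegral_eq_setLIntegral measurableSet_Ioi (s := Ioi 0) (fun x hx => by
    simp [meanDensityW_of_notMem σ hx]), lintegral_Ioi_comp_exp]
  have h := lintegral_lineIntegrand hσ hσ1 (-Real.log l)
  rw [stripFun_neg_log σ hl, Real.exp_neg (Real.log l), Real.exp_log hl] at h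
  have hpi := Real.pi_pos
  have hpt : ∀ u : ℝ, ENNReal.ofReal (Real.exp u) * ENNReal.ofReal
      (meanDensityW σ (Real.exp u) * (1 + l * Real.exp u)⁻¹) =
      ENNReal.ofReal (Real.pi * l)⁻¹ * ENNReal.ofReal (lineIntegrand σ (-Real.log l) u) := by
    intro u
    rw [← ENNReal.ofReal_mul (Real.exp_pos u).le, ← ENNReal.ofReal_mul (by positivity)]
    congr 1
    have he := Real.exp_pos u
    rw [meanDensityW, if_pos he, lineIntegrand, Real.exp_neg (Real.log l), Real.exp_log hl,
      Real.rpow_sub_one he.ne', Real.rpow_def_of_pos he, Real.log_exp,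
      show u * (σ / (1 + Real.exp u)) = σ * u / (1 + Real.exp u) by ring]
    have : Real.exp u + l⁻¹ = (1 + l * Real.exp u) / l := by field_simp; ring
    rw [this]
    field_simp
  simp_rw [hpt]
  rw [lintegral_const_mul' _ _ ENNReal.ofReal_ne_top, h, ← ENNReal.ofReal_mul (by positivity)]
  congr 1
  field_simp

theorem tendsto_exponentW_zero : Tendsto exponentW (𝓝[>] 0) (𝓝 0) := by
  have h1 : Tendsto (fun l : ℝ => l * Real.log l / (l - 1)) (𝓝[>] 0) (𝓝 (0 * Real.log 0 / (0 - 1))) := by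
    refine Tendsto.mono_left ?_ nhdsWithin_le_nhds
    exact (Real.continuous_mul_log.tendsto 0).div ((continuous_id.sub continuous_const).tendsto 0)
      (by norm_num)
  simp only [zero_mul, zero_div] at h1
  refine h1.congr' ?_
  filter_upwards [Ioo_mem_nhdsGT (one_pos)] with l hl
  rw [exponentW, if_neg hl.2.ne]

/-- The contour point -log l escapes to infinity at l = 0. The total mass is therefore obtained as a
monotone limit along l = 1 / (n + 1), where l log l tends to 0. -/
theorem lintegral_meanDensityW {σ : ℝ} (hσ : 0 < σ) (hσ1 : σ ≤ 1) :
    ∫⁻ x, ENNReal.ofReal (meanDensityW σ x) = 1 := by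
  have hseq : Tendsto (fun n : ℕ => (1 / ((n : ℝ) + 1))) atTop (𝓝[>] 0) :=
    tendsto_nhdsWithin_iff.2 ⟨tendsto_one_div_add_atTop_nhds_zero_nat,
      Eventually.of_forall fun n => by simp only [mem_Ioi]; positivity⟩
  have hmono := lintegral_tendsto_of_tendsto_of_monotone (μ := volume)
    (f := fun (n : ℕ) x => ENNReal.ofReal (meanDensityW σ x * (1 + (1 / ((n : ℝ) + 1)) * x)⁻¹))
    (F := fun x => ENNReal.ofReal (meanDensityW σ x))
    (fun n => by have := measurable_meanDensityW σ; fun_prop)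
    (ae_of_all _ fun x => by
      intro n m hnm
      refine ENNReal.ofReal_le_ofReal ?_
      rcases le_or_gt x 0 with hx | hx
      · simp [meanDensityW, hx.not_gt]
      · refine mul_le_mul_of_nonneg_left ?_ (meanDensityW_nonneg hσ hσ1 x)
        have : (n : ℝ) ≤ m := by exact_mod_cast hnm
        gcongr)
    (ae_of_all _ fun x => by
      refine ENNReal.tendsto_ofReal ?_
      have h1 : Tendsto (fun n : ℕ => (1 + (1 / ((n : ℝ) + 1)) * x)) atTop (𝓝 (1 + 0 * x)) :=
        (tendsto_one_div_add_atTop_nhds_zero_nat.mul_const x).const_add 1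
      have := (h1.inv₀ (by simp)).const_mul (meanDensityW σ x)
      simpa using this)
  refine tendsto_nhds_unique hmono ?_
  have hl : ∀ n : ℕ, (0 : ℝ) < 1 / ((n : ℝ) + 1) := fun n => by positivity
  simp_rw [lintegral_meanDensityW_mul hσ hσ1 (hl _)]
  have h2 := ((tendsto_exponentW_zero.comp hseq).const_mul σ).neg.rexp
  simpa using ENNReal.tendsto_ofReal h2

/-- Under x = y / (1 - y), 1 + (1 + l) x = (1 + l y) / (1 - y), and the U integrand at l is e^σ
times the W integrand at 1 + l. As 1 + l ≥ 1, the value l = 0 needs no limit here. -/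
theorem lintegral_meanDensityU_mul {σ : ℝ} (hσ : 0 < σ) (hσ1 : σ ≤ 1) {l : ℝ} (hl : 0 ≤ l) :
    ∫⁻ y, ENNReal.ofReal (meanDensityU σ y * (1 + l * y)⁻¹) =
      ENNReal.ofReal (Real.exp (-(σ * (exponentW (1 + l) - 1)))) := by
  have hl1 : 0 < 1 + l := by linarith
  rw [show -(σ * (exponentW (1 + l) - 1)) = σ + -(σ * exponentW (1 + l)) by ring, Real.exp_add,
    ENNReal.ofReal_mul (Real.exp_pos _).le, ← lintegral_meanDensityW_mul hσ hσ1 hl1,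
    lintegral_eq_setLIntegral measurableSet_Ioi (s := Ioi 0)
      (f := fun x => ENNReal.ofReal (meanDensityW σ x * (1 + (1 + l) * x)⁻¹)) (fun x hx => by
        simp [meanDensityW_of_notMem σ hx]), lintegral_Ioi_comp_div_one_sub,
    lintegral_eq_setLIntegral measurableSet_Ioo (s := Ioo 0 1) (fun x hx => by
        simp [meanDensityU_of_notMem σ hx]), ← lintegral_const_mul' _ _ ENNReal.ofReal_ne_top]
  refine setLIntegral_congr_fun measurableSet_Ioo fun y hy => ?_
  have hy0 := hy.1
  have hy1 : 0 < 1 - y := by linarith [hy.2]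
  rw [← ENNReal.ofReal_mul (by positivity), ← ENNReal.ofReal_mul (by positivity)]
  congr 1
  have h1 : 1 + y / (1 - y) = 1 / (1 - y) := by field_simp; ring
  have h2 : 1 + (1 + l) * (y / (1 - y)) = (1 + l * y) / (1 - y) := by field_simp; ring
  rw [meanDensityU, if_pos (show 0 < y ∧ y < 1 from hy), meanDensityW, if_pos (by positivity), h1, h2,
    Real.div_rpow hy0.le hy1.le, Real.rpow_sub_one (x := 1 - y) hy1.ne',
    show Real.pi * σ / (1 / (1 - y)) = Real.pi * σ * (1 - y) by field_simp,
    show σ / (1 / (1 - y)) = σ * (1 - y) by field_simp, Real.rpow_neg hy1.le]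
  have := (Real.rpow_pos_of_pos hy1 (σ * (1 - y))).ne'
  field_simp

/-- On (0, ∞) the integrand becomes a multiple of x^(σ-1) / (1 + (1 + l) x). Rescaling x by 1 + l
extracts (1 + l)^(-σ) and leaves the case l = 0, which is the total mass 1; no beta integral has to
be evaluated. -/
theorem lintegral_inv_betaMeasure {σ : ℝ} (hσ : 0 < σ) (hσ1 : σ < 1) {l : ℝ} (hl : 0 ≤ l) :
    ∫⁻ y, ENNReal.ofReal ((1 + l * y)⁻¹) ∂betaMeasure σ (1 - σ) =
      ENNReal.ofReal ((1 + l) ^ (-σ)) := by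
  have hb := beta_pos hσ (sub_pos.2 hσ1)
  have hm : Measurable (betaPDF σ (1 - σ)) := (measurable_betaPDFReal σ (1 - σ)).ennreal_ofReal
  have key : ∀ l : ℝ, 0 ≤ l → ∫⁻ y, ENNReal.ofReal ((1 + l * y)⁻¹) ∂betaMeasure σ (1 - σ) =
      ∫⁻ x in Ioi 0, ENNReal.ofReal (1 / beta σ (1 - σ) * x ^ (σ - 1) * (1 + (1 + l) * x)⁻¹) := by
    intro l hl
    rw [betaMeasure, lintegral_withDensity_eq_lintegral_mul _ hm (by fun_prop),
      lintegral_Ioi_comp_div_one_sub,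
      lintegral_eq_setLIntegral measurableSet_Ioo (s := Ioo 0 1) (fun x hx => by
        simp [betaPDF_of_notMem _ _ hx])]
    refine setLIntegral_congr_fun measurableSet_Ioo fun y hy => ?_
    have hy0 := hy.1
    have hy1 : 0 < 1 - y := by linarith [hy.2]
    simp only [Pi.mul_apply]
    rw [betaPDF_of_pos_lt_one hy.1 hy.2, ← ENNReal.ofReal_mul (by positivity),
      ← ENNReal.ofReal_mul (by positivity)]
    congr 1
    have h2 : 1 + (1 + l) * (y / (1 - y)) = (1 + l * y) / (1 - y) := by field_simp; ring
    rw [h2, Real.div_rpow hy0.le hy1.le, Real.rpow_sub_one hy1.ne' σ,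
      show 1 - σ - 1 = -σ by ring, Real.rpow_neg hy1.le]
    have := (Real.rpow_pos_of_pos hy1 σ).ne'
    field_simp
  have hprob := isProbabilityMeasureBeta hσ (sub_pos.2 hσ1)
  have h0 := key 0 le_rfl
  simp only [zero_mul, add_zero, inv_one, ENNReal.ofReal_one, lintegral_const, measure_univ,
    mul_one, one_mul] at h0
  have hl1 : 0 < 1 + l := by linarith
  rw [key l hl, lintegral_Ioi_comp_mul (inv_pos.2 hl1),
    ← mul_one (ENNReal.ofReal ((1 + l) ^ (-σ))), h0,
    ← lintegral_const_mul' _ _ ENNReal.ofReal_ne_top]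
  refine setLIntegral_congr_fun measurableSet_Ioi fun x hx => ?_
  have hx' : (0 : ℝ) < x := hx
  rw [← ENNReal.ofReal_mul (by positivity), ← ENNReal.ofReal_mul (by positivity)]
  congr 1
  rw [Real.mul_rpow hx'.le (by positivity), Real.inv_rpow hl1.le,
    Real.rpow_sub_one (x := 1 + l) hl1.ne', Real.rpow_neg hl1.le,
    show (1 + l) * (x * (1 + l)⁻¹) = x by field_simp]
  field_simp

/-! ### Lévy exponents -/

theorem levyExponent_of_lintegral {F : Measure ℝ} (hF : ∀ᵐ x ∂F, 0 ≤ x) {l c : ℝ} (hl : 0 ≤ l)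
    (hc : 0 ≤ c) (h : ∫⁻ x, ENNReal.ofReal (Real.log (1 + l * x)) ∂F = ENNReal.ofReal c) :
    Integrable (fun x => Real.log (1 + l * x)) F ∧ levyExponent F l = c := by
  have hnn : 0 ≤ᵐ[F] fun x => Real.log (1 + l * x) := by
    filter_upwards [hF] with x hx
    exact Real.log_nonneg (by nlinarith)
  have hm : Measurable fun x : ℝ => Real.log (1 + l * x) := by fun_prop
  refine ⟨⟨hm.aestronglyMeasurable, ?_⟩, ?_⟩
  · rw [hasFiniteIntegral_iff_ofReal hnn, h]
    exact ENNReal.ofReal_lt_top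
  · rw [levyExponent, integral_eq_lintegral_of_nonneg_ae hnn hm.aestronglyMeasurable, h,
      ENNReal.toReal_ofReal hc]

instance isProbabilityMeasure_lawU : IsProbabilityMeasure lawU :=
  ⟨by simp [lawU]⟩

theorem lawU_ae_nonneg : ∀ᵐ x ∂lawU, 0 ≤ x := by
  filter_upwards [ae_restrict_mem measurableSet_Icc] with x hx
  exact hx.1

theorem exponentW_nonneg {l : ℝ} (hl : 0 ≤ l) : 0 ≤ exponentW l := by
  unfold exponentW
  split_ifs with h
  · exact zero_le_one
  · rcases lt_or_gt_of_ne h with h1 | h1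
    · exact div_nonneg_of_nonpos (mul_nonpos_of_nonneg_of_nonpos hl
        (Real.log_nonpos hl h1.le)) (by linarith)
    · exact div_nonneg (mul_nonneg hl (Real.log_nonneg h1.le)) (by linarith)

/-- An explicit antiderivative gives (1 + l) log(1 + l) / l - 1. Writing it through `exponentW`
displays the shift that relates the two priors. -/
theorem levyExponent_lawU {l : ℝ} (hl : 0 ≤ l) :
    levyExponent lawU l = exponentW (1 + l) - 1 := by
  rcases hl.eq_or_lt with rfl | hl0
  · simp [levyExponent, exponentW]
  have hpos : ∀ x ∈ uIcc (0 : ℝ) 1, 0 < 1 + l * x := by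
    intro x hx
    rw [uIcc_of_le zero_le_one] at hx
    have := hx.1
    positivity
  have hcont : ContinuousOn (fun x => Real.log (1 + l * x)) (uIcc 0 1) :=
    ContinuousOn.log (by fun_prop) fun x hx => (hpos x hx).ne'
  have hd : ∀ x ∈ uIcc (0 : ℝ) 1,
      HasDerivAt (fun x => ((1 + l * x) * Real.log (1 + l * x) - l * x) / l)
        (Real.log (1 + l * x)) x := by
    intro x hx
    have h1 : HasDerivAt (fun x : ℝ => l * x) l x := by
      simpa using (hasDerivAt_id x).const_mul l
    have h2 : HasDerivAt (fun x : ℝ => 1 + l * x) l x := h1.const_add 1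
    have := ((h2.mul (h2.log (hpos x hx).ne')).sub h1).div_const l
    refine this.congr_deriv ?_
    have := (hpos x hx).ne'
    field_simp
    ring
  rw [levyExponent, lawU, integral_Icc_eq_integral_Ioc,
    ← intervalIntegral.integral_of_le zero_le_one,
    intervalIntegral.integral_eq_sub_of_hasDerivAt hd hcont.intervalIntegrable, exponentW,
    if_neg (by linarith)]
  simp
  field_simp

theorem levyExponent_nonneg {F : Measure ℝ} (hF : ∀ᵐ x ∂F, 0 ≤ x) {l : ℝ} (hl : 0 ≤ l) :
    0 ≤ levyExponent F l := by
  refine integral_nonneg_of_ae ?_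
  filter_upwards [hF] with x hx
  exact Real.log_nonneg (by nlinarith)

instance isProbabilityMeasure_lawW : IsProbabilityMeasure lawW :=
  Measure.isProbabilityMeasure_map (by fun_prop)

theorem lawW_ae_nonneg : ∀ᵐ x ∂lawW, 0 ≤ x := by
  rw [lawW, ae_map_iff (by fun_prop) measurableSet_Ici]
  filter_upwards [Measure.quasiMeasurePreserving_fst.ae (gammaMeasure_ae_pos 1 1),
    Measure.quasiMeasurePreserving_snd.ae (gammaMeasure_ae_pos 1 1)] with p h1 h2
  exact div_nonneg h1.le h2.le

/-- P(G > t G') = E exp(-t G'), the Laplace transform of an exponential variable. -/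
theorem lawW_Ioi {t : ℝ} (ht : 0 ≤ t) : lawW (Ioi t) = ENNReal.ofReal ((1 + t)⁻¹) := by
  rw [lawW, Measure.map_apply (by fun_prop) measurableSet_Ioi,
    ← lintegral_indicator_one (measurableSet_Ioi.preimage (by fun_prop)), lintegral_prod_symm _
    (by exact (measurable_one.indicator (measurableSet_Ioi.preimage (by fun_prop))).aemeasurable),
    ← Real.rpow_neg_one, ← lintegral_exp_gammaMeasure one_pos ht]
  refine lintegral_congr_ae ?_
  filter_upwards [gammaMeasure_ae_pos 1 1] with y hy
  rw [← expMeasure_Ioi (by positivity), ← lintegral_indicator_one measurableSet_Ioi]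
  refine lintegral_congr fun x => ?_
  have hiff : (x, y) ∈ (fun p : ℝ × ℝ => p.1 / p.2) ⁻¹' Ioi t ↔ x ∈ Ioi (t * y) :=
    lt_div_iff₀ hy
  by_cases h : x ∈ Ioi (t * y)
  · exact (indicator_of_mem (hiff.2 h) 1).trans (indicator_of_mem h 1).symm
  · exact (indicator_of_notMem (fun h' => h (hiff.1 h')) 1).trans (indicator_of_notMem h 1).symm

/-- Partial fractions in t give a difference of logarithms with coefficient l / (l - 1), whose limit
uses (1 + l t) / (1 + t) → l. At l = 1 the two poles merge and the antiderivative is rational. -/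
theorem lintegral_Ioi_exponentW {l : ℝ} (hl : 0 < l) :
    ∫⁻ t in Ioi 0, ENNReal.ofReal ((1 + t)⁻¹) * ENNReal.ofReal (l / (1 + l * t)) =
      ENNReal.ofReal (exponentW l) := by
  obtain ⟨g, hg0, hg, hlim⟩ : ∃ g : ℝ → ℝ, g 0 = 0 ∧
      (∀ t ∈ Ici (0 : ℝ), HasDerivAt g ((1 + t)⁻¹ * (l / (1 + l * t))) t) ∧
      Tendsto g atTop (𝓝 (exponentW l)) := by
    have hinv : Tendsto (fun t : ℝ => (1 + t)⁻¹) atTop (𝓝 0) :=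
      tendsto_inv_atTop_zero.comp (tendsto_atTop_add_const_left _ _ tendsto_id)
    rcases eq_or_ne l 1 with rfl | h
    · refine ⟨fun t => 1 - (1 + t)⁻¹, by simp, fun t ht => ?_, ?_⟩
      · have ht0 : (0 : ℝ) ≤ t := ht
        have := (((hasDerivAt_id t).const_add 1).inv (by positivity)).const_sub 1
        refine this.congr_deriv ?_
        simp
        field_simp
      · simpa [exponentW] using hinv.const_sub 1
    · refine ⟨fun t => l / (l - 1) * (Real.log (1 + l * t) - Real.log (1 + t)), by simp,
        fun t ht => ?_, ?_⟩
      · have ht0 : (0 : ℝ) ≤ t := ht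
        have h1 : HasDerivAt (fun t : ℝ => 1 + l * t) l t := by
          simpa using ((hasDerivAt_id t).const_mul l).const_add 1
        have h2 : HasDerivAt (fun t : ℝ => 1 + t) 1 t := (hasDerivAt_id t).const_add 1
        have := ((h1.log (by positivity)).sub (h2.log (by positivity))).const_mul (l / (l - 1))
        refine this.congr_deriv ?_
        have h3 : l - 1 ≠ 0 := sub_ne_zero.2 h
        field_simp
        ring
      · have h4 : Tendsto (fun t : ℝ => l + (1 - l) * (1 + t)⁻¹) atTop (𝓝 (l + (1 - l) * 0)) :=
          (hinv.const_mul _).const_add _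
        rw [mul_zero, add_zero] at h4
        have h5 := (h4.log hl.ne').const_mul (l / (l - 1))
        rw [exponentW, if_neg h, mul_div_right_comm]
        refine h5.congr' ?_
        filter_upwards [eventually_ge_atTop 0] with t ht
        rw [← Real.log_div (by positivity) (by positivity)]
        congr 2
        field_simp
        ring
  have hnn : ∀ t ∈ Ioi (0 : ℝ), 0 ≤ (1 + t)⁻¹ * (l / (1 + l * t)) := by
    intro t ht
    have : (0 : ℝ) < t := ht
    positivity
  have hint := integrableOn_Ioi_deriv_of_nonneg' hg hnn hlim
  have hval := integral_Ioi_of_hasDerivAt_of_nonneg' hg hnn hlim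
  rw [hg0, sub_zero] at hval
  rw [← hval, ofReal_integral_eq_lintegral_ofReal hint
    ((ae_restrict_mem measurableSet_Ioi).mono hnn)]
  refine setLIntegral_congr_fun measurableSet_Ioi fun t ht => ?_
  have : (0 : ℝ) < t := ht
  rw [← ENNReal.ofReal_mul (by positivity)]

/-- Layer-cake formula: log(1 + l x) is the integral of l / (1 + l t) over t in (0, x), weighted by
the tail of W. -/
theorem lintegral_log_lawW {l : ℝ} (hl : 0 ≤ l) :
    ∫⁻ x, ENNReal.ofReal (Real.log (1 + l * x)) ∂lawW = ENNReal.ofReal (exponentW l) := by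
  rcases hl.eq_or_lt with rfl | hl0
  · simp [exponentW]
  have hcont : ∀ t : ℝ, 0 ≤ t → ContinuousOn (fun t => l / (1 + l * t)) (uIcc 0 t) := by
    intro t ht
    rw [uIcc_of_le ht]
    refine ContinuousOn.div (by fun_prop) (by fun_prop) fun s hs => ?_
    have := hs.1
    positivity
  have h := lintegral_comp_eq_lintegral_meas_lt_mul lawW (f := fun x => x)
    (g := fun t => l / (1 + l * t)) lawW_ae_nonneg aemeasurable_id
    (fun t ht => (hcont t ht.le).intervalIntegrable) (by
      filter_upwards [ae_restrict_mem measurableSet_Ioi] with t ht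
      have : (0 : ℝ) < t := ht
      positivity)
  rw [← lintegral_Ioi_exponentW hl0]
  refine Eq.trans (lintegral_congr_ae ?_) (h.trans ?_)
  · filter_upwards [lawW_ae_nonneg] with x hx
    congr 1
    rw [intervalIntegral.integral_eq_sub_of_hasDerivAt (f := fun t => Real.log (1 + l * t))
      (fun t ht => ?_) (hcont x hx).intervalIntegrable]
    · simp
    · rw [uIcc_of_le hx] at ht
      have := ht.1
      have h1 : HasDerivAt (fun t : ℝ => 1 + l * t) l t := by
        simpa using ((hasDerivAt_id t).const_mul l).const_add 1
      exact h1.log (by positivity)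
  · refine setLIntegral_congr_fun measurableSet_Ioi fun t ht => ?_
    have : (0 : ℝ) < t := ht
    rw [← lawW_Ioi this.le]
    rfl

theorem isProbabilityMeasure_bernoulliLaw {σ : ℝ} (hσ : 0 ≤ σ) (hσ1 : σ ≤ 1) :
    IsProbabilityMeasure (bernoulliLaw σ) := by
  constructor
  simp [bernoulliLaw, ← ENNReal.ofReal_add hσ (sub_nonneg.2 hσ1)]

instance isFiniteMeasure_bernoulliLaw (σ : ℝ) : IsFiniteMeasure (bernoulliLaw σ) := by
  constructor
  simp [bernoulliLaw]

theorem isProbabilityMeasure_thinnedLaw {F : Measure ℝ} [IsProbabilityMeasure F] {σ : ℝ}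
    (hσ : 0 ≤ σ) (hσ1 : σ ≤ 1) : IsProbabilityMeasure (thinnedLaw F σ) := by
  have := isProbabilityMeasure_bernoulliLaw hσ hσ1
  unfold thinnedLaw
  infer_instance

theorem thinnedLaw_ae_nonneg {F : Measure ℝ} [IsProbabilityMeasure F] (hF : ∀ᵐ x ∂F, 0 ≤ x)
    (σ : ℝ) : ∀ᵐ x ∂thinnedLaw F σ, 0 ≤ x := by
  refine ae_nonneg_mconv hF ?_
  rw [bernoulliLaw, ae_add_measure_iff]
  constructor <;> refine Measure.ae_smul_measure ?_ _ <;>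
    exact (ae_dirac_iff measurableSet_Ici).2 (by simp)

/-- The event that the Bernoulli factor is 0 contributes log 1 = 0, so thinning only scales the
exponent. -/
theorem lintegral_log_thinnedLaw {F : Measure ℝ} [IsProbabilityMeasure F] {σ : ℝ} (hσ : 0 ≤ σ)
    {l c : ℝ} (h : ∫⁻ x, ENNReal.ofReal (Real.log (1 + l * x)) ∂F = ENNReal.ofReal c) :
    ∫⁻ x, ENNReal.ofReal (Real.log (1 + l * x)) ∂thinnedLaw F σ = ENNReal.ofReal (σ * c) := by
  rw [thinnedLaw, lintegral_mconv_symm (by fun_prop), bernoulliLaw, lintegral_add_measure,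
    lintegral_smul_measure, lintegral_smul_measure, lintegral_dirac, lintegral_dirac]
  simp [h, ENNReal.ofReal_mul hσ]

/-! ### The Dirichlet distribution -/

theorem lintegral_pi_prod {ι : Type*} [Fintype ι] {μ : ι → Measure ℝ}
    [∀ i, IsProbabilityMeasure (μ i)] {f : ι → ℝ → ℝ≥0∞} (hf : ∀ i, Measurable (f i)) :
    ∫⁻ x, ∏ i, f i (x i) ∂Measure.pi μ = ∏ i, ∫⁻ x, f i x ∂μ i := by
  have hind : iIndepFun (fun i (x : ι → ℝ) => f i (x i)) (Measure.pi μ) :=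
    iIndepFun_pi (fun i => (hf i).aemeasurable)
  rw [lintegral_prod_eq_prod_lintegral_of_indepFun _ _ hind fun i => by fun_prop]
  refine Finset.prod_congr rfl fun i _ => ?_
  rw [← lintegral_map (hf i) (measurable_pi_apply i), (measurePreserving_eval μ i).map_eq]

theorem pi_withDensity {ι : Type*} [Fintype ι] {μ : ι → Measure ℝ}
    [∀ i, IsProbabilityMeasure (μ i)] {f : ι → ℝ → ℝ≥0∞} (hf : ∀ i, Measurable (f i))
    [∀ i, SigmaFinite ((μ i).withDensity (f i))] :
    Measure.pi (fun i => (μ i).withDensity (f i)) =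
      (Measure.pi μ).withDensity fun x => ∏ i, f i (x i) := by
  refine Measure.pi_eq fun s hs => ?_
  rw [withDensity_apply _ (MeasurableSet.univ_pi hs),
    ← lintegral_indicator (MeasurableSet.univ_pi hs)]
  have : ∀ x : ι → ℝ, (univ.pi s).indicator (fun x => ∏ i, f i (x i)) x =
      ∏ i, (s i).indicator (f i) (x i) := by
    intro x
    by_cases hx : x ∈ univ.pi s
    · rw [indicator_of_mem hx]
      exact Finset.prod_congr rfl fun i _ => (indicator_of_mem (hx i (mem_univ i)) _).symm
    · rw [indicator_of_notMem hx]
      simp only [mem_univ_pi, not_forall] at hx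
      obtain ⟨i, hi⟩ := hx
      exact (Finset.prod_eq_zero (Finset.mem_univ i) (indicator_of_notMem hi _)).symm
  simp_rw [this]
  rw [lintegral_pi_prod fun i => (hf i).indicator (hs i)]
  refine Finset.prod_congr rfl fun i _ => ?_
  rw [lintegral_indicator (hs i), withDensity_apply _ (hs i)]

instance isProbabilityMeasure_gammaLaw (a : ℝ) : IsProbabilityMeasure (gammaLaw a) := by
  unfold gammaLaw
  split_ifs with h
  · exact isProbabilityMeasure_gammaMeasure h one_pos
  · infer_instance

theorem gammaLaw_ae_nonneg (a : ℝ) : ∀ᵐ x ∂gammaLaw a, 0 ≤ x := by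
  unfold gammaLaw
  split_ifs with h
  · exact (gammaMeasure_ae_pos a 1).mono fun _ hx => hx.le
  · exact (ae_dirac_iff measurableSet_Ici).2 le_rfl

theorem lintegral_exp_gammaLaw {a l : ℝ} (ha : 0 ≤ a) (hl : 0 ≤ l) :
    ∫⁻ x, ENNReal.ofReal (Real.exp (-(l * x))) ∂gammaLaw a =
      ENNReal.ofReal ((1 + l) ^ (-a)) := by
  rcases ha.eq_or_lt with rfl | ha
  · simp [gammaLaw, lintegral_dirac]
  · rw [gammaLaw, if_pos ha, lintegral_exp_gammaMeasure ha hl]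

/-- Tilting a gamma law by exp(-c x) only rescales it: both sides have Laplace transform (1 + c +
l)^(-a). Comparing transforms covers the point mass a = 0 as well. -/
theorem gammaLaw_withDensity {a c : ℝ} (ha : 0 ≤ a) (hc : 0 ≤ c) :
    (gammaLaw a).withDensity (fun x => ENNReal.ofReal (Real.exp (-(c * x)))) =
      ENNReal.ofReal ((1 + c) ^ (-a)) • (gammaLaw a).map (· / (1 + c)) := by
  have hc1 : 0 < 1 + c := by linarith
  have hfin : IsFiniteMeasure
      ((gammaLaw a).withDensity (fun x => ENNReal.ofReal (Real.exp (-(c * x))))) := by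
    refine isFiniteMeasure_withDensity ?_
    rw [lintegral_exp_gammaLaw ha hc]
    exact ENNReal.ofReal_ne_top
  have hfin2 : IsFiniteMeasure
      (ENNReal.ofReal ((1 + c) ^ (-a)) • (gammaLaw a).map (· / (1 + c))) :=
    (gammaLaw a).map (· / (1 + c)) |>.smul_finite ENNReal.ofReal_ne_top
  refine ext_of_laplace ((withDensity_absolutelyContinuous _ _).ae_le (gammaLaw_ae_nonneg a))
    (Measure.ae_smul_measure ?_ _) fun l hl => ?_
  · rw [ae_map_iff (by fun_prop) measurableSet_Ici]
    filter_upwards [gammaLaw_ae_nonneg a] with x hx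
    exact div_nonneg hx hc1.le
  · rw [lintegral_withDensity_eq_lintegral_mul _ (by fun_prop) (by fun_prop),
      lintegral_smul_measure, lintegral_map (by fun_prop) (by fun_prop)]
    have h1 : ∀ x, ((fun x => ENNReal.ofReal (Real.exp (-(c * x)))) *
        fun x => ENNReal.ofReal (Real.exp (-(l * x)))) x =
        ENNReal.ofReal (Real.exp (-((c + l) * x))) := by
      intro x
      rw [Pi.mul_apply, ← ENNReal.ofReal_mul (Real.exp_pos _).le, ← Real.exp_add]
      congr 2
      ring
    have h2 : ∀ x, l * (x / (1 + c)) = l / (1 + c) * x := fun x => by ring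
    simp_rw [h1, h2]
    rw [lintegral_exp_gammaLaw ha (by positivity), lintegral_exp_gammaLaw ha (by positivity),
      smul_eq_mul, ← ENNReal.ofReal_mul (by positivity), ← Real.mul_rpow (by positivity)
      (by positivity)]
    congr 2
    field_simp
    ring

theorem pi_gammaLaw_withDensity {ι : Type*} [Fintype ι] {a : ι → ℝ} (ha : ∀ i, 0 ≤ a i) {c : ℝ}
    (hc : 0 ≤ c) :
    (Measure.pi fun i => gammaLaw (a i)).withDensity
      (fun x => ENNReal.ofReal (Real.exp (-(c * ∑ i, x i)))) =
      ENNReal.ofReal ((1 + c) ^ (-∑ i, a i)) •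
        (Measure.pi fun i => gammaLaw (a i)).map fun x i => x i / (1 + c) := by
  have hc1 : 0 < 1 + c := by linarith
  have hprod : ∀ x : ι → ℝ, ENNReal.ofReal (Real.exp (-(c * ∑ i, x i))) =
      ∏ i, ENNReal.ofReal (Real.exp (-(c * x i))) := by
    intro x
    rw [← ENNReal.ofReal_prod_of_nonneg fun i _ => (Real.exp_pos _).le, ← Real.exp_sum,
      Finset.mul_sum, Finset.sum_neg_distrib]
  have hconst : ENNReal.ofReal ((1 + c) ^ (-∑ i, a i)) =
      ∏ i, ENNReal.ofReal ((1 + c) ^ (-a i)) := by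
    rw [← ENNReal.ofReal_prod_of_nonneg fun i _ => by positivity, ← Real.rpow_sum_of_pos hc1,
      Finset.sum_neg_distrib]
  have hfin : ∀ i, IsFiniteMeasure
      ((gammaLaw (a i)).withDensity (fun x => ENNReal.ofReal (Real.exp (-(c * x))))) := by
    intro i
    refine isFiniteMeasure_withDensity ?_
    rw [lintegral_exp_gammaLaw (ha i) hc]
    exact ENNReal.ofReal_ne_top
  have hmp : ∀ i, IsProbabilityMeasure ((gammaLaw (a i)).map (· / (1 + c))) :=
    fun i => Measure.isProbabilityMeasure_map (by fun_prop)
  simp_rw [hprod]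
  rw [← pi_withDensity (f := fun _ x => ENNReal.ofReal (Real.exp (-(c * x))))
    (fun i => by fun_prop), Measure.pi_map_pi (f := fun _ x => x / (1 + c)) (fun i => by fun_prop),
    hconst]
  refine Measure.pi_eq fun s hs => ?_
  rw [Measure.smul_apply, Measure.pi_pi, smul_eq_mul, ← Finset.prod_mul_distrib]
  refine Finset.prod_congr rfl fun i _ => ?_
  rw [gammaLaw_withDensity (ha i) hc, Measure.smul_apply, smul_eq_mul]

/-- The sum of independent gamma variables is independent of their proportions. -/
theorem map_proportions_sum {k : ℕ} {a : Fin k → ℝ} (ha : ∀ i, 0 ≤ a i) (hθ : 0 < ∑ i, a i) :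
    (Measure.pi fun i => gammaLaw (a i)).map
      (fun g => ((fun i => g i / ∑ j, g j : Fin k → ℝ), ∑ j, g j)) =
      (dirichletLaw a).prod (gammaMeasure (∑ i, a i) 1) := by
  set γ := Measure.pi fun i => gammaLaw (a i) with hγ
  have hD : Measurable fun (g : Fin k → ℝ) i => g i / ∑ j, g j := by fun_prop
  have hS : Measurable fun g : Fin k → ℝ => ∑ j, g j := by fun_prop
  have hprob := isProbabilityMeasure_gammaMeasure hθ one_pos
  have hprob2 : IsProbabilityMeasure (dirichletLaw a) :=
    Measure.isProbabilityMeasure_map hD.aemeasurable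
  have hnn : ∀ᵐ g ∂γ, 0 ≤ ∑ j, g j := by
    have : ∀ᵐ g ∂γ, ∀ i, 0 ≤ g i := ae_all_iff.2 fun i =>
      (Measure.quasiMeasurePreserving_eval (fun i => gammaLaw (a i)) i).ae
        (gammaLaw_ae_nonneg (a i))
    filter_upwards [this] with g hg
    exact Finset.sum_nonneg fun i _ => hg i
  refine (Measure.prod_eq fun B A hB hA => ?_).symm
  have hB' : MeasurableSet ((fun (g : Fin k → ℝ) i => g i / ∑ j, g j) ⁻¹' B) := hD hB
  -- On the event that the proportions lie in B, the weight exp(-l Σ) amounts to rescaling all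
  -- coordinates, which leaves the proportions unchanged. The Laplace transform of the sum on this
  -- event thus factors.
  have key : (γ.restrict ((fun (g : Fin k → ℝ) i => g i / ∑ j, g j) ⁻¹' B)).map
      (fun g => ∑ j, g j) = dirichletLaw a B • gammaMeasure (∑ i, a i) 1 := by
    have hfin : IsFiniteMeasure (dirichletLaw a B • gammaMeasure (∑ i, a i) 1) :=
      Measure.smul_finite _ (measure_ne_top _ _)
    refine ext_of_laplace ?_ (Measure.ae_smul_measure
      ((gammaMeasure_ae_pos _ 1).mono fun _ hx => hx.le) _) fun l hl => ?_
    · rw [ae_map_iff hS.aemeasurable measurableSet_Ici]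
      exact ae_restrict_of_ae hnn
    · rw [lintegral_map (by fun_prop) hS, lintegral_smul_measure, lintegral_exp_gammaMeasure hθ hl,
        ← withDensity_apply _ hB', pi_gammaLaw_withDensity ha hl, Measure.smul_apply,
        Measure.map_apply (by fun_prop) hB', dirichletLaw, Measure.map_apply hD hB, smul_eq_mul,
        smul_eq_mul, mul_comm]
      congr 2
      ext g
      have hl1 : 1 + l ≠ 0 := by positivity
      simp only [mem_preimage, ← Finset.sum_div, div_div_div_cancel_right₀ hl1]
  rw [Measure.map_apply (hD.prodMk hS) (hB.prod hA)]
  have := congrArg (fun ν => ν A) key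
  simp only [Measure.smul_apply, smul_eq_mul] at this
  rw [← this, Measure.map_apply hS hA, Measure.restrict_apply (hS hA)]
  congr 1
  ext g
  simp [and_comm]

/-- The power (1 + s)^(-Σa) is a gamma Laplace transform. The gamma variable introduced this way
recombines with the proportions into independent gamma variables, where the integral is a product.
-/
theorem lintegral_dirichletLaw {k : ℕ} {a : Fin k → ℝ} (ha : ∀ i, 0 ≤ a i)
    (hθ : 0 < ∑ i, a i) {x : Fin k → ℝ} (hx : ∀ i, 0 ≤ x i) :
    ∫⁻ d, ENNReal.ofReal ((1 + ∑ i, x i * d i) ^ (-∑ i, a i)) ∂dirichletLaw a =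
      ∏ i, ENNReal.ofReal ((1 + x i) ^ (-a i)) := by
  have hD : Measurable fun (g : Fin k → ℝ) i => g i / ∑ j, g j := by fun_prop
  have hS : Measurable fun g : Fin k → ℝ => ∑ j, g j := by fun_prop
  have hprob := isProbabilityMeasure_gammaMeasure hθ one_pos
  have hprob2 : IsProbabilityMeasure (dirichletLaw a) :=
    Measure.isProbabilityMeasure_map hD.aemeasurable
  have hnn : ∀ᵐ g ∂(Measure.pi fun i => gammaLaw (a i)), ∀ i, 0 ≤ g i := ae_all_iff.2 fun i =>
      (Measure.quasiMeasurePreserving_eval (fun i => gammaLaw (a i)) i).ae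
        (gammaLaw_ae_nonneg (a i))
  have hdnn : ∀ᵐ d ∂dirichletLaw a, ∀ i, 0 ≤ d i := by
    rw [dirichletLaw, ae_map_iff hD.aemeasurable
      (by simp only [ofPred_forall]; exact MeasurableSet.iInter fun i =>
        measurableSet_le measurable_const (measurable_pi_apply i))]
    filter_upwards [hnn] with g hg i
    exact div_nonneg (hg i) (Finset.sum_nonneg fun j _ => hg j)
  calc ∫⁻ d, ENNReal.ofReal ((1 + ∑ i, x i * d i) ^ (-∑ i, a i)) ∂dirichletLaw a
      = ∫⁻ d, ∫⁻ s, ENNReal.ofReal (Real.exp (-((∑ i, x i * d i) * s)))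
          ∂gammaMeasure (∑ i, a i) 1 ∂dirichletLaw a := by
        refine lintegral_congr_ae ?_
        filter_upwards [hdnn] with d hd
        exact (lintegral_exp_gammaMeasure hθ
          (Finset.sum_nonneg fun i _ => mul_nonneg (hx i) (hd i))).symm
    _ = ∫⁻ p : (Fin k → ℝ) × ℝ, ENNReal.ofReal (Real.exp (-((∑ i, x i * p.1 i) * p.2)))
          ∂(dirichletLaw a).prod (gammaMeasure (∑ i, a i) 1) := by
        rw [lintegral_prod _ (by fun_prop)]
    _ = ∫⁻ g, ∏ i, ENNReal.ofReal (Real.exp (-(x i * g i)))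
          ∂Measure.pi fun i => gammaLaw (a i) := by
        rw [← map_proportions_sum ha hθ, lintegral_map (by fun_prop) (hD.prodMk hS)]
        refine lintegral_congr_ae ?_
        filter_upwards [hnn] with g hg
        rw [← ENNReal.ofReal_prod_of_nonneg fun i _ => (Real.exp_pos _).le, ← Real.exp_sum,
          Finset.sum_neg_distrib, Finset.sum_mul]
        congr 3
        refine Finset.sum_congr rfl fun i _ => ?_
        -- If the sum vanishes the proportions are 0 by the division convention, but then all
        -- coordinates vanish too.
        rcases eq_or_ne (∑ j, g j) 0 with h0 | h0
        · rw [(Finset.sum_eq_zero_iff_of_nonneg fun j _ => hg j).1 h0 i (Finset.mem_univ i)]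
          simp
        · rw [mul_assoc, div_mul_cancel₀ _ h0]
    _ = ∏ i, ENNReal.ofReal ((1 + x i) ^ (-a i)) := by
        rw [lintegral_pi_prod (f := fun i g => ENNReal.ofReal (Real.exp (-(x i * g))))
          fun i => by fun_prop]
        exact Finset.prod_congr rfl fun i _ => lintegral_exp_gammaLaw (ha i) (hx i)

theorem dirichletLaw_ae_eq_zero {k : ℕ} {a : Fin k → ℝ} {i : Fin k} (hi : a i = 0) :
    ∀ᵐ d ∂dirichletLaw a, d i = 0 := by
  rw [dirichletLaw, ae_map_iff (by fun_prop)
    (measurableSet_eq_fun (measurable_pi_apply i) measurable_const)]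
  have h0 : ∀ᵐ x ∂gammaLaw (a i), x = 0 := by
    rw [hi, gammaLaw, if_neg (lt_irrefl _)]
    exact (ae_dirac_iff (measurableSet_singleton _)).2 rfl
  filter_upwards [(Measure.quasiMeasurePreserving_eval (fun i => gammaLaw (a i)) i).ae h0] with g hg
  simp only [Function.eval] at hg
  simp [hg]

/-! ### Means of Dirichlet processes -/

theorem ofReal_rpow_neg_eq {m θ : ℝ} (hm : 0 ≤ m) :
    ENNReal.ofReal ((1 + m) ^ (-θ)) = (1 + ENNReal.ofReal m) ^ (-θ) := by
  rw [← ENNReal.ofReal_rpow_of_pos (by positivity), ENNReal.ofReal_add zero_le_one hm,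
    ENNReal.ofReal_one]

variable {Ω : Type*} [MeasurableSpace Ω] {μ : Measure Ω} {P : Ω → Measure ℝ} {θ : ℝ}
  {F : Measure ℝ}

theorem tendsto_levyExponent_zero (hF : ∀ᵐ x ∂F, 0 ≤ x)
    (hint : Integrable (fun x => Real.log (1 + 1 * x)) F) :
    Tendsto (fun n : ℕ => levyExponent F (1 / ((n : ℝ) + 1))) atTop (𝓝 0) := by
  have : (0 : ℝ) = ∫ _x, (0 : ℝ) ∂F := by simp
  rw [this]
  refine tendsto_integral_of_dominated_convergence _ (fun n => ?_) hint (fun n => ?_) ?_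
  · exact Measurable.aestronglyMeasurable (by fun_prop)
  · filter_upwards [hF] with x hx
    have hn : 1 / ((n : ℝ) + 1) ≤ 1 := by
      rw [div_le_one (by positivity)]
      linarith [n.cast_nonneg (α := ℝ)]
    have hn0 : 0 ≤ 1 / ((n : ℝ) + 1) * x := by positivity
    rw [Real.norm_of_nonneg (Real.log_nonneg (by linarith))]
    exact Real.log_le_log (by linarith) (by gcongr)
  · filter_upwards [hF] with x hx
    have := ((tendsto_one_div_add_atTop_nhds_zero_nat (𝕜 := ℝ)).mul_const x).const_add 1
    simpa using this.log (by simp)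

theorem IsDirichletProcess.measurable_lintegral (hP : IsDirichletProcess P θ F μ)
    {f : ℝ → ℝ≥0∞} (hf : Measurable f) : Measurable fun ω => ∫⁻ x, f x ∂P ω :=
  (Measure.measurable_lintegral hf).comp hP.measurable

/-- For the partition into negative and nonnegative numbers, the first Dirichlet parameter is 0, so
that coordinate is almost surely 0. -/
theorem IsDirichletProcess.ae_nonneg (hP : IsDirichletProcess P θ F μ) (hF : ∀ᵐ x ∂F, 0 ≤ x) :
    ∀ᵐ ω ∂μ, ∀ᵐ x ∂P ω, 0 ≤ x := by
  let C : Fin 2 → Set ℝ := ![Iio 0, Ici 0]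
  have hC : IsMeasurablePartition C univ := by
    refine ⟨fun i => ?_, fun i j hij => ?_, ?_⟩
    · fin_cases i <;> simp [C]
    · fin_cases i <;> fin_cases j <;> simp_all [C]
    · ext x
      simp only [mem_iUnion, mem_univ, iff_true]
      rcases lt_or_ge x 0 with h | h
      · exact ⟨0, h⟩
      · exact ⟨1, h⟩
  have hF0 : F.real (C 0) = 0 := by
    have : F (Iio 0) = 0 := by
      rw [ae_iff] at hF
      simp only [not_le] at hF
      exact hF
    simp [C, measureReal_def, this]
  have hm : Measurable fun ω i => (P ω).real (C i) := by
    refine measurable_pi_lambda _ fun i => ?_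
    exact ((Measure.measurable_coe (hC.measurableSet i)).comp hP.measurable).ennreal_toReal
  have h := dirichletLaw_ae_eq_zero (a := fun i => θ * F.real (C i)) (i := 0) (by simp [hF0])
  rw [← hP.fidi 2 C hC] at h
  filter_upwards [ae_of_ae_map hm.aemeasurable h] with ω hω
  have := hP.isProbabilityMeasure ω
  rw [ae_iff]
  simp only [not_le]
  exact (measureReal_eq_zero_iff).1 hω

theorem IsDirichletProcess.meanFunctional_ae_eq (hP : IsDirichletProcess P θ F μ)
    (hF : ∀ᵐ x ∂F, 0 ≤ x) :
    meanFunctional P =ᵐ[μ] fun ω => (∫⁻ x, ENNReal.ofReal x ∂P ω).toReal := by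
  filter_upwards [hP.ae_nonneg hF] with ω h2
  exact integral_eq_lintegral_of_nonneg_ae h2 measurable_id.aestronglyMeasurable

theorem IsDirichletProcess.aemeasurable_meanFunctional (hP : IsDirichletProcess P θ F μ)
    (hF : ∀ᵐ x ∂F, 0 ≤ x) : AEMeasurable (meanFunctional P) μ :=
  ((hP.measurable_lintegral (by fun_prop)).ennreal_toReal.aemeasurable).congr
    (hP.meanFunctional_ae_eq hF).symm

theorem IsDirichletProcess.ae_nonneg_map_meanFunctional (hP : IsDirichletProcess P θ F μ)
    (hF : ∀ᵐ x ∂F, 0 ≤ x) : ∀ᵐ m ∂μ.map (meanFunctional P), 0 ≤ m := by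
  rw [ae_map_iff (hP.aemeasurable_meanFunctional hF) measurableSet_Ici]
  filter_upwards [hP.meanFunctional_ae_eq hF] with ω h
  rw [h]
  exact ENNReal.toReal_nonneg

variable [IsProbabilityMeasure F]

theorem sum_real_preimage_eq_one (F : Measure ℝ) [IsProbabilityMeasure F] {k : ℕ}
    {C : Fin k → Set ℝ} (hC : IsMeasurablePartition C univ) : ∑ i, F.real (C i) = 1 := by
  rw [← measureReal_biUnion_finset (fun i _ j _ hij => hC.disjoint i j hij)
    fun i _ => hC.measurableSet i]
  simp [hC.iUnion_eq]

/-- The fibres of f form a finite partition, so only the finite-dimensional laws matter, and the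
resulting product of powers is the exponential of an integral against F. -/
theorem IsDirichletProcess.lintegral_simpleFunc (hP : IsDirichletProcess P θ F μ) (hθ : 0 < θ)
    (f : SimpleFunc ℝ ℝ) (hf : ∀ x, 0 ≤ f x) :
    ∫⁻ ω, (1 + ∫⁻ x, ENNReal.ofReal (f x) ∂P ω) ^ (-θ) ∂μ =
      ENNReal.ofReal (Real.exp (-(θ * ∫ x, Real.log (1 + f x) ∂F))) := by
  classical
  set e := f.range.equivFin.symm with he
  set c : Fin f.range.card → ℝ := fun i => (e i : ℝ) with hcdef
  set C : Fin f.range.card → Set ℝ := fun i => f ⁻¹' {c i} with hC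
  have hc : ∀ i, 0 ≤ c i := by
    intro i
    obtain ⟨y, hy⟩ := SimpleFunc.mem_range.1 (e i).2
    simp only [hcdef, ← hy, hf]
  have hpart : IsMeasurablePartition C univ := by
    refine ⟨fun i => f.measurableSet_fiber _, fun i j hij => ?_, ?_⟩
    · refine Disjoint.preimage _ (disjoint_singleton.2 fun h => hij ?_)
      exact e.injective (Subtype.ext h)
    · refine eq_univ_of_forall fun x => mem_iUnion.2 ⟨e.symm ⟨f x, f.mem_range_self x⟩, ?_⟩
      simp [hC, hcdef]
  have hsum : ∀ (ν : Measure ℝ) [IsProbabilityMeasure ν] (g : ℝ → ℝ),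
      ∫ x, g (f x) ∂ν = ∑ i, g (c i) * ν.real (C i) := by
    intro ν _ g
    have hpt : ∀ x, g (f x) = ∑ i, (C i).indicator (fun _ => g (c i)) x := by
      intro x
      rw [Finset.sum_eq_single (e.symm ⟨f x, f.mem_range_self x⟩)]
      · rw [indicator_of_mem (by simp [hC, hcdef])]
        simp [hcdef]
      · intro i _ hi
        refine indicator_of_notMem (fun hx => hi ?_) _
        rw [Equiv.eq_symm_apply]
        exact Subtype.ext (Eq.symm hx)
      · simp
    simp_rw [hpt]
    rw [integral_finsetSum _ fun i _ =>
      (integrable_const _).indicator (f.measurableSet_fiber _)]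
    refine Finset.sum_congr rfl fun i _ => ?_
    rw [integral_indicator_const _ (f.measurableSet_fiber _), smul_eq_mul, mul_comm]
  have hθsum : ∑ i, θ * F.real (C i) = θ := by
    rw [← Finset.mul_sum, sum_real_preimage_eq_one F hpart, mul_one]
  have hlaw := hP.fidi _ C hpart
  have hm : Measurable fun ω i => (P ω).real (C i) := by
    refine measurable_pi_lambda _ fun i => ?_
    exact ((Measure.measurable_coe (hpart.measurableSet i)).comp hP.measurable).ennreal_toReal
  have hdir := lintegral_dirichletLaw (a := fun i => θ * F.real (C i)) (fun i => by positivity)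
    (by rw [hθsum]; exact hθ) hc
  rw [hθsum, ← hlaw, lintegral_map (by fun_prop) hm] at hdir
  have hl : ∀ ω, (1 + ∫⁻ x, ENNReal.ofReal (f x) ∂P ω) ^ (-θ) =
      ENNReal.ofReal ((1 + ∑ i, c i * (P ω).real (C i)) ^ (-θ)) := by
    intro ω
    have := hP.isProbabilityMeasure ω
    rw [ofReal_rpow_neg_eq (Finset.sum_nonneg fun i _ => mul_nonneg (hc i) measureReal_nonneg),
      ← hsum (P ω) (fun y => y), ofReal_integral_eq_lintegral_ofReal
        (SimpleFunc.integrable_of_isFiniteMeasure f) (ae_of_all _ hf)]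
  simp_rw [hl]
  rw [hdir, hsum F fun y => Real.log (1 + y), ← ENNReal.ofReal_prod_of_nonneg
    fun i _ => Real.rpow_nonneg (by linarith [hc i]) _, Finset.mul_sum, ← Finset.sum_neg_distrib,
    Real.exp_sum]
  congr 1
  refine Finset.prod_congr rfl fun i _ => ?_
  rw [Real.rpow_def_of_pos (by linarith [hc i])]
  congr 1
  ring

variable [IsProbabilityMeasure μ]

/-- The mean is kept in [0, ∞], so its finiteness is not presupposed. Approximation from below by
simple functions passes to the limit with the bounds 1 on the left and log(1 + l x) on the right. -/
theorem IsDirichletProcess.lintegral_extended_mean (hP : IsDirichletProcess P θ F μ)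
    (hθ : 0 < θ) (hF : ∀ᵐ x ∂F, 0 ≤ x) {l : ℝ} (hl : 0 ≤ l)
    (hint : Integrable (fun x => Real.log (1 + l * x)) F) :
    ∫⁻ ω, (1 + ENNReal.ofReal l * ∫⁻ x, ENNReal.ofReal x ∂P ω) ^ (-θ) ∂μ =
      ENNReal.ofReal (Real.exp (-(θ * levyExponent F l))) := by
  set g : ℝ → ℝ≥0∞ := fun x => ENNReal.ofReal l * ENNReal.ofReal x with hg
  have hgm : Measurable g := by fun_prop
  have hgt : ∀ x, g x ≠ ∞ := fun x => ENNReal.mul_ne_top ENNReal.ofReal_ne_top ENNReal.ofReal_ne_top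
  set f : ℕ → SimpleFunc ℝ ℝ := fun n => (SimpleFunc.eapprox g n).map ENNReal.toReal with hfdef
  have hf : ∀ n x, f n x = (SimpleFunc.eapprox g n x).toReal := fun n x => rfl
  have hf0 : ∀ n x, 0 ≤ f n x := fun n x => ENNReal.toReal_nonneg
  have hfo : ∀ n x, ENNReal.ofReal (f n x) = SimpleFunc.eapprox g n x := fun n x =>
    ENNReal.ofReal_toReal (SimpleFunc.eapprox_lt_top g n x).ne
  have hle : ∀ n x, SimpleFunc.eapprox g n x ≤ g x := fun n x => by
    rw [← SimpleFunc.iSup_eapprox_apply hgm x]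
    exact le_iSup (fun n => SimpleFunc.eapprox g n x) n
  have hlim : ∀ x, Tendsto (fun n => f n x) atTop (𝓝 (g x).toReal) := fun x =>
    (ENNReal.tendsto_toReal (hgt x)).comp (SimpleFunc.tendsto_eapprox hgm x)
  have hgx : ∀ x, 0 ≤ x → (g x).toReal = l * x := fun x hx => by
    simp only [hg]
    rw [← ENNReal.ofReal_mul hl, ENNReal.toReal_ofReal (by positivity)]
  have h1 := fun n => hP.lintegral_simpleFunc hθ (f n) (hf0 n)
  have hright : Tendsto (fun n => ENNReal.ofReal (Real.exp (-(θ * ∫ x, Real.log (1 + f n x) ∂F))))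
      atTop (𝓝 (ENNReal.ofReal (Real.exp (-(θ * levyExponent F l))))) := by
    refine ENNReal.tendsto_ofReal ((Tendsto.const_mul θ ?_).neg.rexp)
    refine tendsto_integral_of_dominated_convergence _ (fun n => ?_) hint (fun n => ?_) ?_
    · exact (Real.measurable_log.comp ((f n).measurable.const_add 1)).aestronglyMeasurable
    · filter_upwards [hF] with x hx
      have h3 : f n x ≤ l * x := by
        rw [← hgx x hx]
        exact ENNReal.toReal_mono (hgt x) (hle n x)
      have h4 := hf0 n x
      rw [Real.norm_of_nonneg (Real.log_nonneg (by linarith))]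
      exact Real.log_le_log (by linarith) (by linarith)
    · filter_upwards [hF] with x hx
      have h3 := hlim x
      rw [hgx x hx] at h3
      exact (h3.const_add 1).log (by positivity)
  have hleft : Tendsto (fun n => ∫⁻ ω, (1 + ∫⁻ x, ENNReal.ofReal (f n x) ∂P ω) ^ (-θ) ∂μ) atTop
      (𝓝 (∫⁻ ω, (1 + ENNReal.ofReal l * ∫⁻ x, ENNReal.ofReal x ∂P ω) ^ (-θ) ∂μ)) := by
    refine tendsto_lintegral_of_dominated_convergence (fun _ => 1) (fun n => ?_) (fun n => ?_)
      (by simp) ?_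
    · have := hP.measurable_lintegral (f := fun x => ENNReal.ofReal (f n x))
        (f n).measurable.ennreal_ofReal
      fun_prop
    · refine ae_of_all _ fun ω => ?_
      refine ENNReal.rpow_le_one_of_one_le_of_neg (by simp) (by linarith)
    · refine ae_of_all _ fun ω => ?_
      refine ((ENNReal.continuous_rpow_const).tendsto _).comp (Tendsto.const_add 1 ?_)
      rw [← lintegral_const_mul _ (by fun_prop)]
      simp_rw [hfo]
      refine lintegral_tendsto_of_tendsto_of_monotone (fun n => (SimpleFunc.measurable _).aemeasurable)
        (ae_of_all _ fun x n m hnm => SimpleFunc.monotone_eapprox g hnm x)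
        (ae_of_all _ fun x => SimpleFunc.tendsto_eapprox hgm x)
  simp_rw [h1] at hleft
  exact tendsto_nhds_unique hleft hright

/-- Since ∞^(-θ) = 0, the transform at any l > 0 is a lower bound for the probability that the mean
is finite. As l decreases to 0 this bound tends to 1. -/
theorem IsDirichletProcess.extended_mean_lt_top (hP : IsDirichletProcess P θ F μ)
    (hθ : 0 < θ) (hF : ∀ᵐ x ∂F, 0 ≤ x)
    (hint : ∀ l : ℝ, 0 ≤ l → Integrable (fun x => Real.log (1 + l * x)) F) :
    ∀ᵐ ω ∂μ, ∫⁻ x, ENNReal.ofReal x ∂P ω < ∞ := by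
  have hm : Measurable fun ω => ∫⁻ x, ENNReal.ofReal x ∂P ω :=
    hP.measurable_lintegral (by fun_prop)
  have hs : MeasurableSet {ω | ∫⁻ x, ENNReal.ofReal x ∂P ω < ∞} := measurableSet_lt hm measurable_const
  have hle : ∀ n : ℕ, ENNReal.ofReal (Real.exp (-(θ * levyExponent F (1 / ((n : ℝ) + 1))))) ≤
      μ {ω | ∫⁻ x, ENNReal.ofReal x ∂P ω < ∞} := by
    intro n
    have hn : 0 < 1 / ((n : ℝ) + 1) := by positivity
    rw [← hP.lintegral_extended_mean hθ hF hn.le (hint _ hn.le), ← lintegral_indicator_one hs]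
    refine lintegral_mono fun ω => ?_
    by_cases h : ∫⁻ x, ENNReal.ofReal x ∂P ω < ∞
    · rw [indicator_of_mem (by exact h)]
      exact ENNReal.rpow_le_one_of_one_le_of_neg (by simp) (by linarith)
    · rw [not_lt_top_iff.1 h, ENNReal.mul_top (by simpa using hn)]
      simp [hθ]
  have hlim := ENNReal.tendsto_ofReal
    ((tendsto_levyExponent_zero hF (hint 1 zero_le_one)).const_mul θ).neg.rexp
  have h1 : 1 ≤ μ {ω | ∫⁻ x, ENNReal.ofReal x ∂P ω < ∞} := by
    refine le_of_tendsto' (by simpa using hlim) hle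
  exact (prob_compl_eq_zero_iff hs).2 (le_antisymm prob_le_one h1)

theorem IsDirichletProcess.ae_integrable (hP : IsDirichletProcess P θ F μ)
    (hθ : 0 < θ) (hF : ∀ᵐ x ∂F, 0 ≤ x)
    (hint : ∀ l : ℝ, 0 ≤ l → Integrable (fun x => Real.log (1 + l * x)) F) :
    ∀ᵐ ω ∂μ, Integrable (fun x : ℝ => x) (P ω) := by
  filter_upwards [hP.extended_mean_lt_top hθ hF hint, hP.ae_nonneg hF] with ω h1 h2
  exact ⟨measurable_id.aestronglyMeasurable, (hasFiniteIntegral_iff_ofReal h2).2 h1⟩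

/-- The generalized Stieltjes transform of the mean of a Dirichlet process. -/
theorem IsDirichletProcess.lintegral_meanFunctional (hP : IsDirichletProcess P θ F μ)
    (hθ : 0 < θ) (hF : ∀ᵐ x ∂F, 0 ≤ x)
    (hint : ∀ l : ℝ, 0 ≤ l → Integrable (fun x => Real.log (1 + l * x)) F) {l : ℝ} (hl : 0 ≤ l) :
    ∫⁻ m, ENNReal.ofReal ((1 + l * m) ^ (-θ)) ∂μ.map (meanFunctional P) =
      ENNReal.ofReal (Real.exp (-(θ * levyExponent F l))) := by
  rw [lintegral_map' (by fun_prop) (hP.aemeasurable_meanFunctional hF),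
    ← hP.lintegral_extended_mean hθ hF hl (hint l hl)]
  refine lintegral_congr_ae ?_
  filter_upwards [hP.meanFunctional_ae_eq hF, hP.extended_mean_lt_top hθ hF hint] with ω h1 h2
  rw [h1, ofReal_rpow_neg_eq (by positivity), ENNReal.ofReal_mul hl, ENNReal.ofReal_toReal h2.ne]

/-! ### The random measure of a subordinator -/

section

variable {Ω : Type*} {ζ : unitInterval → Ω → ℝ}

theorem monotone_extendedPath {ω : Ω} (h : Monotone fun t => ζ t ω) :
    Monotone (extendedPath ζ ω) :=
  h.comp (monotone_projIcc zero_le_one)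

theorem continuousWithinAt_extendedPath {ω : Ω}
    (h : ∀ t, ContinuousWithinAt (fun s => ζ s ω) (Ioi t) t) (t : ℝ) :
    ContinuousWithinAt (extendedPath ζ ω) (Ici t) t := by
  have h1 := continuousWithinAt_Ioi_iff_Ici.1 (h (projIcc 0 1 zero_le_one t))
  exact h1.comp continuous_projIcc.continuousWithinAt
    fun s hs => mem_Ici.2 (monotone_projIcc zero_le_one (mem_Ici.1 hs))

theorem pathMeasure_Ioc {ω : Ω} (hm : Monotone fun t => ζ t ω)
    (h : ∀ t, ContinuousWithinAt (fun s => ζ s ω) (Ioi t) t) (a b : ℝ) :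
    pathMeasure ζ ω (Ioc a b) =
      ENNReal.ofReal (extendedPath ζ ω b - extendedPath ζ ω a) := by
  have hm' := monotone_extendedPath hm
  rw [pathMeasure, dif_pos hm', StieltjesFunction.measure_Ioc, hm'.stieltjesFunction_eq,
    hm'.stieltjesFunction_eq]
  congr 2
  · exact (continuousWithinAt_extendedPath h b).rightLim_eq
  · exact (continuousWithinAt_extendedPath h a).rightLim_eq

variable [MeasurableSpace Ω] {μ : Measure Ω} {θ : ℝ} {F : Measure ℝ}

/-- The path measures of a subordinator, restricted to `(0, 1]`, agree almost surely with a
random finite measure. -/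
theorem IsGGCSubordinator.exists_randomMeasure (hζ : IsGGCSubordinator ζ θ F μ) :
    ∃ κ : Ω → Measure ℝ, Measurable κ ∧ (∀ ω, IsFiniteMeasure (κ ω)) ∧
      (∀ᵐ ω ∂μ, ∀ a b : ℝ, 0 ≤ a → b ≤ 1 →
        κ ω (Ioc a b) = ENNReal.ofReal (extendedPath ζ ω b - extendedPath ζ ω a)) ∧
      (∀ᵐ ω ∂μ, ∀ C ⊆ Ioc (0 : ℝ) 1, κ ω C = pathMeasure ζ ω C) ∧
      ∀ ω, κ ω (Ioc 0 1)ᶜ = 0 := by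
  classical
  -- The path properties hold only almost surely; outside a measurable set of full measure the
  -- kernel is set to 0, so that it is measurable and finite everywhere.
  obtain ⟨s, hs, hsm, hs'⟩ :=
    (hζ.monotone.and hζ.rightContinuous).exists_measurable_mem
  set κ : Ω → Measure ℝ := fun ω => if ω ∈ s then (pathMeasure ζ ω).restrict (Ioc 0 1) else 0
    with hκ
  have hpos : ∀ ω ∈ s, κ ω = (pathMeasure ζ ω).restrict (Ioc 0 1) := fun ω h => if_pos h
  have hneg : ∀ ω ∉ s, κ ω = 0 := fun ω h => if_neg h
  have hext : ∀ t, Measurable fun ω => extendedPath ζ ω t := fun t => hζ.measurable _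
  have hIoc : ∀ ω ∈ s, ∀ a b : ℝ, pathMeasure ζ ω (Ioc a b) =
      ENNReal.ofReal (extendedPath ζ ω b - extendedPath ζ ω a) := fun ω h a b =>
    pathMeasure_Ioc (hs' ω h).1 (hs' ω h).2 a b
  have hfin : ∀ ω, IsFiniteMeasure (κ ω) := by
    intro ω
    by_cases h : ω ∈ s
    · rw [hpos ω h]
      refine ⟨?_⟩
      rw [Measure.restrict_apply_univ, hIoc ω h]
      exact ENNReal.ofReal_lt_top
    · rw [hneg ω h]
      infer_instance
  have hmeas : ∀ b : ℝ, b ≤ 1 →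
      Measurable fun ω => if ω ∈ s then pathMeasure ζ ω (Ioc 0 b) else 0 := by
    intro b _
    have : (fun ω => if ω ∈ s then pathMeasure ζ ω (Ioc 0 b) else 0) = s.indicator
        fun ω => ENNReal.ofReal (extendedPath ζ ω b - extendedPath ζ ω 0) := by
      ext ω
      by_cases h : ω ∈ s
      · simp [h, hIoc ω h]
      · simp [h]
    rw [this]
    exact (((hext b).sub (hext 0)).ennreal_ofReal).indicator hsm
  refine ⟨κ, ?_, hfin, ?_, ?_, ?_⟩
  · refine Measurable.measure_of_isPiSystem (borel_eq_generateFrom_Iic ℝ) isPiSystem_Iic ?_ ?_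
    · rintro _ ⟨x, rfl⟩
      have : (fun ω => κ ω (Iic x)) =
          fun ω => if ω ∈ s then pathMeasure ζ ω (Ioc 0 (min x 1)) else 0 := by
        ext ω
        by_cases h : ω ∈ s
        · rw [hpos ω h, Measure.restrict_apply measurableSet_Iic, if_pos h]
          congr 1
          ext y
          simp only [mem_inter_iff, mem_Iic, mem_Ioc, le_min_iff]
          tauto
        · simp [hneg ω h, h]
      rw [this]
      exact hmeas _ (min_le_right _ _)
    · have : (fun ω => κ ω univ) = fun ω => if ω ∈ s then pathMeasure ζ ω (Ioc 0 1) else 0 := by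
        ext ω
        by_cases h : ω ∈ s
        · rw [hpos ω h, Measure.restrict_apply_univ, if_pos h]
        · simp [hneg ω h, h]
      rw [this]
      exact hmeas 1 le_rfl
  · filter_upwards [hs] with ω h a b ha hb
    rw [hpos ω h, Measure.restrict_apply measurableSet_Ioc, ← hIoc ω h,
      inter_eq_left.2 (Ioc_subset_Ioc ha hb)]
  · filter_upwards [hs] with ω h C hC
    rw [hpos ω h, Measure.restrict_eq_self _ hC]
  · intro ω
    by_cases h : ω ∈ s
    · rw [hpos ω h, Measure.restrict_apply measurableSet_Ioc.compl]
      simp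
    · simp [hneg ω h]

end

/-! ### Riemann–Stieltjes sums -/

/-- The left-continuous step function with the values of `h` on the grid of mesh `1 / n`. -/
noncomputable def gridStep (n : ℕ) (h : ℝ → ℝ) (t : ℝ) : ℝ :=
  ∑ j : Fin n, (Ioc ((j : ℝ) / n) (((j : ℝ) + 1) / n)).indicator (fun _ => h (((j : ℝ) + 1) / n)) t

theorem gridStep_of_notMem {n : ℕ} {h : ℝ → ℝ} {t : ℝ} (ht : t ∉ Ioc (0 : ℝ) 1) :
    gridStep n h t = 0 := by
  refine Finset.sum_eq_zero fun j _ => indicator_of_notMem (fun hj => ht ?_) _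
  have hn : 0 < (n : ℝ) := by exact_mod_cast j.pos
  refine ⟨lt_of_le_of_lt (by positivity) hj.1, hj.2.trans ?_⟩
  rw [div_le_one hn]
  exact_mod_cast j.2

theorem gridStep_of_mem {n : ℕ} (hn : 0 < n) {h : ℝ → ℝ} {t : ℝ} (ht : t ∈ Ioc (0 : ℝ) 1) :
    gridStep n h t = h (⌈n * t⌉₊ / n) := by
  have hn' : (0 : ℝ) < n := by exact_mod_cast hn
  have hpos : 0 < n * t := mul_pos hn' ht.1
  have hc : 0 < ⌈n * t⌉₊ := Nat.ceil_pos.2 hpos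
  have hcn : ⌈n * t⌉₊ ≤ n := Nat.ceil_le.2 (by nlinarith [ht.2])
  have hcast : ((⌈n * t⌉₊ - 1 : ℕ) : ℝ) = (⌈n * t⌉₊ : ℝ) - 1 := by
    rw [Nat.cast_sub hc, Nat.cast_one]
  -- The cells are closed on the right, hence the cell of t has index ⌈n t⌉ - 1 and right endpoint
  -- ⌈n t⌉ / n; t > 0 keeps the natural subtraction honest.
  have hmem : ∀ j : ℕ, t ∈ Ioc ((j : ℝ) / n) (((j : ℝ) + 1) / n) ↔ j = ⌈n * t⌉₊ - 1 := by
    intro j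
    rw [mem_Ioc, div_lt_iff₀ hn', le_div_iff₀ hn', mul_comm t]
    have h1 : (n * t ≤ (j : ℝ) + 1) ↔ ⌈n * t⌉₊ ≤ j + 1 := by
      rw [Nat.ceil_le]; push_cast; rfl
    rw [← Nat.lt_ceil, h1]
    omega
  rw [gridStep, Finset.sum_eq_single (⟨⌈n * t⌉₊ - 1, by omega⟩ : Fin n)]
  · rw [indicator_of_mem ((hmem _).2 rfl), hcast, sub_add_cancel]
  · intro j _ hj
    exact indicator_of_notMem (fun hj' => hj (Fin.ext ((hmem _).1 hj'))) _
  · simp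

theorem tendsto_gridStep {h : ℝ → ℝ} (hh : Continuous h) (t : ℝ) :
    Tendsto (fun n => gridStep n h t) atTop (𝓝 ((Ioc 0 1).indicator h t)) := by
  by_cases ht : t ∈ Ioc (0 : ℝ) 1
  · rw [indicator_of_mem ht]
    have h1 : Tendsto (fun n : ℕ => (⌈(n : ℝ) * t⌉₊ : ℝ) / n) atTop (𝓝 t) := by
      have := (tendsto_nat_ceil_mul_div_atTop ht.1.le).comp
        (tendsto_natCast_atTop_atTop (R := ℝ))
      refine this.congr fun n => ?_
      simp [mul_comm]
    refine ((hh.tendsto t).comp h1).congr' ?_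
    filter_upwards [eventually_gt_atTop 0] with n hn
    exact (gridStep_of_mem hn ht).symm
  · rw [indicator_of_notMem ht]
    exact tendsto_const_nhds.congr fun n => (gridStep_of_notMem ht).symm

theorem measurable_gridStep (n : ℕ) (h : ℝ → ℝ) : Measurable (gridStep n h) :=
  Finset.measurable_fun_sum _ fun _ _ => measurable_const.indicator measurableSet_Ioc

theorem norm_gridStep_le {n : ℕ} {h : ℝ → ℝ} {M : ℝ} (hM : ∀ t, |h t| ≤ M) (t : ℝ) :
    ‖gridStep n h t‖ ≤ M := by
  have hM0 : 0 ≤ M := (abs_nonneg _).trans (hM 0)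
  by_cases ht : t ∈ Ioc (0 : ℝ) 1
  · rcases n.eq_zero_or_pos with rfl | hn
    · simpa [gridStep] using hM0
    · rw [gridStep_of_mem hn ht]
      exact hM _
  · rw [gridStep_of_notMem ht, norm_zero]
    exact hM0

theorem integral_gridStep (n : ℕ) (h : ℝ → ℝ) (ν : Measure ℝ) [IsFiniteMeasure ν] :
    ∫ t, gridStep n h t ∂ν =
      ∑ j : Fin n, h (((j : ℝ) + 1) / n) * ν.real (Ioc ((j : ℝ) / n) (((j : ℝ) + 1) / n)) := by
  unfold gridStep
  rw [integral_finsetSum _ fun j _ => (integrable_const _).indicator measurableSet_Ioc]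
  refine Finset.sum_congr rfl fun j _ => ?_
  rw [integral_indicator_const _ measurableSet_Ioc, smul_eq_mul, mul_comm]

/-- Convergence of Riemann–Stieltjes sums. -/
theorem tendsto_sum_grid {h : ℝ → ℝ} (hh : Continuous h) {M : ℝ} (hM : ∀ t, |h t| ≤ M)
    (ν : Measure ℝ) [IsFiniteMeasure ν] :
    Tendsto (fun n : ℕ => ∑ j : Fin n, h (((j : ℝ) + 1) / n) *
      ν.real (Ioc ((j : ℝ) / n) (((j : ℝ) + 1) / n))) atTop (𝓝 (∫ t in Ioc 0 1, h t ∂ν)) := by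
  simp_rw [← integral_gridStep]
  rw [← integral_indicator measurableSet_Ioc]
  exact tendsto_integral_of_dominated_convergence (fun _ => M)
    (fun n => (measurable_gridStep n h).aestronglyMeasurable) (integrable_const _)
    (fun n => ae_of_all _ (norm_gridStep_le hM)) (ae_of_all _ (tendsto_gridStep hh))

/-! ### Regularity of the Lévy exponent -/

section

variable {F : Measure ℝ}

theorem levyExponent_zero (F : Measure ℝ) : levyExponent F 0 = 0 := by
  simp [levyExponent]

theorem levyExponent_mono (hF : ∀ᵐ x ∂F, 0 ≤ x)
    (hint : ∀ l : ℝ, 0 ≤ l → Integrable (fun x => Real.log (1 + l * x)) F) {a b : ℝ}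
    (ha : 0 ≤ a) (hab : a ≤ b) : levyExponent F a ≤ levyExponent F b := by
  refine integral_mono_ae (hint a ha) (hint b (ha.trans hab)) ?_
  filter_upwards [hF] with x hx
  exact Real.log_le_log (by positivity) (by gcongr)

/-- Truncation at 0 gives a function continuous on all of ℝ, as the approximation argument requires,
without changing it on [0, ∞). -/
theorem continuous_levyExponent_max (hF : ∀ᵐ x ∂F, 0 ≤ x)
    (hint : ∀ l : ℝ, 0 ≤ l → Integrable (fun x => Real.log (1 + l * x)) F) :
    Continuous fun a => levyExponent F (max a 0) := by
  refine continuous_iff_continuousAt.2 fun a₀ => ?_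
  refine continuousAt_of_dominated (bound := fun x => Real.log (1 + (|a₀| + 1) * x)) ?_ ?_
    (hint _ (by positivity)) ?_
  · exact Eventually.of_forall fun a => Measurable.aestronglyMeasurable (by fun_prop)
  · have : ∀ᶠ a in 𝓝 a₀, a < |a₀| + 1 :=
      (continuous_id.tendsto a₀).eventually (gt_mem_nhds (by
        simp only [id_eq]; linarith [le_abs_self a₀]))
    filter_upwards [this] with a ha
    filter_upwards [hF] with x hx
    have h1 : max a 0 ≤ |a₀| + 1 := max_le ha.le (by positivity)
    have h0 : 0 ≤ max a 0 := le_max_right _ _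
    have h2 : 0 ≤ max a 0 * x := by positivity
    rw [Real.norm_of_nonneg (Real.log_nonneg (by linarith))]
    exact Real.log_le_log (by positivity) (by gcongr)
  · filter_upwards [hF] with x hx
    have h0 : 0 ≤ max a₀ 0 := le_max_right _ _
    exact ContinuousAt.log (by fun_prop) (by positivity)

/-- For b ≤ a, the logarithm of the ratio is at most (a - b) x / (1 + b x) ≤ (a - b) / ε. The bound
is only away from 0, where the slope would be the mean of F, which is infinite for W. -/
theorem levyExponent_sub_le [IsProbabilityMeasure F] (hF : ∀ᵐ x ∂F, 0 ≤ x)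
    (hint : ∀ l : ℝ, 0 ≤ l → Integrable (fun x => Real.log (1 + l * x)) F) {ε a b : ℝ}
    (hε : 0 < ε) (ha : ε ≤ a) (hb : ε ≤ b) :
    |levyExponent F a - levyExponent F b| ≤ ε⁻¹ * |a - b| := by
  wlog hab : b ≤ a generalizing a b
  · rw [abs_sub_comm, abs_sub_comm a]
    exact this hb ha (le_of_not_ge hab)
  have ha0 : 0 ≤ a := hε.le.trans ha
  have hb0 : 0 < b := hε.trans_le hb
  rw [levyExponent, levyExponent, ← integral_sub (hint a ha0) (hint b hb0.le)]
  have hbound := norm_integral_le_of_norm_le_const (μ := F) (C := ε⁻¹ * |a - b|)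
    (f := fun x => Real.log (1 + a * x) - Real.log (1 + b * x)) ?_
  · simpa using hbound
  filter_upwards [hF] with x hx
  have h1 : 0 < 1 + b * x := by positivity
  have h2 : 0 < 1 + a * x := by positivity
  have h3 : 1 + b * x ≤ 1 + a * x := by gcongr
  rw [Real.norm_of_nonneg (sub_nonneg.2 (Real.log_le_log h1 h3)), abs_of_nonneg (sub_nonneg.2 hab),
    ← Real.log_div h2.ne' h1.ne']
  refine (Real.log_le_sub_one_of_pos (div_pos h2 h1)).trans ?_
  rw [div_sub_one h1.ne', div_le_iff₀ h1, ← div_eq_inv_mul, div_mul_eq_mul_div, le_div_iff₀ hε]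
  have : 0 ≤ (a - b) * x * (b - ε) := by
    have := sub_nonneg.2 hab
    have := sub_nonneg.2 hb
    positivity
  nlinarith

end

theorem abs_exp_neg_sub_le {a b c : ℝ} (ha : c ≤ a) (hb : c ≤ b) :
    |Real.exp (-a) - Real.exp (-b)| ≤ Real.exp (-c) * |a - b| := by
  wlog hab : a ≤ b generalizing a b
  · rw [abs_sub_comm, abs_sub_comm a]
    exact this hb ha (le_of_not_ge hab)
  rw [abs_of_nonneg (sub_nonneg.2 (Real.exp_le_exp.2 (neg_le_neg hab))), abs_sub_comm,
    abs_of_nonneg (sub_nonneg.2 hab)]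
  have h1 : Real.exp (-a) - Real.exp (-b) = Real.exp (-a) * (1 - Real.exp (-(b - a))) := by
    rw [mul_sub, ← Real.exp_add]; ring_nf
  have h2 : 1 - Real.exp (-(b - a)) ≤ b - a := by
    linarith [Real.add_one_le_exp (-(b - a))]
  rw [h1]
  exact mul_le_mul (Real.exp_le_exp.2 (neg_le_neg ha)) h2
    (sub_nonneg.2 (Real.exp_le_one_iff.2 (by linarith))) (Real.exp_pos _).le

/-! ### Laplace functionals: from continuous to measurable functions -/

section

variable {Ω : Type*} [MeasurableSpace Ω] {μ : Measure Ω}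

theorem measurable_integral_randomMeasure {κ : Ω → Measure ℝ} (hκ : Measurable κ)
    [∀ ω, IsFiniteMeasure (κ ω)] {f : ℝ → ℝ} (hf : Measurable f) (hf0 : ∀ t, 0 ≤ f t) :
    Measurable fun ω => ∫ t, f t ∂κ ω := by
  have h : ∀ ω, ∫ t, f t ∂κ ω = (∫⁻ t, ENNReal.ofReal (f t) ∂κ ω).toReal := fun ω =>
    integral_eq_lintegral_of_nonneg_ae (ae_of_all _ hf0) hf.aestronglyMeasurable
  simp_rw [h]
  exact ((Measure.measurable_lintegral hf.ennreal_ofReal).comp hκ).ennreal_toReal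

theorem integrable_exp_neg_integral [IsFiniteMeasure μ] {κ : Ω → Measure ℝ} (hκ : Measurable κ)
    [∀ ω, IsFiniteMeasure (κ ω)] {f : ℝ → ℝ} (hf : Measurable f) (hf0 : ∀ t, 0 ≤ f t) :
    Integrable (fun ω => Real.exp (-∫ t, f t ∂κ ω)) μ := by
  refine Integrable.of_bound (measurable_integral_randomMeasure hκ hf hf0).neg.exp.aestronglyMeasurable
    1 (ae_of_all _ fun ω => ?_)
  rw [Real.norm_of_nonneg (Real.exp_pos _).le, Real.exp_le_one_iff, neg_nonpos]
  exact integral_nonneg hf0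

theorem integrable_of_measurable_of_bounds {ν : Measure ℝ} [IsFiniteMeasure ν] {f : ℝ → ℝ} {M : ℝ}
    (hf : Measurable f) (hf0 : ∀ t, 0 ≤ f t) (hM : ∀ t, f t ≤ M) : Integrable f ν :=
  Integrable.of_bound hf.aestronglyMeasurable M (ae_of_all _ fun t => by
    rw [Real.norm_of_nonneg (hf0 t)]; exact hM t)

/-- The intensity of a random measure weighted by `exp (-ε κ(ℝ))` is finite. -/
theorem isFiniteMeasure_weighted_bind [IsProbabilityMeasure μ] {κ : Ω → Measure ℝ}
    (hκ : Measurable κ) [∀ ω, IsFiniteMeasure (κ ω)] {ε : ℝ} (hε : 0 < ε) :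
    IsFiniteMeasure ((μ.withDensity fun ω =>
      ENNReal.ofReal (Real.exp (-(ε * (κ ω).real univ)))).bind κ) := by
  have hT : Measurable fun ω => (κ ω).real univ :=
    ((Measure.measurable_coe MeasurableSet.univ).comp hκ).ennreal_toReal
  have hm : Measurable fun ω => κ ω univ := (Measure.measurable_coe MeasurableSet.univ).comp hκ
  refine ⟨?_⟩
  rw [Measure.bind_apply MeasurableSet.univ hκ.aemeasurable,
    lintegral_withDensity_eq_lintegral_mul _ (by fun_prop) hm]
  -- The weight makes the total mass x contribute x e^(-εx) ≤ 1 / ε, whatever its law.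
  refine lt_of_le_of_lt (lintegral_mono (g := fun _ => ENNReal.ofReal ε⁻¹) fun ω => ?_) (by simp)
  simp only [Pi.mul_apply]
  rw [← ofReal_measureReal (measure_ne_top (κ ω) univ), ← ENNReal.ofReal_mul (Real.exp_pos _).le]
  refine ENNReal.ofReal_le_ofReal ?_
  have h1 := Real.add_one_le_exp (ε * (κ ω).real univ)
  rw [Real.exp_neg, ← div_eq_inv_mul, div_le_iff₀ (Real.exp_pos _), ← div_eq_inv_mul,
    le_div_iff₀ hε]
  linarith

/-- Both integrals are at least ε κ(ℝ), so the Lipschitz constant of e^(-x) on that range is the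
weight itself. This makes the Laplace functional L¹-continuous for a finite measure. -/
theorem enorm_integral_exp_sub_le [IsProbabilityMeasure μ] {κ : Ω → Measure ℝ}
    (hκ : Measurable κ) [∀ ω, IsFiniteMeasure (κ ω)] {ε : ℝ} (hε : 0 < ε) {f g : ℝ → ℝ} {M : ℝ}
    (hf : Measurable f) (hg : Measurable g) (hfε : ∀ t, ε ≤ f t) (hgε : ∀ t, ε ≤ g t)
    (hfM : ∀ t, f t ≤ M) (hgM : ∀ t, g t ≤ M) :
    ‖∫ ω, Real.exp (-∫ t, f t ∂κ ω) ∂μ - ∫ ω, Real.exp (-∫ t, g t ∂κ ω) ∂μ‖ₑ ≤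
      ∫⁻ t, ‖f t - g t‖ₑ ∂((μ.withDensity fun ω =>
        ENNReal.ofReal (Real.exp (-(ε * (κ ω).real univ)))).bind κ) := by
  have hT : Measurable fun ω => (κ ω).real univ :=
    ((Measure.measurable_coe MeasurableSet.univ).comp hκ).ennreal_toReal
  have hf0 : ∀ t, 0 ≤ f t := fun t => hε.le.trans (hfε t)
  have hg0 : ∀ t, 0 ≤ g t := fun t => hε.le.trans (hgε t)
  have hmeas : Measurable fun t => ‖f t - g t‖ₑ := by fun_prop
  have hm : Measurable fun ω => ∫⁻ t, ‖f t - g t‖ₑ ∂κ ω :=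
    (Measure.measurable_lintegral hmeas).comp hκ
  rw [← integral_sub (integrable_exp_neg_integral hκ hf hf0)
    (integrable_exp_neg_integral hκ hg hg0), Measure.lintegral_bind hκ.aemeasurable
    hmeas.aemeasurable, lintegral_withDensity_eq_lintegral_mul _ (by fun_prop) hm]
  refine (enorm_integral_le_lintegral_enorm _).trans (lintegral_mono fun ω => ?_)
  have hif : Integrable f (κ ω) := integrable_of_measurable_of_bounds hf hf0 hfM
  have hig : Integrable g (κ ω) := integrable_of_measurable_of_bounds hg hg0 hgM
  have hlow : ∀ h : ℝ → ℝ, Integrable h (κ ω) → (∀ t, ε ≤ h t) →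
      ε * (κ ω).real univ ≤ ∫ t, h t ∂κ ω := by
    intro h hi hle
    have := integral_mono (integrable_const ε) hi hle
    simpa [mul_comm] using this
  have h1 := abs_exp_neg_sub_le (hlow f hif hfε) (hlow g hig hgε)
  simp only [Pi.mul_apply]
  calc ‖Real.exp (-∫ t, f t ∂κ ω) - Real.exp (-∫ t, g t ∂κ ω)‖ₑ
      ≤ ENNReal.ofReal (Real.exp (-(ε * (κ ω).real univ)) *
          |∫ t, f t ∂κ ω - ∫ t, g t ∂κ ω|) := by
        rw [Real.enorm_eq_ofReal_abs]
        exact ENNReal.ofReal_le_ofReal h1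
    _ = ENNReal.ofReal (Real.exp (-(ε * (κ ω).real univ))) *
          ‖∫ t, f t - g t ∂κ ω‖ₑ := by
        rw [ENNReal.ofReal_mul (Real.exp_pos _).le, Real.enorm_eq_ofReal_abs,
          integral_sub hif hig]
    _ ≤ _ := by
        gcongr
        exact enorm_integral_le_lintegral_enorm _

theorem abs_sub_clamp_le {ε M x y : ℝ} (hx : ε ≤ x) (hM : x ≤ M) :
    |x - max ε (min y M)| ≤ |x - y| := by
  simp only [max_def, min_def]
  split_ifs <;> rw [abs_le] <;> rcases abs_cases (x - y) with h | h <;> constructor <;> linarith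

variable {κ : Ω → Measure ℝ} {ψ : ℝ → ℝ}

/-- Approximate f by a continuous g in L¹ of the weighted intensity plus Lebesgue measure. One side
of the identity then moves by at most δ, the other by at most L δ. -/
theorem laplaceFunctional_of_le [IsProbabilityMeasure μ] (hκ : Measurable κ)
    [∀ ω, IsFiniteMeasure (κ ω)] (hψc : Continuous ψ) (hψ0 : ∀ a, 0 ≤ ψ a)
    (H : ∀ (g : ℝ → ℝ) (M : ℝ), Continuous g → (∀ t, 0 ≤ g t) → (∀ t, g t ≤ M) →
      ∫ ω, Real.exp (-∫ t, g t ∂κ ω) ∂μ = Real.exp (-∫ t in Ioc 0 1, ψ (g t)))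
    {ε L M : ℝ} (hε : 0 < ε) (hL : 0 ≤ L)
    (hLip : ∀ a b, ε ≤ a → ε ≤ b → |ψ a - ψ b| ≤ L * |a - b|) {f : ℝ → ℝ}
    (hf : Measurable f) (hfε : ∀ t, ε ≤ f t) (hfM : ∀ t, f t ≤ M) :
    ∫ ω, Real.exp (-∫ t, f t ∂κ ω) ∂μ = Real.exp (-∫ t in Ioc 0 1, ψ (f t)) := by
  have hεM : ε ≤ M := (hfε 0).trans (hfM 0)
  set ρ := (μ.withDensity fun ω =>
        ENNReal.ofReal (Real.exp (-(ε * (κ ω).real univ)))).bind κ with hρ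
  have hρfin : IsFiniteMeasure ρ := isFiniteMeasure_weighted_bind hκ hε
  have hψb : ∀ h : ℝ → ℝ, Measurable h → (∀ t, ε ≤ h t) → (∀ t, h t ≤ M) →
      Integrable (fun t => ψ (h t)) (volume.restrict (Ioc 0 1)) := by
    intro h hh hhε hhM
    refine Integrable.of_bound (hψc.measurable.comp hh).aestronglyMeasurable
      (ψ ε + L * (M - ε)) (ae_of_all _ fun t => ?_)
    rw [Real.norm_of_nonneg (hψ0 _)]
    have h1 := (le_abs_self _).trans (hLip (h t) ε (hhε t) le_rfl)
    rw [abs_of_nonneg (sub_nonneg.2 (hhε t))] at h1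
    have h2 : L * (h t - ε) ≤ L * (M - ε) :=
      mul_le_mul_of_nonneg_left (sub_le_sub_right (hhM t) _) hL
    linarith
  refine eq_of_forall_dist_le fun η hη => ?_
  -- Chosen so that δ + L δ = η.
  set δ := η / (1 + L) with hδ
  have hδ0 : 0 < δ := by positivity
  have hfi : Integrable f (ρ + volume.restrict (Ioc 0 1)) :=
    integrable_of_measurable_of_bounds hf (fun t => hε.le.trans (hfε t)) hfM
  obtain ⟨g₀, hg₀, -⟩ := hfi.exists_boundedContinuous_lintegral_sub_le
    (ε := ENNReal.ofReal δ) (by simpa using hδ0)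
  -- Clamping restores the bounds ε and M, and cannot increase the distance to f.
  set g : ℝ → ℝ := fun t => max ε (min (g₀ t) M) with hg
  have hgc : Continuous g := by fun_prop
  have hgε : ∀ t, ε ≤ g t := fun t => le_max_left _ _
  have hgM : ∀ t, g t ≤ M := fun t => max_le hεM (min_le_right _ _)
  have hclose : ∀ t, ‖f t - g t‖ₑ ≤ ‖f t - g₀ t‖ₑ := fun t => by
    rw [Real.enorm_eq_ofReal_abs, Real.enorm_eq_ofReal_abs]
    exact ENNReal.ofReal_le_ofReal (abs_sub_clamp_le (hfε t) (hfM t))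
  have hfg : ∫⁻ t, ‖f t - g t‖ₑ ∂ρ + ∫⁻ t in Ioc 0 1, ‖f t - g t‖ₑ ≤ ENNReal.ofReal δ := by
    rw [← lintegral_add_measure]
    exact (lintegral_mono hclose).trans hg₀
  have hA : |∫ ω, Real.exp (-∫ t, f t ∂κ ω) ∂μ - ∫ ω, Real.exp (-∫ t, g t ∂κ ω) ∂μ| ≤ δ := by
    rw [← ENNReal.ofReal_le_ofReal_iff hδ0.le, ← Real.enorm_eq_ofReal_abs]
    exact (enorm_integral_exp_sub_le hκ hε hf hgc.measurable hfε hgε hfM hgM).trans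
      (le_self_add.trans hfg)
  have hB : |(∫ t in Ioc 0 1, ψ (f t)) - ∫ t in Ioc 0 1, ψ (g t)| ≤ L * δ := by
    rw [← ENNReal.ofReal_le_ofReal_iff (by positivity), ← Real.enorm_eq_ofReal_abs,
      ← integral_sub (hψb f hf hfε hfM) (hψb g hgc.measurable hgε hgM)]
    refine (enorm_integral_le_lintegral_enorm _).trans ?_
    calc ∫⁻ t in Ioc 0 1, ‖ψ (f t) - ψ (g t)‖ₑ
        ≤ ∫⁻ t in Ioc 0 1, ENNReal.ofReal L * ‖f t - g t‖ₑ := by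
          refine lintegral_mono fun t => ?_
          rw [Real.enorm_eq_ofReal_abs, Real.enorm_eq_ofReal_abs, ← ENNReal.ofReal_mul hL]
          exact ENNReal.ofReal_le_ofReal (hLip _ _ (hfε t) (hgε t))
      _ = ENNReal.ofReal L * ∫⁻ t in Ioc 0 1, ‖f t - g t‖ₑ :=
          lintegral_const_mul' _ _ ENNReal.ofReal_ne_top
      _ ≤ ENNReal.ofReal L * ENNReal.ofReal δ := by
          gcongr
          exact le_add_self.trans hfg
      _ = _ := (ENNReal.ofReal_mul hL).symm
  have hC := abs_exp_neg_sub_le (c := 0)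
    (integral_nonneg (μ := volume.restrict (Ioc (0 : ℝ) 1)) fun t => hψ0 (f t))
    (integral_nonneg (μ := volume.restrict (Ioc (0 : ℝ) 1)) fun t => hψ0 (g t))
  rw [neg_zero, Real.exp_zero, one_mul] at hC
  rw [H g M hgc (fun t => hε.le.trans (hgε t)) hgM] at hA
  rw [Real.dist_eq]
  have hδη : δ + L * δ = η := by rw [hδ]; field_simp
  have := abs_sub_le (∫ ω, Real.exp (-∫ t, f t ∂κ ω) ∂μ)
    (Real.exp (-∫ t in Ioc 0 1, ψ (g t))) (Real.exp (-∫ t in Ioc 0 1, ψ (f t)))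
  rw [abs_sub_comm (Real.exp (-∫ t in Ioc 0 1, ψ (g t)))] at this
  linarith

/-- If the Laplace functional of a random measure is known at continuous functions, it is known
at bounded measurable functions. -/
theorem laplaceFunctional_of_continuous [IsProbabilityMeasure μ] (hκ : Measurable κ)
    [∀ ω, IsFiniteMeasure (κ ω)] (hψc : Continuous ψ) (hψ0 : ∀ a, 0 ≤ ψ a)
    (hLip : ∀ ε > 0, ∃ L : ℝ, 0 ≤ L ∧ ∀ a b, ε ≤ a → ε ≤ b → |ψ a - ψ b| ≤ L * |a - b|)
    (H : ∀ (g : ℝ → ℝ) (M : ℝ), Continuous g → (∀ t, 0 ≤ g t) → (∀ t, g t ≤ M) →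
      ∫ ω, Real.exp (-∫ t, g t ∂κ ω) ∂μ = Real.exp (-∫ t in Ioc 0 1, ψ (g t)))
    {M : ℝ} {f : ℝ → ℝ} (hf : Measurable f) (hf0 : ∀ t, 0 ≤ f t) (hfM : ∀ t, f t ≤ M) :
    ∫ ω, Real.exp (-∫ t, f t ∂κ ω) ∂μ = Real.exp (-∫ t in Ioc 0 1, ψ (f t)) := by
  -- The shift by ε n moves f into the range of `laplaceFunctional_of_le`; both sides are then
  -- continuous as the shift tends to 0.
  set ε : ℕ → ℝ := fun n => 1 / ((n : ℝ) + 1) with hεdef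
  have hε : ∀ n, 0 < ε n := fun n => by simp only [hεdef]; positivity
  have hε1 : ∀ n, ε n ≤ 1 := fun n => by
    simp only [hεdef]
    rw [div_le_one (by positivity)]
    linarith [n.cast_nonneg (α := ℝ)]
  have hεlim : Tendsto ε atTop (𝓝 0) := tendsto_one_div_add_atTop_nhds_zero_nat
  have hn : ∀ n, ∫ ω, Real.exp (-∫ t, f t + ε n ∂κ ω) ∂μ =
      Real.exp (-∫ t in Ioc 0 1, ψ (f t + ε n)) := by
    intro n
    obtain ⟨L, hL, hL'⟩ := hLip (ε n) (hε n)
    exact laplaceFunctional_of_le hκ hψc hψ0 H (hε n) hL hL'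
      (hf.add_const _) (fun t => by linarith [hf0 t]) (M := M + ε n) fun t => by linarith [hfM t]
  have hleft : Tendsto (fun n => ∫ ω, Real.exp (-∫ t, f t + ε n ∂κ ω) ∂μ) atTop
      (𝓝 (∫ ω, Real.exp (-∫ t, f t ∂κ ω) ∂μ)) := by
    have hfn0 : ∀ n t, 0 ≤ f t + ε n := fun n t => add_nonneg (hf0 t) (hε n).le
    refine tendsto_integral_of_dominated_convergence (fun _ => 1) (fun n =>
      (integrable_exp_neg_integral hκ (hf.add_const _) (hfn0 n)).aestronglyMeasurable)
      (integrable_const _) (fun n => ae_of_all _ fun ω => ?_) (ae_of_all _ fun ω => ?_)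
    · rw [Real.norm_of_nonneg (Real.exp_pos _).le, Real.exp_le_one_iff, neg_nonpos]
      exact integral_nonneg (hfn0 n)
    · refine Tendsto.rexp (Tendsto.neg ?_)
      have h1 : ∀ n, ∫ t, f t + ε n ∂κ ω = ∫ t, f t ∂κ ω + ε n * (κ ω).real univ := by
        intro n
        rw [integral_add (integrable_of_measurable_of_bounds hf hf0 hfM) (integrable_const _),
          integral_const, smul_eq_mul, mul_comm]
      simp_rw [h1]
      simpa using (hεlim.mul_const ((κ ω).real univ)).const_add (∫ t, f t ∂κ ω)
  have hright : Tendsto (fun n => Real.exp (-∫ t in Ioc 0 1, ψ (f t + ε n))) atTop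
      (𝓝 (Real.exp (-∫ t in Ioc 0 1, ψ (f t)))) := by
    obtain ⟨B, hB⟩ := (isCompact_Icc (a := (0 : ℝ)) (b := M + 1)).exists_bound_of_continuousOn
      hψc.continuousOn
    refine Tendsto.rexp (Tendsto.neg ?_)
    refine tendsto_integral_of_dominated_convergence (fun _ => B) (fun n =>
      (hψc.measurable.comp (hf.add_const _)).aestronglyMeasurable)
      (integrable_const _) (fun n => ae_of_all _ fun t => ?_) (ae_of_all _ fun t => ?_)
    · exact hB _ ⟨add_nonneg (hf0 t) (hε n).le, add_le_add (hfM t) (hε1 n)⟩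
    · have := hεlim.const_add (f t)
      rw [add_zero] at this
      exact (hψc.tendsto _).comp this
  simp_rw [hn] at hleft
  exact tendsto_nhds_unique hleft hright

end

/-! ### The Laplace functional of a subordinator -/

section

variable {Ω : Type*} {ζ : unitInterval → Ω → ℝ} [MeasurableSpace Ω] {μ : Measure Ω} {θ : ℝ}
  {F : Measure ℝ}

theorem IsGGCSubordinator.integral_exp_sub (hζ : IsGGCSubordinator ζ θ F μ) {r s t : unitInterval}
    (h : (s : ℝ) + r = t) {c : ℝ} (hc : 0 ≤ c) :
    ∫ ω, Real.exp (-(c * (ζ t ω - ζ s ω))) ∂μ = Real.exp (-(r * θ * levyExponent F c)) := by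
  rw [← hζ.laplace r c hc]
  exact ((hζ.stationary r s t h).comp (u := fun x => Real.exp (-(c * x))) (by fun_prop)).integral_eq

/-- Independence factors the expectation over the n cells, and by stationarity each factor is that
of an increment over time 1 / n. -/
theorem IsGGCSubordinator.integral_exp_grid (hζ : IsGGCSubordinator ζ θ F μ) {n : ℕ} (hn : 0 < n)
    {c : Fin n → ℝ} (hc : ∀ j, 0 ≤ c j) :
    ∫ ω, Real.exp (-∑ j : Fin n, c j *
        (extendedPath ζ ω (((j : ℝ) + 1) / n) - extendedPath ζ ω ((j : ℝ) / n))) ∂μ =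
      Real.exp (-∑ j : Fin n, θ * levyExponent F (c j) * (1 / n)) := by
  have hn' : (0 : ℝ) < n := by exact_mod_cast hn
  have hmem : ∀ j : ℕ, j ≤ n → (j : ℝ) / n ∈ Icc (0 : ℝ) 1 := fun j hj =>
    ⟨by positivity, by rw [div_le_one hn']; exact_mod_cast hj⟩
  set t : Fin (n + 1) → unitInterval := fun j => ⟨(j : ℕ) / n, hmem j (Nat.lt_succ_iff.1 j.2)⟩
    with ht
  have hmono : Monotone t := fun i j hij => by
    rw [← Subtype.coe_le_coe]
    have : ((i : ℕ) : ℝ) ≤ (j : ℕ) := by exact_mod_cast hij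
    simp only [ht]
    gcongr
  have hpath : ∀ (j : Fin (n + 1)) ω, extendedPath ζ ω (((j : ℕ) : ℝ) / n) = ζ (t j) ω :=
    fun j ω => by
      rw [extendedPath, projIcc_of_mem zero_le_one (hmem j (Nat.lt_succ_iff.1 j.2))]
  have hsucc : ∀ (j : Fin n) ω, extendedPath ζ ω (((j : ℝ) + 1) / n) = ζ (t j.succ) ω := fun j ω => by
    rw [← hpath]; simp
  have hcast : ∀ (j : Fin n) ω, extendedPath ζ ω ((j : ℝ) / n) = ζ (t j.castSucc) ω := fun j ω => by
    rw [← hpath]; simp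
  simp_rw [hsucc, hcast, ← Finset.sum_neg_distrib, Real.exp_sum]
  rw [(hζ.indepIncrements n t hmono).integral_fun_prod_comp
    (f := fun j x => Real.exp (-(c j * x)))
    (fun j => ((hζ.measurable _).sub (hζ.measurable _)).aemeasurable)
    fun j => Measurable.aestronglyMeasurable (by fun_prop)]
  refine Finset.prod_congr rfl fun j _ => ?_
  have h1 : ((t j.castSucc : unitInterval) : ℝ) + (⟨1 / n, by simpa using hmem 1 hn⟩ : unitInterval) =
      t j.succ := by
    simp only [ht, Fin.val_castSucc, Fin.val_succ]
    push_cast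
    ring
  rw [hζ.integral_exp_sub h1 (hc j)]
  congr 2
  ring

theorem IsGGCSubordinator.aemeasurable_increment (hζ : IsGGCSubordinator ζ θ F μ) {C : Set ℝ}
    (hC : MeasurableSet C) (hCs : C ⊆ Ioc 0 1) : AEMeasurable (increment ζ C) μ := by
  obtain ⟨κ, hκ, -, -, hκC, -⟩ := hζ.exists_randomMeasure
  refine ⟨fun ω => (κ ω).real C, ((Measure.measurable_coe hC).comp hκ).ennreal_toReal, ?_⟩
  filter_upwards [hκC] with ω hω
  rw [increment, measureReal_def, measureReal_def, hω C hCs]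

variable [IsProbabilityMeasure μ] [IsProbabilityMeasure F]

/-- The Laplace functional of the random measure of a subordinator. -/
theorem IsGGCSubordinator.laplaceFunctional (hζ : IsGGCSubordinator ζ θ F μ) (hθ : 0 ≤ θ)
    (hF : ∀ᵐ x ∂F, 0 ≤ x) (hint : ∀ l : ℝ, 0 ≤ l → Integrable (fun x => Real.log (1 + l * x)) F)
    {κ : Ω → Measure ℝ} (hκ : Measurable κ) [∀ ω, IsFiniteMeasure (κ ω)]
    (hκI : ∀ᵐ ω ∂μ, ∀ a b : ℝ, 0 ≤ a → b ≤ 1 →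
        κ ω (Ioc a b) = ENNReal.ofReal (extendedPath ζ ω b - extendedPath ζ ω a))
    (hκ0 : ∀ ω, κ ω (Ioc 0 1)ᶜ = 0) {f : ℝ → ℝ} {M : ℝ} (hf : Measurable f)
    (hf0 : ∀ t, 0 ≤ f t) (hfM : ∀ t, f t ≤ M) :
    ∫ ω, Real.exp (-∫ t, f t ∂κ ω) ∂μ =
      Real.exp (-∫ t in Ioc 0 1, θ * levyExponent F (max (f t) 0)) := by
  have hψc : Continuous fun a => θ * levyExponent F (max a 0) :=
    (continuous_levyExponent_max hF hint).const_mul θ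
  have hlev0 : ∀ a, 0 ≤ levyExponent F (max a 0) := fun a => by
    have h := levyExponent_mono hF hint le_rfl (le_max_right a 0)
    rwa [levyExponent_zero] at h
  refine laplaceFunctional_of_continuous (ψ := fun a => θ * levyExponent F (max a 0)) hκ hψc
    (fun a => mul_nonneg hθ (hlev0 a)) ?_ ?_ hf hf0 hfM
  · intro ε hε
    refine ⟨θ * ε⁻¹, by positivity, fun a b ha hb => ?_⟩
    rw [max_eq_left (hε.le.trans ha), max_eq_left (hε.le.trans hb), ← mul_sub, abs_mul,
      abs_of_nonneg hθ, mul_assoc]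
    exact mul_le_mul_of_nonneg_left (levyExponent_sub_le hF hint hε ha hb) hθ
  · intro g M hg hg0 hgM
    have hgabs : ∀ t, |g t| ≤ M := fun t => by rw [abs_of_nonneg (hg0 t)]; exact hgM t
    have hleft : Tendsto (fun n : ℕ => ∫ ω, Real.exp (-∑ j : Fin n, g (((j : ℝ) + 1) / n) *
        (κ ω).real (Ioc ((j : ℝ) / n) (((j : ℝ) + 1) / n))) ∂μ) atTop
        (𝓝 (∫ ω, Real.exp (-∫ t, g t ∂κ ω) ∂μ)) := by
      refine tendsto_integral_of_dominated_convergence (fun _ => 1) (fun n => ?_)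
        (integrable_const _) (fun n => ae_of_all _ fun ω => ?_) (ae_of_all _ fun ω => ?_)
      · refine Measurable.aestronglyMeasurable (Measurable.exp (Measurable.neg ?_))
        exact Finset.measurable_fun_sum _ fun j _ => measurable_const.mul
          ((Measure.measurable_coe measurableSet_Ioc).comp hκ).ennreal_toReal
      · rw [Real.norm_of_nonneg (Real.exp_pos _).le, Real.exp_le_one_iff, neg_nonpos]
        exact Finset.sum_nonneg fun j _ => mul_nonneg (hg0 _) measureReal_nonneg
      · refine Tendsto.rexp (Tendsto.neg ?_)
        have h1 := tendsto_sum_grid hg hgabs (κ ω)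
        rwa [Measure.restrict_eq_self_of_ae_mem (by
          rw [ae_iff]; exact hκ0 ω)] at h1
    have hright : Tendsto (fun n : ℕ => Real.exp (-∑ j : Fin n,
        θ * levyExponent F (max (g (((j : ℝ) + 1) / n)) 0) * (1 / n))) atTop
        (𝓝 (Real.exp (-∫ t in Ioc 0 1, θ * levyExponent F (max (g t) 0)))) := by
      refine Tendsto.rexp (Tendsto.neg ?_)
      have h1 := tendsto_sum_grid (h := fun t => θ * levyExponent F (max (g t) 0)) (hψc.comp hg)
        (M := θ * levyExponent F (max M 0)) (fun t => by
          rw [abs_of_nonneg (mul_nonneg hθ (hlev0 _))]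
          exact mul_le_mul_of_nonneg_left (levyExponent_mono hF hint (le_max_right _ _)
            (max_le_max (hgM t) le_rfl)) hθ) (volume.restrict (Ioc 0 1))
      rw [Measure.restrict_restrict measurableSet_Ioc, inter_self] at h1
      refine h1.congr' ?_
      filter_upwards [eventually_gt_atTop 0] with n hn
      have hn' : (0 : ℝ) < n := by exact_mod_cast hn
      refine Finset.sum_congr rfl fun j _ => ?_
      have hsub : Ioc ((j : ℝ) / n) (((j : ℝ) + 1) / n) ⊆ Ioc 0 1 := by
        refine Ioc_subset_Ioc (by positivity) ?_
        rw [div_le_one hn']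
        exact_mod_cast j.2
      rw [measureReal_restrict_apply measurableSet_Ioc, inter_eq_left.2 hsub, Real.volume_real_Ioc,
        ← sub_div, add_sub_cancel_left, max_eq_left (by positivity : (0 : ℝ) ≤ 1 / n)]
    refine tendsto_nhds_unique hleft (hright.congr' ?_)
    filter_upwards [eventually_gt_atTop 0] with n hn
    have hn' : (0 : ℝ) < n := by exact_mod_cast hn
    simp_rw [fun t => max_eq_left (hg0 t)]
    rw [← hζ.integral_exp_grid hn fun j => hg0 _]
    refine integral_congr_ae ?_
    filter_upwards [hκI, hζ.monotone] with ω hω hm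
    congr 2
    refine Finset.sum_congr rfl fun j _ => ?_
    have hle : (j : ℝ) / n ≤ ((j : ℝ) + 1) / n := by gcongr; linarith
    rw [measureReal_def, hω _ _ (by positivity) (by
      rw [div_le_one hn']
      exact_mod_cast j.2), ENNReal.toReal_ofReal (sub_nonneg.2 (monotone_extendedPath hm hle))]

variable {k : ℕ} {C : Fin k → Set ℝ}

/-- The joint Laplace transform of the increments over disjoint sets of times. -/
theorem IsGGCSubordinator.laplace_increment (hζ : IsGGCSubordinator ζ θ F μ) (hθ : 0 ≤ θ)
    (hF : ∀ᵐ x ∂F, 0 ≤ x) (hint : ∀ l : ℝ, 0 ≤ l → Integrable (fun x => Real.log (1 + l * x)) F)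
    (hC : IsMeasurablePartition C (Ioo 0 1)) {l : Fin k → ℝ} (hl : ∀ i, 0 ≤ l i) :
    ∫ ω, Real.exp (-∑ i, l i * increment ζ (C i) ω) ∂μ =
      ∏ i, Real.exp (-(volume.real (C i) * θ * levyExponent F (l i))) := by
  obtain ⟨κ, hκ, hκfin, hκI, hκC, hκ0⟩ := hζ.exists_randomMeasure
  have hCs : ∀ i, C i ⊆ Ioc 0 1 := fun i =>
    ((subset_iUnion C i).trans hC.iUnion_eq.subset).trans Ioo_subset_Ioc_self
  -- The joint Laplace transform is the Laplace functional at this step function. As the sets are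
  -- disjoint and the exponent vanishes at 0, applying the exponent gives a step function on the
  -- same sets.
  set f : ℝ → ℝ := fun t => ∑ i, (C i).indicator (fun _ => l i) t with hf
  have hfm : Measurable f :=
    Finset.measurable_fun_sum _ fun i _ => measurable_const.indicator (hC.measurableSet i)
  have hf0 : ∀ t, 0 ≤ f t := fun t =>
    Finset.sum_nonneg fun i _ => indicator_nonneg (fun _ _ => hl i) t
  have hfM : ∀ t, f t ≤ ∑ i, l i := fun t =>
    Finset.sum_le_sum fun i _ => indicator_le_self' (fun _ _ => hl i) t
  have hψ : ∀ t, θ * levyExponent F (max (f t) 0) =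
      ∑ i, (C i).indicator (fun _ => θ * levyExponent F (l i)) t := by
    intro t
    rw [max_eq_left (hf0 t)]
    by_cases h : ∃ i, t ∈ C i
    · obtain ⟨i, hi⟩ := h
      have hne : ∀ j, j ≠ i → t ∉ C j := fun j hj htj =>
        (hC.disjoint j i hj).le_bot ⟨htj, hi⟩
      rw [hf]
      simp only
      rw [Finset.sum_eq_single i (fun j _ hj => indicator_of_notMem (hne j hj) _) (by simp),
        Finset.sum_eq_single i (fun j _ hj => indicator_of_notMem (hne j hj) _) (by simp),
        indicator_of_mem hi, indicator_of_mem hi]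
    · push Not at h
      rw [hf]
      simp only
      rw [Finset.sum_eq_zero fun i _ => indicator_of_notMem (h i) _,
        Finset.sum_eq_zero fun i _ => indicator_of_notMem (h i) _, levyExponent_zero, mul_zero]
  have hsum : ∀ (ν : Measure ℝ) [IsFiniteMeasure ν] (c : Fin k → ℝ),
      ∫ t, ∑ i, (C i).indicator (fun _ => c i) t ∂ν = ∑ i, c i * ν.real (C i) := by
    intro ν _ c
    rw [integral_finsetSum _ fun j _ => (integrable_const _).indicator (hC.measurableSet j)]
    refine Finset.sum_congr rfl fun j _ => ?_
    rw [integral_indicator_const _ (hC.measurableSet j), smul_eq_mul, mul_comm]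
  have h := hζ.laplaceFunctional hθ hF hint hκ hκI hκ0 hfm hf0 hfM
  simp_rw [hψ, hf, hsum] at h
  rw [← Real.exp_sum]
  have hL : ∫ ω, Real.exp (-∑ i, l i * increment ζ (C i) ω) ∂μ =
      ∫ ω, Real.exp (-∑ i, l i * (κ ω).real (C i)) ∂μ := by
    refine integral_congr_ae ?_
    filter_upwards [hκC] with ω hω
    simp only [increment, measureReal_def, hω _ (hCs _)]
  rw [hL, h]
  congr 1
  rw [← Finset.sum_neg_distrib]
  refine Finset.sum_congr rfl fun i _ => ?_
  rw [measureReal_restrict_apply (hC.measurableSet i), inter_eq_left.2 (hCs i)]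
  ring

end

/-! ### Laws of means -/

/-- `d` is the density of a probability measure on `(0, ∞)` with Stieltjes transform
`l ↦ exp (-σ ψ_F(l))`. -/
structure IsMeanDensity (F : Measure ℝ) (σ : ℝ) (d : ℝ → ℝ) : Prop where
  measurable : Measurable d
  nonneg : ∀ x, 0 ≤ d x
  eq_zero : ∀ x ≤ 0, d x = 0
  stieltjes : ∀ l : ℝ, 0 ≤ l → ∫⁻ x, ENNReal.ofReal (d x * (1 + l * x)⁻¹) =
    ENNReal.ofReal (Real.exp (-(σ * levyExponent F l)))

namespace IsMeanDensity

variable {F : Measure ℝ} {σ : ℝ} {d : ℝ → ℝ}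

theorem lintegral_eq_one (hd : IsMeanDensity F σ d) : ∫⁻ x, ENNReal.ofReal (d x) = 1 := by
  simpa [levyExponent_zero] using hd.stieltjes 0 le_rfl

theorem integrable (hd : IsMeanDensity F σ d) : Integrable d :=
  ⟨hd.measurable.aestronglyMeasurable, (hasFiniteIntegral_iff_ofReal (ae_of_all _ hd.nonneg)).2
    (by rw [hd.lintegral_eq_one]; exact ENNReal.one_lt_top)⟩

theorem isProbabilityMeasure (hd : IsMeanDensity F σ d) :
    IsProbabilityMeasure (volume.withDensity fun x => ENNReal.ofReal (d x)) :=
  ⟨by rw [withDensity_apply _ MeasurableSet.univ, setLIntegral_univ, hd.lintegral_eq_one]⟩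

theorem ae_nonneg (hd : IsMeanDensity F σ d) :
    ∀ᵐ x ∂(volume.withDensity fun x => ENNReal.ofReal (d x)), 0 ≤ x := by
  rw [ae_withDensity_iff hd.measurable.ennreal_ofReal]
  refine ae_of_all _ fun x hx => ?_
  by_contra h
  exact hx (by rw [hd.eq_zero x (not_le.1 h).le, ENNReal.ofReal_zero])

theorem lintegral_inv (hd : IsMeanDensity F σ d) {l : ℝ} (hl : 0 ≤ l) :
    ∫⁻ x, ENNReal.ofReal ((1 + l * x)⁻¹) ∂(volume.withDensity fun x => ENNReal.ofReal (d x)) =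
      ENNReal.ofReal (Real.exp (-(σ * levyExponent F l))) := by
  rw [lintegral_withDensity_eq_lintegral_mul _ hd.measurable.ennreal_ofReal (by fun_prop),
    ← hd.stieltjes l hl]
  refine lintegral_congr fun x => ?_
  rw [Pi.mul_apply, ENNReal.ofReal_mul (hd.nonneg x)]

/-- A measure on `[0, ∞)` is determined by its Stieltjes transform. -/
theorem eq_withDensity (hd : IsMeanDensity F σ d) {ν : Measure ℝ} [IsFiniteMeasure ν]
    (hν : ∀ᵐ x ∂ν, 0 ≤ x)
    (h : ∀ l : ℝ, 0 ≤ l → ∫⁻ x, ENNReal.ofReal ((1 + l * x)⁻¹) ∂ν =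
      ENNReal.ofReal (Real.exp (-(σ * levyExponent F l)))) :
    ν = volume.withDensity fun x => ENNReal.ofReal (d x) := by
  have := hd.isProbabilityMeasure
  exact ext_of_stieltjes hν hd.ae_nonneg fun l hl => by rw [h l hl, hd.lintegral_inv hl]

end IsMeanDensity

theorem integrable_log_thinnedLaw {F : Measure ℝ} [IsProbabilityMeasure F]
    (hF : ∀ᵐ x ∂F, 0 ≤ x) {l : ℝ} (hl : 0 ≤ l)
    (hint : Integrable (fun x => Real.log (1 + l * x)) F) {σ : ℝ} (hσ : 0 ≤ σ) :
    Integrable (fun x => Real.log (1 + l * x)) (thinnedLaw F σ) ∧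
      levyExponent (thinnedLaw F σ) l = σ * levyExponent F l := by
  refine levyExponent_of_lintegral (thinnedLaw_ae_nonneg hF σ) hl
    (mul_nonneg hσ (levyExponent_nonneg hF hl)) (lintegral_log_thinnedLaw hσ ?_)
  rw [levyExponent, ofReal_integral_eq_lintegral_ofReal hint]
  filter_upwards [hF] with x hx
  exact Real.log_nonneg (by nlinarith)

section

variable {Ω : Type*} [MeasurableSpace Ω] {μ : Measure Ω} [IsProbabilityMeasure μ]
  {P : Ω → Measure ℝ} {F : Measure ℝ} [IsProbabilityMeasure F] {σ : ℝ} {d : ℝ → ℝ}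

/-- The law of the mean of a Dirichlet process over a thinned prior. -/
theorem IsDirichletProcess.map_meanFunctional_thinnedLaw
    (hP : IsDirichletProcess P 1 (thinnedLaw F σ) μ) (hσ : 0 ≤ σ) (hσ1 : σ ≤ 1)
    (hF : ∀ᵐ x ∂F, 0 ≤ x) (hint : ∀ l : ℝ, 0 ≤ l → Integrable (fun x => Real.log (1 + l * x)) F)
    (hd : IsMeanDensity F σ d) :
    (∀ᵐ ω ∂μ, Integrable (fun x : ℝ => x) (P ω)) ∧
      μ.map (meanFunctional P) = volume.withDensity fun x => ENNReal.ofReal (d x) := by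
  have := isProbabilityMeasure_thinnedLaw (F := F) hσ hσ1
  have hT := thinnedLaw_ae_nonneg hF σ
  have hintT : ∀ l : ℝ, 0 ≤ l → Integrable (fun x => Real.log (1 + l * x)) (thinnedLaw F σ) :=
    fun l hl => (integrable_log_thinnedLaw hF hl (hint l hl) hσ).1
  refine ⟨hP.ae_integrable one_pos hT hintT, ?_⟩
  refine hd.eq_withDensity (hP.ae_nonneg_map_meanFunctional hT) fun l hl => ?_
  rw [← (integrable_log_thinnedLaw hF hl (hint l hl) hσ).2]
  simpa [Real.rpow_neg_one] using hP.lintegral_meanFunctional one_pos hT hintT hl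

theorem isProbabilityMeasure_symmetricBetaLaw (hσ : 0 < σ) :
    IsProbabilityMeasure (symmetricBetaLaw σ) := by
  unfold symmetricBetaLaw
  split_ifs with h
  · exact isProbabilityMeasureBeta hσ (sub_pos.2 h)
  · infer_instance

theorem symmetricBetaLaw_ae_nonneg (σ : ℝ) : ∀ᵐ x ∂symmetricBetaLaw σ, 0 ≤ x := by
  unfold symmetricBetaLaw
  split_ifs with h
  · have hm : Measurable (betaPDF σ (1 - σ)) := (measurable_betaPDFReal σ (1 - σ)).ennreal_ofReal
    rw [betaMeasure, ae_withDensity_iff hm]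
    refine ae_of_all _ fun x hx => ?_
    by_contra h
    exact hx (betaPDF_eq_zero_of_nonpos (not_le.1 h).le)
  · exact (ae_dirac_iff measurableSet_Ici).2 (by simp)

theorem lintegral_inv_symmetricBetaLaw (hσ : 0 < σ) (hσ1 : σ ≤ 1) {l : ℝ} (hl : 0 ≤ l) :
    ∫⁻ y, ENNReal.ofReal ((1 + l * y)⁻¹) ∂symmetricBetaLaw σ =
      ENNReal.ofReal ((1 + l) ^ (-σ)) := by
  unfold symmetricBetaLaw
  split_ifs with h
  · exact lintegral_inv_betaMeasure hσ h hl
  · rw [lintegral_dirac, mul_one, le_antisymm hσ1 (not_lt.1 h), Real.rpow_neg_one]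

/-- The law of the product of a beta variable and the mean of a Dirichlet process. -/
theorem IsDirichletProcess.symmetricBetaLaw_mconv (hP : IsDirichletProcess P σ F μ) (hσ : 0 < σ)
    (hσ1 : σ ≤ 1) (hF : ∀ᵐ x ∂F, 0 ≤ x)
    (hint : ∀ l : ℝ, 0 ≤ l → Integrable (fun x => Real.log (1 + l * x)) F)
    (hd : IsMeanDensity F σ d) :
    (∀ᵐ ω ∂μ, Integrable (fun x : ℝ => x) (P ω)) ∧
      (symmetricBetaLaw σ).mconv (μ.map (meanFunctional P)) =
        volume.withDensity fun x => ENNReal.ofReal (d x) := by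
  have := isProbabilityMeasure_symmetricBetaLaw hσ
  refine ⟨hP.ae_integrable hσ hF hint, ?_⟩
  have hM := hP.ae_nonneg_map_meanFunctional hF
  refine hd.eq_withDensity (ae_nonneg_mconv (symmetricBetaLaw_ae_nonneg σ) hM) fun l hl => ?_
  rw [← hP.lintegral_meanFunctional hσ hF hint hl, lintegral_mconv_symm (by fun_prop)]
  refine lintegral_congr_ae ?_
  filter_upwards [hM] with m hm
  -- For a fixed mean m, the beta identity at parameter l m produces the power -σ that the
  -- generalized Stieltjes transform of M_σ requires.
  rw [← lintegral_inv_symmetricBetaLaw hσ hσ1 (mul_nonneg hl hm)]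
  refine lintegral_congr fun b => ?_
  rw [mul_comm b m, mul_assoc]

end

/-! ### Laws of increments -/

section

variable {F : Measure ℝ} {σ : ℝ} {d : ℝ → ℝ}

/-- The Laplace transform of the product of an exponential variable and a mean. -/
theorem IsMeanDensity.laplace_mconv (hd : IsMeanDensity F σ d) {l : ℝ} (hl : 0 ≤ l) :
    ∫ x, Real.exp (-(l * x))
        ∂((expMeasure 1).mconv (volume.withDensity fun x => ENNReal.ofReal (d x))) =
      Real.exp (-(σ * levyExponent F l)) := by
  have := hd.isProbabilityMeasure
  rw [integral_eq_lintegral_of_nonneg_ae (ae_of_all _ fun x => (Real.exp_pos _).le)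
    (Measurable.aestronglyMeasurable (by fun_prop)),
    lintegral_exp_expMeasure_mconv hd.ae_nonneg hl, hd.lintegral_inv hl,
    ENNReal.toReal_ofReal (Real.exp_pos _).le]

variable {Ω : Type*} [MeasurableSpace Ω] {μ : Measure Ω} [IsProbabilityMeasure μ]
  [IsProbabilityMeasure F] {ζ : unitInterval → Ω → ℝ} {k : ℕ} {C : Fin k → Set ℝ}

/-- The joint law of the increments over disjoint sets of times. -/
theorem IsGGCSubordinator.map_increment (hζ : IsGGCSubordinator ζ 1 F μ)
    (hF : ∀ᵐ x ∂F, 0 ≤ x) (hint : ∀ l : ℝ, 0 ≤ l → Integrable (fun x => Real.log (1 + l * x)) F)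
    (hC : IsMeasurablePartition C (Ioo 0 1)) {d : Fin k → ℝ → ℝ}
    (hd : ∀ i, IsMeanDensity F (volume.real (C i)) (d i)) :
    μ.map (fun ω i => increment ζ (C i) ω) = Measure.pi fun i =>
      (expMeasure 1).mconv (volume.withDensity fun x => ENNReal.ofReal (d i x)) := by
  have := fun i => (hd i).isProbabilityMeasure
  have hCs : ∀ i, C i ⊆ Ioc 0 1 := fun i =>
    ((subset_iUnion C i).trans hC.iUnion_eq.subset).trans Ioo_subset_Ioc_self
  have hm : AEMeasurable (fun ω i => increment ζ (C i) ω) μ :=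
    aemeasurable_pi_lambda _ fun i => hζ.aemeasurable_increment (hC.measurableSet i) (hCs i)
  have hexp : ∀ᵐ x ∂expMeasure 1, (0 : ℝ) ≤ x :=
    (gammaMeasure_ae_pos 1 1).mono fun _ hx => hx.le
  refine ext_of_laplace_pi ?_ ?_ fun l hl => ?_
  · rw [ae_map_iff hm (by simp only [ofPred_forall]; measurability)]
    exact ae_of_all _ fun ω i => measureReal_nonneg
  · rw [ae_all_iff]
    exact fun i => (Measure.quasiMeasurePreserving_eval _ i).ae
      (ae_nonneg_mconv hexp (hd i).ae_nonneg)
  · rw [integral_map hm (Measurable.aestronglyMeasurable (by fun_prop)),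
      hζ.laplace_increment zero_le_one hF hint hC hl]
    simp_rw [← Finset.sum_neg_distrib, Real.exp_sum]
    rw [integral_fintype_prod_eq_prod (fun i x => Real.exp (-(l i * x)))]
    refine Finset.prod_congr rfl fun i _ => ?_
    rw [(hd i).laplace_mconv (hl i), mul_one]

theorem IsGGCSubordinator.map_increment_apply (hζ : IsGGCSubordinator ζ 1 F μ)
    (hF : ∀ᵐ x ∂F, 0 ≤ x) (hint : ∀ l : ℝ, 0 ≤ l → Integrable (fun x => Real.log (1 + l * x)) F)
    (hC : IsMeasurablePartition C (Ioo 0 1)) {d : Fin k → ℝ → ℝ}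
    (hd : ∀ i, IsMeanDensity F (volume.real (C i)) (d i)) (i : Fin k) :
    μ.map (increment ζ (C i)) =
      (expMeasure 1).mconv (volume.withDensity fun x => ENNReal.ofReal (d i x)) := by
  have := fun i => (hd i).isProbabilityMeasure
  have hCs : ∀ i, C i ⊆ Ioc 0 1 := fun i =>
    ((subset_iUnion C i).trans hC.iUnion_eq.subset).trans Ioo_subset_Ioc_self
  have hm : AEMeasurable (fun ω i => increment ζ (C i) ω) μ :=
    aemeasurable_pi_lambda _ fun i => hζ.aemeasurable_increment (hC.measurableSet i) (hCs i)
  have h := congrArg (Measure.map (Function.eval i)) (hζ.map_increment hF hint hC hd)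
  rw [AEMeasurable.map_map_of_aemeasurable (measurable_pi_apply i).aemeasurable hm,
    (measurePreserving_eval _ i).map_eq] at h
  exact h

theorem IsGGCSubordinator.iIndepFun_increment (hζ : IsGGCSubordinator ζ 1 F μ)
    (hF : ∀ᵐ x ∂F, 0 ≤ x) (hint : ∀ l : ℝ, 0 ≤ l → Integrable (fun x => Real.log (1 + l * x)) F)
    (hC : IsMeasurablePartition C (Ioo 0 1)) {d : Fin k → ℝ → ℝ}
    (hd : ∀ i, IsMeanDensity F (volume.real (C i)) (d i)) :
    iIndepFun (fun i => increment ζ (C i)) μ := by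
  have hCs : ∀ i, C i ⊆ Ioc 0 1 := fun i =>
    ((subset_iUnion C i).trans hC.iUnion_eq.subset).trans Ioo_subset_Ioc_self
  rw [iIndepFun_iff_map_fun_eq_pi_map fun i =>
    hζ.aemeasurable_increment (hC.measurableSet i) (hCs i), hζ.map_increment hF hint hC hd]
  congr 1
  ext1 i
  rw [hζ.map_increment_apply hF hint hC hd i]

end

/-! ### Exponential mixtures -/

section

variable {F : Measure ℝ} {σ : ℝ} {d : ℝ → ℝ}

/-- The density of the product of an exponential variable and an independent variable with
density `d`. -/
noncomputable def expMixture (d : ℝ → ℝ) (x : ℝ) : ℝ :=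
  (Ioi 0).indicator (fun x => ∫ y in Ioi 0, Real.exp (-(x / y)) * y⁻¹ * d y) x

/-- From e^s ≥ s with s = x / y. The bound is uniform in y, so the mixture integral converges for
every x > 0 despite the factor 1 / y at the origin. -/
theorem exp_neg_div_mul_inv_le {x y : ℝ} (hx : 0 < x) (hy : 0 < y) :
    Real.exp (-(x / y)) * y⁻¹ ≤ x⁻¹ := by
  rw [Real.exp_neg, ← mul_inv]
  refine inv_anti₀ hx ?_
  have h := Real.add_one_le_exp (x / y)
  calc x = x / y * y := (div_mul_cancel₀ _ hy.ne').symm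
    _ ≤ Real.exp (x / y) * y := by gcongr; linarith

theorem IsMeanDensity.integrableOn_mixture (hd : IsMeanDensity F σ d) {x : ℝ} (hx : 0 < x) :
    IntegrableOn (fun y => Real.exp (-(x / y)) * y⁻¹ * d y) (Ioi 0) := by
  have hdm := hd.measurable
  refine Integrable.mono' (hd.integrable.integrableOn.const_mul x⁻¹)
    (Measurable.aestronglyMeasurable (by fun_prop)) ?_
  filter_upwards [ae_restrict_mem measurableSet_Ioi] with y hy
  have hy' : 0 < y := hy
  rw [Real.norm_of_nonneg (mul_nonneg (by positivity) (hd.nonneg y))]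
  exact mul_le_mul_of_nonneg_right (exp_neg_div_mul_inv_le hx hy') (hd.nonneg y)

theorem IsMeanDensity.expMixture_nonneg (hd : IsMeanDensity F σ d) (x : ℝ) :
    0 ≤ expMixture d x := by
  refine indicator_nonneg (fun x _ => setIntegral_nonneg measurableSet_Ioi fun y hy => ?_) x
  have hy' : 0 < y := hy
  exact mul_nonneg (by positivity) (hd.nonneg y)

theorem IsMeanDensity.measurable_expMixture (hd : IsMeanDensity F σ d) :
    Measurable (expMixture d) := by
  have hdm := hd.measurable
  refine Measurable.indicator ?_ measurableSet_Ioi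
  exact (StronglyMeasurable.integral_prod_right (f := fun x y : ℝ =>
    Real.exp (-(x / y)) * y⁻¹ * d y) (Measurable.stronglyMeasurable (by fun_prop))).measurable

theorem IsMeanDensity.expMeasure_mconv (hd : IsMeanDensity F σ d) :
    (expMeasure 1).mconv (volume.withDensity fun x => ENNReal.ofReal (d x)) =
      volume.withDensity fun x => ENNReal.ofReal (expMixture d x) := by
  have := hd.isProbabilityMeasure
  rw [expMeasure_mconv_withDensity hd.measurable.ennreal_ofReal fun x hx => by
    rw [hd.eq_zero x hx, ENNReal.ofReal_zero]]
  congr 1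
  ext1 x
  by_cases hx : x ∈ Ioi (0 : ℝ)
  · rw [indicator_of_mem hx, expMixture, indicator_of_mem hx,
      ofReal_integral_eq_lintegral_ofReal (hd.integrableOn_mixture hx)]
    · refine setLIntegral_congr_fun measurableSet_Ioi fun y hy => ?_
      have hy' : 0 < y := hy
      exact (ENNReal.ofReal_mul (by positivity)).symm
    · filter_upwards [ae_restrict_mem measurableSet_Ioi] with y hy
      have hy' : 0 < y := hy
      exact mul_nonneg (by positivity) (hd.nonneg y)
  · rw [indicator_of_notMem hx, expMixture, indicator_of_notMem hx, ENNReal.ofReal_zero]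

theorem IsMeanDensity.integrable_expMixture (hd : IsMeanDensity F σ d) :
    Integrable (expMixture d) := by
  have := hd.isProbabilityMeasure
  have h : ((expMeasure 1).mconv (volume.withDensity fun x => ENNReal.ofReal (d x))) univ = 1 :=
    measure_univ
  rw [hd.expMeasure_mconv, withDensity_apply _ MeasurableSet.univ, setLIntegral_univ] at h
  exact ⟨hd.measurable_expMixture.aestronglyMeasurable,
    (hasFiniteIntegral_iff_ofReal (ae_of_all _ hd.expMixture_nonneg)).2
      (by rw [h]; exact ENNReal.one_lt_top)⟩

theorem pi_withDensity_ofReal {ι : Type*} [Fintype ι] {p : ι → ℝ → ℝ}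
    (hp : ∀ i, Integrable (p i)) (hp0 : ∀ i x, 0 ≤ p i x) :
    Measure.pi (fun i => (volume : Measure ℝ).withDensity fun x => ENNReal.ofReal (p i x)) =
      (volume : Measure (ι → ℝ)).withDensity fun x => ENNReal.ofReal (∏ i, p i (x i)) := by
  have := fun i => isFiniteMeasure_withDensity_ofReal (hp i).2
  refine Measure.pi_eq fun s hs => ?_
  rw [withDensity_apply _ (MeasurableSet.univ_pi hs), volume_pi, Measure.restrict_pi_pi,
    ← ofReal_integral_eq_lintegral_ofReal
      (Integrable.fintype_prod fun i => (hp i).integrableOn)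
      (ae_of_all _ fun x => Finset.prod_nonneg fun i _ => hp0 i (x i)),
    integral_fintype_prod_eq_prod, ENNReal.ofReal_prod_of_nonneg fun i _ =>
      setIntegral_nonneg (hs i) fun x _ => hp0 i x]
  refine Finset.prod_congr rfl fun i _ => ?_
  rw [withDensity_apply _ (hs i), ofReal_integral_eq_lintegral_ofReal (hp i).integrableOn
    (ae_of_all _ (hp0 i))]

end

/-! ### Assembly for a general prior -/

section

variable {F : Measure ℝ} [IsProbabilityMeasure F]

/-- The prior enters only through a family of mean densities for all σ in (0, 1], so both priors are
treated together. -/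
theorem IsMeanDensity.increments {d : ℝ → ℝ → ℝ} {Ω : Type*} [MeasurableSpace Ω] {μ : Measure Ω}
    [IsProbabilityMeasure μ] {ζ : unitInterval → Ω → ℝ} (hF : ∀ᵐ x ∂F, 0 ≤ x)
    (hint : ∀ l : ℝ, 0 ≤ l → Integrable (fun x => Real.log (1 + l * x)) F)
    (hd : ∀ σ : ℝ, 0 < σ → σ ≤ 1 → IsMeanDensity F σ (d σ)) (hζ : IsGGCSubordinator ζ 1 F μ)
    {k : ℕ} {C : Fin k → Set ℝ} (hC : IsMeasurablePartition C (Ioo 0 1))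
    (hpos : ∀ i, 0 < volume.real (C i)) :
    (∀ i, volume.real (C i) ≤ 1) ∧
    μ.map (fun ω i => increment ζ (C i) ω) =
      (volume : Measure (Fin k → ℝ)).withDensity (fun x => ENNReal.ofReal
        (∏ i, expMixture (d (volume.real (C i))) (x i))) ∧
    iIndepFun (fun i => increment ζ (C i)) μ ∧
    (∀ i, ∀ (Ω' : Type*) [MeasurableSpace Ω'] (μ' : Measure Ω') [IsProbabilityMeasure μ']
        (P : Ω' → Measure ℝ),
      IsDirichletProcess P 1 (thinnedLaw F (volume.real (C i))) μ' →
      μ.map (increment ζ (C i)) = (expMeasure 1).mconv (μ'.map (meanFunctional P))) := by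
  have hle : ∀ i, volume.real (C i) ≤ 1 := fun i => by
    have h : volume.real (C i) ≤ volume.real (Ioo (0 : ℝ) 1) :=
      measureReal_mono ((subset_iUnion C i).trans hC.iUnion_eq.subset) (by simp)
    simpa using h
  have hdC := fun i => hd _ (hpos i) (hle i)
  refine ⟨hle, ?_, hζ.iIndepFun_increment hF hint hC hdC, fun i Ω' _ μ' _ P hP => ?_⟩
  · rw [hζ.map_increment hF hint hC hdC, ← pi_withDensity_ofReal
      (fun i => (hdC i).integrable_expMixture) fun i => (hdC i).expMixture_nonneg]
    simp_rw [(hdC _).expMeasure_mconv]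
  · rw [hζ.map_increment_apply hF hint hC hdC i,
      (hP.map_meanFunctional_thinnedLaw (hpos i).le (hle i) hF hint (hdC i)).2]

end

/-! ### The uniform prior -/

theorem integrable_log_lawU (l : ℝ) (hl : 0 ≤ l) :
    Integrable (fun x => Real.log (1 + l * x)) lawU := by
  refine ContinuousOn.integrableOn_Icc (ContinuousOn.log (by fun_prop) fun x hx => ?_)
  have := hx.1
  positivity

theorem isMeanDensity_meanDensityU {σ : ℝ} (hσ : 0 < σ) (hσ1 : σ ≤ 1) :
    IsMeanDensity lawU σ (meanDensityU σ) where
  measurable := measurable_meanDensityU σ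
  nonneg := meanDensityU_nonneg hσ hσ1
  eq_zero x hx := meanDensityU_of_notMem σ fun h => not_lt.2 hx h.1
  stieltjes l hl := by rw [lintegral_meanDensityU_mul hσ hσ1 hl, levyExponent_lawU hl]

theorem mixtureIntegrandU_eq (σ x : ℝ) {y : ℝ} (hy : y ∈ Ioo (0 : ℝ) 1) :
    mixtureIntegrandU σ x y = Real.exp (-(x / y)) * y⁻¹ * meanDensityU σ y := by
  rw [mixtureIntegrandU, meanDensityU, if_pos (mem_Ioo.1 hy),
    show σ * (1 - y) - 2 = σ * (1 - y) - 1 - 1 by ring, Real.rpow_sub_one hy.1.ne']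
  ring

theorem integrableOn_mixtureIntegrandU {σ : ℝ} (hσ : 0 < σ) (hσ1 : σ ≤ 1) {x : ℝ} (hx : 0 < x) :
    IntegrableOn (mixtureIntegrandU σ x) (Ioo 0 1) :=
  (((isMeanDensity_meanDensityU hσ hσ1).integrableOn_mixture hx).mono_set
    Ioo_subset_Ioi_self).congr_fun (fun _ hy => (mixtureIntegrandU_eq σ x hy).symm) measurableSet_Ioo

theorem mixtureDensityU_eq_expMixture (σ : ℝ) : mixtureDensityU σ = expMixture (meanDensityU σ) := by
  ext x
  by_cases hx : 0 < x
  · rw [mixtureDensityU, if_pos hx, expMixture, indicator_of_mem (mem_Ioi.2 hx),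
      setIntegral_eq_of_subset_of_forall_sdiff_eq_zero measurableSet_Ioi Ioo_subset_Ioi_self
        fun y hy => by rw [meanDensityU_of_notMem σ hy.2, mul_zero]]
    exact setIntegral_congr_fun measurableSet_Ioo fun y hy => mixtureIntegrandU_eq σ x hy
  · rw [mixtureDensityU, if_neg hx, expMixture, indicator_of_notMem (by simpa using hx)]

/-! ### The prior of the ratio of two exponential variables -/

theorem levyExponent_lawW {l : ℝ} (hl : 0 ≤ l) :
    Integrable (fun x => Real.log (1 + l * x)) lawW ∧ levyExponent lawW l = exponentW l :=
  levyExponent_of_lintegral lawW_ae_nonneg hl (exponentW_nonneg hl) (lintegral_log_lawW hl)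

theorem isMeanDensity_meanDensityW {σ : ℝ} (hσ : 0 < σ) (hσ1 : σ ≤ 1) :
    IsMeanDensity lawW σ (meanDensityW σ) where
  measurable := measurable_meanDensityW σ
  nonneg := meanDensityW_nonneg hσ hσ1
  eq_zero x hx := meanDensityW_of_notMem σ (not_lt.2 hx)
  stieltjes l hl := by
    rcases hl.eq_or_lt with rfl | hl0
    · simpa [levyExponent_zero] using lintegral_meanDensityW hσ hσ1
    · rw [lintegral_meanDensityW_mul hσ hσ1 hl0, (levyExponent_lawW hl).2]

theorem mixtureIntegrandW_eq (σ x : ℝ) {y : ℝ} (hy : y ∈ Ioi (0 : ℝ)) :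
    mixtureIntegrandW σ x y = Real.exp (-(x / y)) * y⁻¹ * meanDensityW σ y := by
  rw [mixtureIntegrandW, meanDensityW, if_pos (mem_Ioi.1 hy),
    show σ / (1 + y) - 2 = σ / (1 + y) - 1 - 1 by ring, Real.rpow_sub_one (ne_of_gt hy)]
  ring

theorem integrableOn_mixtureIntegrandW {σ : ℝ} (hσ : 0 < σ) (hσ1 : σ ≤ 1) {x : ℝ} (hx : 0 < x) :
    IntegrableOn (mixtureIntegrandW σ x) (Ioi 0) :=
  ((isMeanDensity_meanDensityW hσ hσ1).integrableOn_mixture hx).congr_fun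
    (fun _ hy => (mixtureIntegrandW_eq σ x hy).symm) measurableSet_Ioi

theorem mixtureDensityW_eq_expMixture (σ : ℝ) : mixtureDensityW σ = expMixture (meanDensityW σ) := by
  ext x
  by_cases hx : 0 < x
  · rw [mixtureDensityW, if_pos hx, expMixture, indicator_of_mem (mem_Ioi.2 hx)]
    exact setIntegral_congr_fun measurableSet_Ioi fun y hy => mixtureIntegrandW_eq σ x hy
  · rw [mixtureDensityW, if_neg hx, expMixture, indicator_of_notMem (by simpa using hx)]

end DirichletMeans

/-! ### The general results applied to the uniform prior and to the exponential-ratio prior. -/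

theorem proposition4p2 :
    -- the GGC(1, F_U) subordinator over a partition of (0, 1)
    (∀ (Ω : Type*) [MeasurableSpace Ω] (μ : Measure Ω) [IsProbabilityMeasure μ]
        (ζ : unitInterval → Ω → ℝ), DirichletMeans.IsGGCSubordinator ζ 1 DirichletMeans.lawU μ →
      ∀ (k : ℕ) (C : Fin k → Set ℝ), DirichletMeans.IsMeasurablePartition C (Ioo 0 1) →
        (∀ i, 0 < volume.real (C i)) →
        (∀ i, ∀ x : ℝ, 0 < x →
          IntegrableOn (DirichletMeans.mixtureIntegrandU (volume.real (C i)) x) (Ioo 0 1)) ∧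
        μ.map (fun ω i => DirichletMeans.increment ζ (C i) ω) =
          (volume : Measure (Fin k → ℝ)).withDensity (fun x => ENNReal.ofReal
            (∏ i, DirichletMeans.mixtureDensityU (volume.real (C i)) (x i))) ∧
        iIndepFun (fun i => DirichletMeans.increment ζ (C i)) μ ∧
        (∀ i, ∀ (Ω' : Type*) [MeasurableSpace Ω'] (μ' : Measure Ω') [IsProbabilityMeasure μ']
            (P : Ω' → Measure ℝ),
          DirichletMeans.IsDirichletProcess P 1
            (DirichletMeans.thinnedLaw DirichletMeans.lawU (volume.real (C i))) μ' →
          μ.map (DirichletMeans.increment ζ (C i)) =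
            (expMeasure 1).mconv (μ'.map (DirichletMeans.meanFunctional P)))) ∧
    -- the means M_1(F_{UY_σ}) and β_{σ,1-σ} M_σ(F_U)
    (∀ σ : ℝ, 0 < σ → σ ≤ 1 →
      (∀ (Ω' : Type*) [MeasurableSpace Ω'] (μ' : Measure Ω') [IsProbabilityMeasure μ']
          (P : Ω' → Measure ℝ),
        DirichletMeans.IsDirichletProcess P 1
          (DirichletMeans.thinnedLaw DirichletMeans.lawU σ) μ' →
        (∀ᵐ ω ∂μ', Integrable (fun x : ℝ => x) (P ω)) ∧
        μ'.map (DirichletMeans.meanFunctional P) =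
          volume.withDensity (fun y => ENNReal.ofReal (DirichletMeans.meanDensityU σ y))) ∧
      (∀ (Ω' : Type*) [MeasurableSpace Ω'] (μ' : Measure Ω') [IsProbabilityMeasure μ']
          (P : Ω' → Measure ℝ),
        DirichletMeans.IsDirichletProcess P σ DirichletMeans.lawU μ' →
        (∀ᵐ ω ∂μ', Integrable (fun x : ℝ => x) (P ω)) ∧
        (DirichletMeans.symmetricBetaLaw σ).mconv (μ'.map (DirichletMeans.meanFunctional P)) =
          volume.withDensity (fun y => ENNReal.ofReal (DirichletMeans.meanDensityU σ y)))) ∧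
    -- the GGC(1, F_W) subordinator over a partition of (0, 1)
    (∀ (Ω : Type*) [MeasurableSpace Ω] (μ : Measure Ω) [IsProbabilityMeasure μ]
        (ζ : unitInterval → Ω → ℝ), DirichletMeans.IsGGCSubordinator ζ 1 DirichletMeans.lawW μ →
      ∀ (k : ℕ) (C : Fin k → Set ℝ), DirichletMeans.IsMeasurablePartition C (Ioo 0 1) →
        (∀ i, 0 < volume.real (C i)) →
        (∀ i, ∀ x : ℝ, 0 < x →
          IntegrableOn (DirichletMeans.mixtureIntegrandW (volume.real (C i)) x) (Ioi 0)) ∧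
        μ.map (fun ω i => DirichletMeans.increment ζ (C i) ω) =
          (volume : Measure (Fin k → ℝ)).withDensity (fun x => ENNReal.ofReal
            (∏ i, DirichletMeans.mixtureDensityW (volume.real (C i)) (x i))) ∧
        iIndepFun (fun i => DirichletMeans.increment ζ (C i)) μ ∧
        (∀ i, ∀ (Ω' : Type*) [MeasurableSpace Ω'] (μ' : Measure Ω') [IsProbabilityMeasure μ']
            (P : Ω' → Measure ℝ),
          DirichletMeans.IsDirichletProcess P 1
            (DirichletMeans.thinnedLaw DirichletMeans.lawW (volume.real (C i))) μ' →
          μ.map (DirichletMeans.increment ζ (C i)) =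
            (expMeasure 1).mconv (μ'.map (DirichletMeans.meanFunctional P)))) ∧
    -- the means M_1(F_{WY_σ}) and β_{σ,1-σ} M_σ(F_W)
    (∀ σ : ℝ, 0 < σ → σ ≤ 1 →
      (∀ (Ω' : Type*) [MeasurableSpace Ω'] (μ' : Measure Ω') [IsProbabilityMeasure μ']
          (P : Ω' → Measure ℝ),
        DirichletMeans.IsDirichletProcess P 1
          (DirichletMeans.thinnedLaw DirichletMeans.lawW σ) μ' →
        (∀ᵐ ω ∂μ', Integrable (fun x : ℝ => x) (P ω)) ∧
        μ'.map (DirichletMeans.meanFunctional P) =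
          volume.withDensity (fun x => ENNReal.ofReal (DirichletMeans.meanDensityW σ x))) ∧
      (∀ (Ω' : Type*) [MeasurableSpace Ω'] (μ' : Measure Ω') [IsProbabilityMeasure μ']
          (P : Ω' → Measure ℝ),
        DirichletMeans.IsDirichletProcess P σ DirichletMeans.lawW μ' →
        (∀ᵐ ω ∂μ', Integrable (fun x : ℝ => x) (P ω)) ∧
        (DirichletMeans.symmetricBetaLaw σ).mconv (μ'.map (DirichletMeans.meanFunctional P)) =
          volume.withDensity (fun x => ENNReal.ofReal (DirichletMeans.meanDensityW σ x)))) := by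

  refine ⟨fun Ω _ μ _ ζ hζ k C hC hpos => ?_, fun σ hσ hσ1 => ⟨fun Ω _ μ _ P hP => ?_,
    fun Ω _ μ _ P hP => ?_⟩, fun Ω _ μ _ ζ hζ k C hC hpos => ?_, fun σ hσ hσ1 =>
    ⟨fun Ω _ μ _ P hP => ?_, fun Ω _ μ _ P hP => ?_⟩⟩
  · obtain ⟨hle, hlaw, hindep, hmarg⟩ := DirichletMeans.IsMeanDensity.increments
      DirichletMeans.lawU_ae_nonneg DirichletMeans.integrable_log_lawU
      (fun _ => DirichletMeans.isMeanDensity_meanDensityU) hζ hC hpos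
    refine ⟨fun i x => DirichletMeans.integrableOn_mixtureIntegrandU (hpos i) (hle i), ?_, hindep,
      hmarg⟩
    simpa only [DirichletMeans.mixtureDensityU_eq_expMixture] using hlaw
  · exact hP.map_meanFunctional_thinnedLaw hσ.le hσ1 DirichletMeans.lawU_ae_nonneg
      DirichletMeans.integrable_log_lawU (DirichletMeans.isMeanDensity_meanDensityU hσ hσ1)
  · exact hP.symmetricBetaLaw_mconv hσ hσ1 DirichletMeans.lawU_ae_nonneg
      DirichletMeans.integrable_log_lawU (DirichletMeans.isMeanDensity_meanDensityU hσ hσ1)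
  · obtain ⟨hle, hlaw, hindep, hmarg⟩ := DirichletMeans.IsMeanDensity.increments
      DirichletMeans.lawW_ae_nonneg (fun _ hl => (DirichletMeans.levyExponent_lawW hl).1)
      (fun _ => DirichletMeans.isMeanDensity_meanDensityW) hζ hC hpos
    refine ⟨fun i x => DirichletMeans.integrableOn_mixtureIntegrandW (hpos i) (hle i), ?_, hindep,
      hmarg⟩
    simpa only [DirichletMeans.mixtureDensityW_eq_expMixture] using hlaw
  · exact hP.map_meanFunctional_thinnedLaw hσ.le hσ1 DirichletMeans.lawW_ae_nonneg
      (fun _ hl => (DirichletMeans.levyExponent_lawW hl).1)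
      (DirichletMeans.isMeanDensity_meanDensityW hσ hσ1)
  · exact hP.symmetricBetaLaw_mconv hσ hσ1 DirichletMeans.lawW_ae_nonneg
      (fun _ hl => (DirichletMeans.levyExponent_lawW hl).1)
      (DirichletMeans.isMeanDensity_meanDensityW hσ hσ1)
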